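/- Let $(M,\mathfrak g)$ be a connected compact $C^\infty$ Riemannian manifold of dimension $d$, with Riemannian measure $\nu$ and Levi-Civita connection $\nabla$. For $1\le p<\infty$ let $\|X\|_p=(\int_M|X|_x^p\,\nu(dx))^{1/p}$ and, for $X\in C^\infty(TM)$, $\|X\|_{1,p}=\|X\|_p+(\int_M|\nabla X|_x^p\,\nu(dx))^{1/p}$; let $\mathbb H^p_1(TM)$ be the completion of $C^\infty(TM)$ for $\|\cdot\|_{1,p}$, regarded as a space of ($\nu$-a.e. defined) measurable vector fields. An integrable function $h$ is the divergence $\operatorname{div}X$ of an integrable vector field $X$ if $\int_M hf\,d\nu=-\int_M Xf\,d\nu$ for all $f\in C^\infty(M)$. Write $[a]^-=\max(-a,0)$. Fix a finite family of charts $(U_\alpha,\varphi_\alpha)_{\alpha\in\Lambda}$ of $M$, with coordinates $\xi^k_\alpha$, covering $M$, and a constant $\lambda>0$ such that $\lambda I\le(\mathfrak g(\partial_{\xi^i_\alpha},\partial_{\xi^j_\alpha}))_{ij}\le\lambda^{-1}I$ on $U_\alpha$ for every $\alpha$; a smooth partition of unity $(\psi_\alpha)$ with $\operatorname{supp}\psi_\alpha\subset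 U_\alpha$; and a smooth $\zeta:\mathbb R^d\to[0,\infty)$ that vanishes outside $\{|\xi|<1\}$, with $\int\zeta=1$. Put $\zeta_n(\xi)=n^d\zeta(n\xi)$. For a vector field $X$ with components $X^k_\alpha$ in the chart $\varphi_\alpha$ (so $X=X^k_\alpha\partial_{\xi^k_\alpha}$ on $U_\alpha$) define, for $n\ge1$, $$X^k_{\alpha,n}(x)=\int_{\varphi_\alpha(U_\alpha)}X^k_\alpha(\varphi_\alpha^{-1}(\xi))\,\zeta_n(\varphi_\alpha(x)-\xi)\,d\xi,\qquad X_n=\sum_\alpha\psi_\alpha X^k_{\alpha,n}\,\partial_{\xi^k_\alpha}.$$ Then: (1) for every $1\le p<\infty$ and every $X\in\mathbb H^p_1(TM)$, one has $X_n\in C^\infty(TM)$ for all $n\ge1$, and $\lim_{n\to\infty}\|X-X_n\|_{1,p}=0$; (2) there is a constant $C>0$, independent of $p$, $X$ and $n$, such that for every $1\le p<\infty$, every $X\in\mathbb H^p_1(TM)\cap L^\infty(TM)$ with $[\operatorname{div}X]^-\in L^\infty(M)$, and every $n\ge1$, $$\|[\operatorname{div}X_n]^-\|_{L^\infty(M)}\le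 C\big(\|[\operatorname{div}X]^-\|_{L^\infty(M)}+\|X\|_{L^\infty(TM)}\big).$$ -/

import Mathlib

open Bundle Filter MeasureTheory
open scoped Manifold ContDiff Topology ENNReal NNReal

noncomputable section

namespace RiemannianMollification

variable {d : ℕ} {M : Type*} [TopologicalSpace M] [ChartedSpace (EuclideanSpace ℝ (Fin d)) M]

/-- The local representative, in the chart `e`, of a vector field `X`: the vector in `ℝ^d` whose
`k`-th coordinate is the component `X^k` with `X = X^k ∂_{ξ^k}`, i.e. `X^k = dξ^k(X)`. -/
def chartComponents (e : OpenPartialHomeomorph M (EuclideanSpace ℝ (Fin d)))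
    (X : Π x : M, TangentSpace (𝓡 d) x) (x : M) : EuclideanSpace ℝ (Fin d) :=
  mvfderiv (𝓡 d) e x (X x)

/-- The tangent vector `w^k ∂_{ξ^k}` at `x`, for `x` in the domain of the chart `e` with
coordinates `ξ^k` and `w ∈ ℝ^d`. -/
def ofChartComponents (e : OpenPartialHomeomorph M (EuclideanSpace ℝ (Fin d)))
    (x : M) (w : EuclideanSpace ℝ (Fin d)) : TangentSpace (𝓡 d) x :=
  (mvfderiv (𝓡 d) e x).inverse w

/-- `X ∈ C^∞(TM)`. -/
def IsSmoothField [IsManifold (𝓡 d) ∞ M] (X : Π x : M, TangentSpace (𝓡 d) x) : Prop :=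
  ContMDiff (𝓡 d) (𝓡 d).tangent ∞ (fun x ↦ (⟨x, X x⟩ : TangentBundle (𝓡 d) M))

/-- The rescaled kernel `ζ_n(ξ) = n^d ζ(n ξ)`. -/
def rescaledKernel (ζ : EuclideanSpace ℝ (Fin d) → ℝ) (n : ℕ)
    (ξ : EuclideanSpace ℝ (Fin d)) : ℝ :=
  (n : ℝ) ^ d * ζ ((n : ℝ) • ξ)

/-- The components `X^k_{α,n}` (as a vector in `ℝ^d`) of the mollification of `X` in the chart
`e = φ_α`: `∫_{φ_α(U_α)} X^k_α(φ_α⁻¹(ξ)) ζ_n(φ_α(x) - ξ) dξ`. -/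
def mollifiedComponents (ζ : EuclideanSpace ℝ (Fin d) → ℝ) (n : ℕ)
    (e : OpenPartialHomeomorph M (EuclideanSpace ℝ (Fin d)))
    (X : Π x : M, TangentSpace (𝓡 d) x) (x : M) : EuclideanSpace ℝ (Fin d) :=
  ∫ ξ in e.target, rescaledKernel ζ n (e x - ξ) • chartComponents e X (e.symm ξ)

/-- The mollified vector field `X_n = ∑_α ψ_α X^k_{α,n} ∂_{ξ^k_α}`. -/
def mollifiedField {ι : Type*} [Fintype ι] (ζ : EuclideanSpace ℝ (Fin d) → ℝ)
    (φ : ι → OpenPartialHomeomorph M (EuclideanSpace ℝ (Fin d)))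
    (ψ : SmoothPartitionOfUnity ι (𝓡 d) M Set.univ)
    (X : Π x : M, TangentSpace (𝓡 d) x) (n : ℕ) (x : M) : TangentSpace (𝓡 d) x :=
  ∑ α, ψ α x • ofChartComponents (φ α) x (mollifiedComponents ζ n (φ α) X x)

variable [RiemannianBundle (fun x : M ↦ TangentSpace (𝓡 d) x)]

/-- The matrix `g_{ij} = g(∂_{ξ^i}, ∂_{ξ^j})` of the metric in the chart `e`, at `x`. -/
def metricMatrix (e : OpenPartialHomeomorph M (EuclideanSpace ℝ (Fin d))) (x : M) :
    Matrix (Fin d) (Fin d) ℝ :=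
  fun i j ↦ inner ℝ (ofChartComponents e x (EuclideanSpace.single i 1))
    (ofChartComponents e x (EuclideanSpace.single j 1))

/-- The measure on `M` carried by the domain of the chart `e` and given there by
`√(det g_{ij}) dξ`. -/
def chartMeasure [MeasurableSpace M]
    (e : OpenPartialHomeomorph M (EuclideanSpace ℝ (Fin d))) : Measure M :=
  Measure.map e.symm ((volume.restrict e.target).withDensity
    (fun ξ ↦ ENNReal.ofReal (Real.sqrt (metricMatrix e (e.symm ξ)).det)))

/-- The Riemannian measure `ν`. The measures `√(det g_{ij}) dξ` attached to the charts of the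
smooth structure agree on overlaps, so they are the restrictions of one measure to the chart
domains; that measure is their supremum. -/
def riemannianMeasure (d : ℕ) (M : Type*) [TopologicalSpace M]
    [ChartedSpace (EuclideanSpace ℝ (Fin d)) M] [MeasurableSpace M]
    [RiemannianBundle (fun x : M ↦ TangentSpace (𝓡 d) x)] : Measure M :=
  ⨆ e ∈ IsManifold.maximalAtlas (𝓡 d) ∞ M, chartMeasure (d := d) e

instance instFiniteDimensionalTangentSpace (x : M) : FiniteDimensional ℝ (TangentSpace (𝓡 d) x) :=
  inferInstanceAs (FiniteDimensional ℝ (EuclideanSpace ℝ (Fin d)))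

variable [IsManifold (𝓡 d) ∞ M]

/-- The Koszul formula for `g_x(∇_v X, w)`, where `∇` is the Levi-Civita connection: with `V`, `W`
local smooth extensions of `v`, `w` (the value does not depend on them),
`½ (V g(X,W) + X g(V,W) - W g(V,X) + g([V,X],W) - g([V,W],X) - g([X,W],V))`. -/
def koszul (X : Π x : M, TangentSpace (𝓡 d) x) (x : M) (v w : TangentSpace (𝓡 d) x) : ℝ :=
  let V : Π y : M, TangentSpace (𝓡 d) y := FiberBundle.extend (EuclideanSpace ℝ (Fin d)) v
  let W : Π y : M, TangentSpace (𝓡 d) y := FiberBundle.extend (EuclideanSpace ℝ (Fin d)) w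
  (1 / 2) * (mvfderiv (𝓡 d) (fun y ↦ (inner ℝ (X y) (W y) : ℝ)) x v
    + mvfderiv (𝓡 d) (fun y ↦ (inner ℝ (V y) (W y) : ℝ)) x (X x)
    - mvfderiv (𝓡 d) (fun y ↦ (inner ℝ (V y) (X y) : ℝ)) x w
    + inner ℝ (VectorField.mlieBracket (𝓡 d) V X x) w
    - inner ℝ (VectorField.mlieBracket (𝓡 d) V W x) (X x)
    - inner ℝ (VectorField.mlieBracket (𝓡 d) X W x) v)

/-- The Levi-Civita covariant derivative `∇_v X` at `x`: the tangent vector at `x` with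
`g_x(∇_v X, w) = koszul X x v w`, written in an orthonormal basis of `T_x M`. -/
def leviCivita (X : Π x : M, TangentSpace (𝓡 d) x) (x : M) (v : TangentSpace (𝓡 d) x) :
    TangentSpace (𝓡 d) x :=
  ∑ i, koszul X x v (stdOrthonormalBasis ℝ (TangentSpace (𝓡 d) x) i) •
    stdOrthonormalBasis ℝ (TangentSpace (𝓡 d) x) i

/-- The length `|∇X|_x` of the tensor `∇X` at `x`: `(∑_i |∇_{e_i} X|²)^{1/2}` for an orthonormal
basis `e_i` of `T_x M`. -/
def covDerivLength (X : Π x : M, TangentSpace (𝓡 d) x) (x : M) : ℝ :=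
  Real.sqrt (∑ i, ‖leviCivita X x (stdOrthonormalBasis ℝ (TangentSpace (𝓡 d) x) i)‖ ^ 2)

variable [MeasurableSpace M]

/-- The norm `‖X‖_p = (∫ |X|_x^p ν(dx))^{1/p}` (the essential supremum of `|X|` if `p = ∞`), with
values in `[0,∞]`. -/
def fieldLpNorm (p : ℝ≥0∞) (X : Π x : M, TangentSpace (𝓡 d) x) : ℝ≥0∞ :=
  eLpNorm (fun x ↦ ‖X x‖) p (riemannianMeasure d M)

/-- For smooth `X`, the norm `‖X‖_{1,p} = ‖X‖_p + ‖∇X‖_p`. -/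
def smoothSobolevNorm (p : ℝ≥0∞) (X : Π x : M, TangentSpace (𝓡 d) x) : ℝ≥0∞ :=
  fieldLpNorm p X + eLpNorm (covDerivLength X) p (riemannianMeasure d M)

/-- `X` is a (`ν`-almost everywhere defined) measurable vector field: its components in every
chart of the smooth structure are `ν`-measurable. -/
def IsMeasurableField (X : Π x : M, TangentSpace (𝓡 d) x) : Prop :=
  ∀ e ∈ IsManifold.maximalAtlas (𝓡 d) ∞ M,
    AEMeasurable (chartComponents e X) ((riemannianMeasure d M).restrict e.source)

/-- The sequence `Y` of smooth vector fields is Cauchy for `‖·‖_{1,p}` and converges in `L^p` to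
the measurable vector field `X`; that is, `Y` represents the element `X` of the completion of
`C^∞(TM)` for `‖·‖_{1,p}`. -/
def IsSobolevApprox (p : ℝ≥0∞) (X : Π x : M, TangentSpace (𝓡 d) x)
    (Y : ℕ → Π x : M, TangentSpace (𝓡 d) x) : Prop :=
  IsMeasurableField X ∧ (∀ j, IsSmoothField (Y j)) ∧
    Tendsto (fun ij : ℕ × ℕ ↦ smoothSobolevNorm p (fun x ↦ Y ij.1 x - Y ij.2 x)) atTop (𝓝 0) ∧
    Tendsto (fun j ↦ fieldLpNorm p (fun x ↦ Y j x - X x)) atTop (𝓝 0)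

/-- `X ∈ ℍ^p_1(TM)`, the completion of `C^∞(TM)` for `‖·‖_{1,p}`, realised inside the measurable
vector fields. -/
def MemSobolev (p : ℝ≥0∞) (X : Π x : M, TangentSpace (𝓡 d) x) : Prop :=
  ∃ Y : ℕ → Π x : M, TangentSpace (𝓡 d) x, IsSobolevApprox p X Y

/-- The norm of the completion: `‖X‖_{1,p} = lim_j ‖Y_j‖_{1,p}` for any sequence `Y` of smooth
fields representing `X` (the limit does not depend on `Y`); it is `∞` outside `ℍ^p_1(TM)`. -/
def sobolevNorm (p : ℝ≥0∞) (X : Π x : M, TangentSpace (𝓡 d) x) : ℝ≥0∞ :=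
  ⨅ (Y : ℕ → Π x : M, TangentSpace (𝓡 d) x) (_ : IsSobolevApprox p X Y),
    limsup (fun j ↦ smoothSobolevNorm p (Y j)) atTop

/-- `h = div X`, where the divergence is minus the adjoint of the gradient with respect to `ν`:
`X` and `h` are integrable and `∫ h f dν = - ∫ X f dν = - ∫ g(X, ∇f) dν` for all
`f ∈ C^∞(M)`. -/
def IsDivergence (X : Π x : M, TangentSpace (𝓡 d) x) (h : M → ℝ) : Prop :=
  IsMeasurableField X ∧ fieldLpNorm 1 X < ⊤ ∧ Integrable h (riemannianMeasure d M) ∧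
    ∀ f : M → ℝ, ContMDiff (𝓡 d) 𝓘(ℝ, ℝ) ∞ f →
      ∫ x, h x * f x ∂(riemannianMeasure d M)
        = - ∫ x, mvfderiv (𝓡 d) f x (X x) ∂(riemannianMeasure d M)

end RiemannianMollification

end

open RiemannianMollification

set_option linter.unusedSectionVars false

noncomputable section

namespace RiemannianMollification

/-! ### Differentials and vector fields in a chart -/

section ChartCalculus

/-! In coordinates the Koszul formula reads `g(∂_v X, w)` plus Christoffel terms, linear in the
components of `X` with coefficients given by first derivatives of the metric (`koszul_eq`). The
metric bounds make each chart bilipschitz, and derivatives of the metric are bounded on compact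
parts of a chart. There, `‖·‖_{1,p}` is therefore comparable with the Euclidean `W^{1,p}` norm of
the components, in the two directions needed: `exists_smoothSobolevNorm_assembleField_le` and
`exists_localSobolevNorm_chartRep_le`. The densities `√(det g)` lie between `κ^{-d}` and `κ^d`, so
`L^p` norms pass between `M` and the charts.

Convergence: since `X = ∑ ψ_α X`, the error `X - X_n` is assembled from the errors of mollifying
components. At distance at least `1/n` from the boundary of the chart, mollification commutes with
differentiation and is an `L^p` contraction up to enlarging the domain. As `X` is only a limit of
smooth fields `Y_j`, one splits the components of `Y_j - X_n` into those of `Y_j - Y_m`, the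
mollification error of `Y_m`, and the mollifications of `Y_m - Y_i` and of `Y_i - X`. The Cauchy
property controls the first and third terms uniformly in `n`; uniform continuity of `Y_m` and of its
derivative controls the second. The last needs only `Y_i → X` in `L^p`: for fixed `n` mollification
sends `L^1` into `C^1`, and `i → ∞` is taken before `n → ∞`. This is
`tendsto_sobolevNorm_sub_mollifiedField`.

Divergence: write `ρ = √(det g)`. The divergence of `ψ u^k ∂_k` is `ψ ∂_k u^k + dψ(u) + ψ ρ⁻¹
dρ(u)`, so a lower bound on the Euclidean divergence of the mollified components suffices. Testing
`div X = h` with `k(η - ·)/ρ` shows that this divergence at `η` is the average of `h` against the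
kernel `k`, minus the average of `ρ⁻¹ dρ(X)`; both averages are controlled
(`exists_neg_le_euclideanDiv_mollify`). The test function must live inside the chart, which holds
once `1/n ≤ δ`. The finitely many remaining `n` are covered by the crude `L^1`-to-`C^1` bound. -/

theorem two_le_infty : (2 : WithTop ℕ∞) ≤ ((⊤ : ℕ∞) : WithTop ℕ∞) := by
  have : ((2 : ℕ∞) : WithTop ℕ∞) ≤ ((⊤ : ℕ∞) : WithTop ℕ∞) := WithTop.coe_le_coe.2 le_top
  exact this

variable {d : ℕ} {M : Type*} [TopologicalSpace M] [ChartedSpace (EuclideanSpace ℝ (Fin d)) M]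
  [IsManifold (𝓡 d) ∞ M]
  {e : OpenPartialHomeomorph M (EuclideanSpace ℝ (Fin d))}

theorem mdifferentiable_of_mem_maximalAtlas (he : e ∈ IsManifold.maximalAtlas (𝓡 d) ∞ M) :
    e.MDifferentiable (𝓡 d) (𝓡 d) :=
  ⟨(contMDiffOn_of_mem_maximalAtlas he).mdifferentiableOn (by simp),
    (contMDiffOn_symm_of_mem_maximalAtlas he).mdifferentiableOn (by simp)⟩

theorem mfderiv_symm_comp_mvfderiv (he : e ∈ IsManifold.maximalAtlas (𝓡 d) ∞ M) {x : M}
    (hx : x ∈ e.source) (v : TangentSpace (𝓡 d) x) :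
    mfderiv (𝓡 d) (𝓡 d) e.symm (e x) (mvfderiv (𝓡 d) e x v) = v := by
  have := (mdifferentiable_of_mem_maximalAtlas he).symm_comp_deriv hx
  exact DFunLike.congr_fun this v

theorem mvfderiv_comp_mfderiv_symm (he : e ∈ IsManifold.maximalAtlas (𝓡 d) ∞ M) {x : M}
    (hx : x ∈ e.source) (w : EuclideanSpace ℝ (Fin d)) :
    mvfderiv (𝓡 d) e x (mfderiv (𝓡 d) (𝓡 d) e.symm (e x) w) = w := by
  have := (mdifferentiable_of_mem_maximalAtlas he).comp_symm_deriv (e.map_source hx)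
  rw [e.left_inv hx] at this
  exact DFunLike.congr_fun this w

/-- The differential of a chart, as a continuous linear equivalence. -/
def chartEquiv (he : e ∈ IsManifold.maximalAtlas (𝓡 d) ∞ M) {x : M} (hx : x ∈ e.source) :
    TangentSpace (𝓡 d) x ≃L[ℝ] EuclideanSpace ℝ (Fin d) :=
  ContinuousLinearEquiv.equivOfInverse (mvfderiv (𝓡 d) e x)
    (mfderiv (𝓡 d) (𝓡 d) e.symm (e x))
    (mfderiv_symm_comp_mvfderiv he hx) (mvfderiv_comp_mfderiv_symm he hx)

theorem coe_chartEquiv (he : e ∈ IsManifold.maximalAtlas (𝓡 d) ∞ M) {x : M}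
    (hx : x ∈ e.source) :
    (chartEquiv he hx : TangentSpace (𝓡 d) x →L[ℝ] EuclideanSpace ℝ (Fin d))
      = mvfderiv (𝓡 d) e x := rfl

theorem ofChartComponents_eq (he : e ∈ IsManifold.maximalAtlas (𝓡 d) ∞ M) {x : M}
    (hx : x ∈ e.source) (w : EuclideanSpace ℝ (Fin d)) :
    ofChartComponents e x w = (chartEquiv he hx).symm w := by
  rw [ofChartComponents, ← coe_chartEquiv he hx, ContinuousLinearMap.inverse_equiv]
  rfl

theorem ofChartComponents_eq_mfderiv_symm (he : e ∈ IsManifold.maximalAtlas (𝓡 d) ∞ M) {x : M}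
    (hx : x ∈ e.source) (w : EuclideanSpace ℝ (Fin d)) :
    ofChartComponents e x w = mfderiv (𝓡 d) (𝓡 d) e.symm (e x) w := by
  rw [ofChartComponents_eq he hx]
  rfl

theorem ofChartComponents_mvfderiv (he : e ∈ IsManifold.maximalAtlas (𝓡 d) ∞ M) {x : M}
    (hx : x ∈ e.source) (v : TangentSpace (𝓡 d) x) :
    ofChartComponents e x (mvfderiv (𝓡 d) e x v) = v := by
  rw [ofChartComponents_eq he hx]
  exact (chartEquiv he hx).symm_apply_apply v

theorem mvfderiv_ofChartComponents (he : e ∈ IsManifold.maximalAtlas (𝓡 d) ∞ M) {x : M}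
    (hx : x ∈ e.source) (w : EuclideanSpace ℝ (Fin d)) :
    mvfderiv (𝓡 d) e x (ofChartComponents e x w) = w := by
  rw [ofChartComponents_eq he hx]
  exact (chartEquiv he hx).apply_symm_apply w

theorem ofChartComponents_sub (x : M) (v w : EuclideanSpace ℝ (Fin d)) :
    ofChartComponents e x (v - w) = ofChartComponents e x v - ofChartComponents e x w :=
  map_sub _ _ _

/-- The representative of a vector field in the coordinates of a chart. -/
def chartRep (e : OpenPartialHomeomorph M (EuclideanSpace ℝ (Fin d)))
    (X : Π x : M, TangentSpace (𝓡 d) x) (ξ : EuclideanSpace ℝ (Fin d)) :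
    EuclideanSpace ℝ (Fin d) :=
  chartComponents e X (e.symm ξ)

theorem chartRep_apply {x : M} (hx : x ∈ e.source) (X : Π x : M, TangentSpace (𝓡 d) x) :
    chartRep e X (e x) = mvfderiv (𝓡 d) e x (X x) := by
  rw [chartRep, e.left_inv hx, chartComponents]

theorem mfderiv_symm_comp_mvfderiv_symm (he : e ∈ IsManifold.maximalAtlas (𝓡 d) ∞ M)
    {ξ : EuclideanSpace ℝ (Fin d)} (hξ : ξ ∈ e.target) :
    (mfderiv (𝓡 d) (𝓡 d) e.symm ξ).comp (mfderiv (𝓡 d) (𝓡 d) e (e.symm ξ))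
      = ContinuousLinearMap.id ℝ _ := by
  have h := (mdifferentiable_of_mem_maximalAtlas he).symm_comp_deriv (e.map_target hξ)
  rw [e.right_inv hξ] at h
  exact h

theorem inverse_mfderiv_symm (he : e ∈ IsManifold.maximalAtlas (𝓡 d) ∞ M)
    {ξ : EuclideanSpace ℝ (Fin d)} (hξ : ξ ∈ e.target) :
    (mfderiv (𝓡 d) (𝓡 d) e.symm ξ).inverse = mfderiv (𝓡 d) (𝓡 d) e (e.symm ξ) :=
  ContinuousLinearMap.inverse_eq (mfderiv_symm_comp_mvfderiv_symm he hξ)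
    ((mdifferentiable_of_mem_maximalAtlas he).comp_symm_deriv hξ)

theorem mpullback_symm_eq_chartRep (he : e ∈ IsManifold.maximalAtlas (𝓡 d) ∞ M)
    (X : Π x : M, TangentSpace (𝓡 d) x) {ξ : EuclideanSpace ℝ (Fin d)} (hξ : ξ ∈ e.target) :
    VectorField.mpullback (𝓡 d) (𝓡 d) e.symm X ξ = chartRep e X ξ := by
  rw [VectorField.mpullback, inverse_mfderiv_symm he hξ]
  rfl

theorem isInvertible_mfderiv_symm (he : e ∈ IsManifold.maximalAtlas (𝓡 d) ∞ M)
    {ξ : EuclideanSpace ℝ (Fin d)} (hξ : ξ ∈ e.target) :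
    (mfderiv (𝓡 d) (𝓡 d) e.symm ξ).IsInvertible :=
  ContinuousLinearMap.IsInvertible.of_inverse (mfderiv_symm_comp_mvfderiv_symm he hξ)
    ((mdifferentiable_of_mem_maximalAtlas he).comp_symm_deriv hξ)

theorem isInvertible_mfderiv (he : e ∈ IsManifold.maximalAtlas (𝓡 d) ∞ M) {x : M}
    (hx : x ∈ e.source) : (mfderiv (𝓡 d) (𝓡 d) e x).IsInvertible :=
  ⟨chartEquiv he hx, rfl⟩

theorem contMDiffAt_vectorSpace_iff
    {u : Π ξ : EuclideanSpace ℝ (Fin d), TangentSpace (𝓡 d) ξ} {ξ : EuclideanSpace ℝ (Fin d)} :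
    ContMDiffAt (𝓡 d) (𝓡 d).tangent ∞
      (fun η ↦ (⟨η, u η⟩ : TangentBundle (𝓡 d) (EuclideanSpace ℝ (Fin d)))) ξ
      ↔ ContDiffAt (F := EuclideanSpace ℝ (Fin d)) ℝ ∞ u ξ := by
  exact contMDiffAt_vectorSpace_iff_contDiffAt

theorem chartRep_eventuallyEq_mpullback (he : e ∈ IsManifold.maximalAtlas (𝓡 d) ∞ M)
    (X : Π x : M, TangentSpace (𝓡 d) x) {ξ : EuclideanSpace ℝ (Fin d)} (hξ : ξ ∈ e.target) :
    chartRep e X =ᶠ[𝓝 ξ] VectorField.mpullback (𝓡 d) (𝓡 d) e.symm X := by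
  filter_upwards [e.open_target.mem_nhds hξ] with η hη
  exact (mpullback_symm_eq_chartRep he X hη).symm

/-- Near `ξ` the components are the pullback of the field by the inverse chart, and pullback by a
local diffeomorphism preserves smoothness. -/
theorem contDiffAt_chartRep (he : e ∈ IsManifold.maximalAtlas (𝓡 d) ∞ M)
    {X : Π x : M, TangentSpace (𝓡 d) x} {ξ : EuclideanSpace ℝ (Fin d)} (hξ : ξ ∈ e.target)
    (hX : ContMDiffAt (𝓡 d) (𝓡 d).tangent ∞
      (fun y ↦ (⟨y, X y⟩ : TangentBundle (𝓡 d) M)) (e.symm ξ)) :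
    ContDiffAt ℝ ∞ (chartRep e X) ξ := by
  have h := ContMDiffAt.mpullback_vectorField_preimage (n := ∞) hX
    (contMDiffAt_symm_of_mem_maximalAtlas he hξ) (isInvertible_mfderiv_symm he hξ) (by simp)
  exact (contMDiffAt_vectorSpace_iff.1 h).congr_of_eventuallyEq
    (chartRep_eventuallyEq_mpullback he X hξ)

theorem contDiffOn_chartRep (he : e ∈ IsManifold.maximalAtlas (𝓡 d) ∞ M)
    {X : Π x : M, TangentSpace (𝓡 d) x} (hX : IsSmoothField X) :
    ContDiffOn ℝ ∞ (chartRep e X) e.target :=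
  fun _ hξ ↦ (contDiffAt_chartRep he hξ (hX _)).contDiffWithinAt

theorem differentiableAt_chartRep (he : e ∈ IsManifold.maximalAtlas (𝓡 d) ∞ M)
    {X : Π x : M, TangentSpace (𝓡 d) x} {ξ : EuclideanSpace ℝ (Fin d)} (hξ : ξ ∈ e.target)
    (hX : MDifferentiableAt (𝓡 d) (𝓡 d).tangent
      (fun y ↦ (⟨y, X y⟩ : TangentBundle (𝓡 d) M)) (e.symm ξ)) :
    DifferentiableAt ℝ (chartRep e X) ξ := by
  have h := MDifferentiableAt.mpullback_vectorField (n := ∞) hX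
    (contMDiffAt_symm_of_mem_maximalAtlas he hξ) (isInvertible_mfderiv_symm he hξ)
    two_le_infty
  have h' := ((contMDiff_snd_tangentBundle_modelSpace (EuclideanSpace ℝ (Fin d))
    (𝓡 d)).contMDiffAt.mdifferentiableAt one_ne_zero).comp ξ h
  exact h'.differentiableAt.congr_of_eventuallyEq (chartRep_eventuallyEq_mpullback he X hξ)

/-- The converse direction: this field is the pullback by `e` of the Euclidean field `u`. -/
theorem contMDiffAt_ofChartComponents (he : e ∈ IsManifold.maximalAtlas (𝓡 d) ∞ M)
    {u : EuclideanSpace ℝ (Fin d) → EuclideanSpace ℝ (Fin d)} {x : M} (hx : x ∈ e.source)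
    (hu : ContDiffAt ℝ ∞ u (e x)) :
    ContMDiffAt (𝓡 d) (𝓡 d).tangent ∞
      (fun y ↦ (⟨y, ofChartComponents e y (u (e y))⟩ : TangentBundle (𝓡 d) M)) x := by
  have hu' : ContMDiffAt (𝓡 d) (𝓡 d).tangent ∞
      (fun η ↦ (⟨η, u η⟩ : TangentBundle (𝓡 d) (EuclideanSpace ℝ (Fin d)))) (e x) :=
    contMDiffAt_vectorSpace_iff.2 hu
  exact ContMDiffAt.mpullback_vectorField_preimage (n := ∞) hu'
    (contMDiffAt_of_mem_maximalAtlas he hx) (isInvertible_mfderiv he hx) (by simp)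

end ChartCalculus

/-! ### Operator norms on linear and bilinear forms -/

section FormInstances

variable {d : ℕ}

instance instNormedAddCommGroupDual : NormedAddCommGroup (EuclideanSpace ℝ (Fin d) →L[ℝ] ℝ) :=
  ContinuousLinearMap.toNormedAddCommGroup

instance instNormedAddCommGroupForm : NormedAddCommGroup
    (EuclideanSpace ℝ (Fin d) →L[ℝ] EuclideanSpace ℝ (Fin d) →L[ℝ] ℝ) :=
  ContinuousLinearMap.toNormedAddCommGroup

instance instSeminormedAddCommGroupForm : SeminormedAddCommGroup
    (EuclideanSpace ℝ (Fin d) →L[ℝ] EuclideanSpace ℝ (Fin d) →L[ℝ] ℝ) :=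
  ContinuousLinearMap.toSeminormedAddCommGroup

instance instNormedSpaceForm : NormedSpace ℝ
    (EuclideanSpace ℝ (Fin d) →L[ℝ] EuclideanSpace ℝ (Fin d) →L[ℝ] ℝ) :=
  ContinuousLinearMap.toNormedSpace

end FormInstances

/-! ### The metric, Lie brackets and the Koszul formula in coordinates -/

section MetricForm

variable {d : ℕ} {M : Type*} [TopologicalSpace M] [ChartedSpace (EuclideanSpace ℝ (Fin d)) M]
  [IsManifold (𝓡 d) ∞ M]
  {e : OpenPartialHomeomorph M (EuclideanSpace ℝ (Fin d))}

theorem mvfderiv_eq_fderiv_comp_symm (he : e ∈ IsManifold.maximalAtlas (𝓡 d) ∞ M) {x : M}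
    (hx : x ∈ e.source) {f : M → ℝ}
    (hf : MDifferentiableAt (𝓡 d) 𝓘(ℝ, ℝ) f x) (v : TangentSpace (𝓡 d) x) :
    mvfderiv (𝓡 d) f x v = fderiv ℝ (f ∘ e.symm) (e x) (mvfderiv (𝓡 d) e x v) := by
  have hs : MDifferentiableAt (𝓡 d) (𝓡 d) e.symm (e x) :=
    (mdifferentiable_of_mem_maximalAtlas he).mdifferentiableAt_symm (e.map_source hx)
  have h := mvfderiv_comp_apply_of_eq (e x) hf hs (e.left_inv hx) (mvfderiv (𝓡 d) e x v)
  rw [mfderiv_symm_comp_mvfderiv he hx] at h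
  rw [← h, mvfderiv, mfderiv_eq_fderiv]
  rfl

/-- The Lie bracket commutes with pullback by the inverse chart, and on `ℝ^d` it is `DW(V) - DV(W)`.
-/
theorem chartRep_mlieBracket (he : e ∈ IsManifold.maximalAtlas (𝓡 d) ∞ M) {x : M}
    (hx : x ∈ e.source) {V W : Π x : M, TangentSpace (𝓡 d) x}
    (hV : MDifferentiableAt (𝓡 d) (𝓡 d).tangent
      (fun y ↦ (⟨y, V y⟩ : TangentBundle (𝓡 d) M)) x)
    (hW : MDifferentiableAt (𝓡 d) (𝓡 d).tangent
      (fun y ↦ (⟨y, W y⟩ : TangentBundle (𝓡 d) M)) x) :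
    mvfderiv (𝓡 d) e x (VectorField.mlieBracket (𝓡 d) V W x)
      = fderiv ℝ (chartRep e W) (e x) (chartRep e V (e x))
        - fderiv ℝ (chartRep e V) (e x) (chartRep e W (e x)) := by
  have hξ := e.map_source hx
  rw [← chartRep_apply hx, ← mpullback_symm_eq_chartRep he _ hξ]
  rw [← e.left_inv hx] at hV hW
  have : IsManifold (𝓡 d) (minSmoothness ℝ 2) M := by
    rw [minSmoothness_of_isRCLikeNormedField]; infer_instance
  rw [VectorField.mpullback_mlieBracket (n := ∞) hV hW (contMDiffAt_symm_of_mem_maximalAtlas he hξ)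
    (by rw [minSmoothness_of_isRCLikeNormedField]; exact two_le_infty)]
  rw [← VectorField.mlieBracketWithin_univ, VectorField.mlieBracketWithin_eq_lieBracketWithin]
  exact (congrFun VectorField.lieBracketWithin_univ _).trans
    ((chartRep_eventuallyEq_mpullback he V hξ).symm.lieBracket_vectorField_eq
      (chartRep_eventuallyEq_mpullback he W hξ).symm)

variable [RiemannianBundle (fun x : M ↦ TangentSpace (𝓡 d) x)]

/-- The metric in the coordinates of a chart, as a bilinear form depending on the coordinates. -/
def metricForm (e : OpenPartialHomeomorph M (EuclideanSpace ℝ (Fin d)))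
    (ξ : EuclideanSpace ℝ (Fin d)) :
    EuclideanSpace ℝ (Fin d) →L[ℝ] EuclideanSpace ℝ (Fin d) →L[ℝ] ℝ :=
  ∑ i, ∑ j, metricMatrix e (e.symm ξ) i j •
    (EuclideanSpace.proj (𝕜 := ℝ) i).smulRight
      (EuclideanSpace.proj (𝕜 := ℝ) j)

theorem metricForm_apply (ξ a b : EuclideanSpace ℝ (Fin d)) :
    metricForm e ξ a b
      = inner ℝ (ofChartComponents e (e.symm ξ) a) (ofChartComponents e (e.symm ξ) b) := by
  have h (c : EuclideanSpace ℝ (Fin d)) : ofChartComponents e (e.symm ξ) c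
      = ∑ i, c i • ofChartComponents e (e.symm ξ) (EuclideanSpace.single i 1) := by
    conv_lhs => rw [← (EuclideanSpace.basisFun (Fin d) ℝ).sum_repr c]
    simp only [ofChartComponents, map_sum, map_smul, EuclideanSpace.basisFun_repr,
      EuclideanSpace.basisFun_apply]
  rw [h a, h b, sum_inner]
  simp only [inner_sum, inner_smul_left, inner_smul_right, metricForm, metricMatrix,
    _root_.sum_apply, _root_.smul_apply, ContinuousLinearMap.smulRight_apply, smul_eq_mul]
  refine Finset.sum_congr rfl fun i _ ↦ Finset.sum_congr rfl fun j _ ↦ ?_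
  simp
  ring

theorem inner_eq_metricForm (he : e ∈ IsManifold.maximalAtlas (𝓡 d) ∞ M) {x : M}
    (hx : x ∈ e.source) (v w : TangentSpace (𝓡 d) x) :
    inner ℝ v w = metricForm e (e x) (mvfderiv (𝓡 d) e x v) (mvfderiv (𝓡 d) e x w) := by
  rw [metricForm_apply, e.left_inv hx, ofChartComponents_mvfderiv he hx,
    ofChartComponents_mvfderiv he hx]

theorem metricForm_symm (ξ a b : EuclideanSpace ℝ (Fin d)) :
    metricForm e ξ a b = metricForm e ξ b a := by
  rw [metricForm_apply, metricForm_apply, real_inner_comm]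

variable [IsContMDiffRiemannianBundle (𝓡 d) ∞ (EuclideanSpace ℝ (Fin d))
      (fun x : M ↦ TangentSpace (𝓡 d) x)]

/-- The entries are inner products of coordinate fields, which are smooth as fields with constant
components. -/
theorem contDiffOn_metricMatrix (he : e ∈ IsManifold.maximalAtlas (𝓡 d) ∞ M) (i j : Fin d) :
    ContDiffOn ℝ ∞ (fun ξ ↦ metricMatrix e (e.symm ξ) i j) e.target := by
  intro ξ hξ
  have hx := e.map_target hξ
  have h (k : Fin d) := contMDiffAt_ofChartComponents he hx
    (contDiffAt_const (c := EuclideanSpace.single k (1 : ℝ)))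
  have h2 : ContMDiffAt (𝓡 d) 𝓘(ℝ, ℝ) ∞ (fun y ↦ metricMatrix e y i j) (e.symm ξ) :=
    (h i).inner_bundle (h j)
  exact (h2.comp ξ (contMDiffAt_symm_of_mem_maximalAtlas he hξ)).contDiffAt.contDiffWithinAt

theorem contDiffOn_metricForm (he : e ∈ IsManifold.maximalAtlas (𝓡 d) ∞ M) :
    ContDiffOn ℝ ∞ (metricForm e) e.target :=
  ContDiffOn.sum fun i _ ↦ ContDiffOn.sum fun j _ ↦
    (ContinuousLinearMap.toSpanSingleton ℝ _).contDiff.comp_contDiffOn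
      (contDiffOn_metricMatrix he i j)

theorem differentiableAt_metricForm (he : e ∈ IsManifold.maximalAtlas (𝓡 d) ∞ M)
    {ξ : EuclideanSpace ℝ (Fin d)} (hξ : ξ ∈ e.target) :
    DifferentiableAt ℝ (metricForm e) ξ :=
  ((contDiffOn_metricForm he).contDiffAt (e.open_target.mem_nhds hξ)).differentiableAt (by simp)

/-- Leibniz rule for `g_ξ(V(ξ), W(ξ))`: one term for the metric and one for each field. With it the
Koszul formula becomes algebra in the components. -/
theorem mvfderiv_inner (he : e ∈ IsManifold.maximalAtlas (𝓡 d) ∞ M) {x : M}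
    (hx : x ∈ e.source) {V W : Π x : M, TangentSpace (𝓡 d) x}
    (hV : MDifferentiableAt (𝓡 d) (𝓡 d).tangent
      (fun y ↦ (⟨y, V y⟩ : TangentBundle (𝓡 d) M)) x)
    (hW : MDifferentiableAt (𝓡 d) (𝓡 d).tangent
      (fun y ↦ (⟨y, W y⟩ : TangentBundle (𝓡 d) M)) x) (v : TangentSpace (𝓡 d) x) :
    mvfderiv (𝓡 d) (fun y ↦ (inner ℝ (V y) (W y) : ℝ)) x v
      = fderiv ℝ (metricForm e) (e x) (mvfderiv (𝓡 d) e x v)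
          (chartRep e V (e x)) (chartRep e W (e x))
        + metricForm e (e x) (fderiv ℝ (chartRep e V) (e x) (mvfderiv (𝓡 d) e x v))
          (chartRep e W (e x))
        + metricForm e (e x) (chartRep e V (e x))
          (fderiv ℝ (chartRep e W) (e x) (mvfderiv (𝓡 d) e x v)) := by
  have hξ := e.map_source hx
  have : IsContMDiffRiemannianBundle (𝓡 d) 1 (EuclideanSpace ℝ (Fin d))
      (fun x : M ↦ TangentSpace (𝓡 d) x) := IsContMDiffRiemannianBundle.of_le (n := ∞)
        (le_trans one_le_two two_le_infty)
  have hVW : MDifferentiableAt (𝓡 d) 𝓘(ℝ, ℝ) (fun y ↦ (inner ℝ (V y) (W y) : ℝ)) x :=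
    hV.inner_bundle hW
  have hev : (fun y ↦ (inner ℝ (V y) (W y) : ℝ)) ∘ e.symm =ᶠ[𝓝 (e x)]
      fun η ↦ metricForm e η (chartRep e V η) (chartRep e W η) := by
    filter_upwards [e.open_target.mem_nhds hξ] with η hη
    simp only [Function.comp_apply]
    rw [inner_eq_metricForm he (e.map_target hη), e.right_inv hη]
    rfl
  have hV' := hV
  have hW' := hW
  rw [← e.left_inv hx] at hV' hW'
  have h1 := (differentiableAt_metricForm he hξ).hasFDerivAt
  have h2 := (differentiableAt_chartRep he hξ hV').hasFDerivAt
  have h3 := (differentiableAt_chartRep he hξ hW').hasFDerivAt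
  rw [mvfderiv_eq_fderiv_comp_symm he hx hVW, hev.fderiv_eq,
    ((h1.clm_apply h2).clm_apply h3).fderiv]
  simp only [_root_.add_apply, ContinuousLinearMap.comp_apply,
    ContinuousLinearMap.flip_apply]
  ring

/-- The derivatives of the auxiliary extensions of `v` and `w` cancel between the derivatives of
inner products and the brackets. What survives is the derivative of the components of `X` and the
Christoffel symbols of the first kind, so the result is independent of the extensions. -/
theorem koszul_eq (he : e ∈ IsManifold.maximalAtlas (𝓡 d) ∞ M) {x : M}
    (hx : x ∈ e.source) {X : Π x : M, TangentSpace (𝓡 d) x}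
    (hX : MDifferentiableAt (𝓡 d) (𝓡 d).tangent
      (fun y ↦ (⟨y, X y⟩ : TangentBundle (𝓡 d) M)) x) (v w : TangentSpace (𝓡 d) x) :
    koszul X x v w
      = metricForm e (e x) (fderiv ℝ (chartRep e X) (e x) (mvfderiv (𝓡 d) e x v))
          (mvfderiv (𝓡 d) e x w)
        + (1 / 2) * (fderiv ℝ (metricForm e) (e x) (mvfderiv (𝓡 d) e x v)
            (chartRep e X (e x)) (mvfderiv (𝓡 d) e x w)
          + fderiv ℝ (metricForm e) (e x) (chartRep e X (e x))
            (mvfderiv (𝓡 d) e x v) (mvfderiv (𝓡 d) e x w)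
          - fderiv ℝ (metricForm e) (e x) (mvfderiv (𝓡 d) e x w)
            (mvfderiv (𝓡 d) e x v) (chartRep e X (e x))) := by
  have hV : MDifferentiableAt (𝓡 d) (𝓡 d).tangent
      (fun y ↦ (⟨y, FiberBundle.extend (EuclideanSpace ℝ (Fin d)) v y⟩ :
        TangentBundle (𝓡 d) M)) x := FiberBundle.mdifferentiableAt_extend ..
  have hW : MDifferentiableAt (𝓡 d) (𝓡 d).tangent
      (fun y ↦ (⟨y, FiberBundle.extend (EuclideanSpace ℝ (Fin d)) w y⟩ :
        TangentBundle (𝓡 d) M)) x := FiberBundle.mdifferentiableAt_extend ..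
  have hv : chartRep e (FiberBundle.extend (EuclideanSpace ℝ (Fin d)) v) (e x)
      = mvfderiv (𝓡 d) e x v := by
    rw [chartRep_apply hx, FiberBundle.extend_apply_self]
  have hw : chartRep e (FiberBundle.extend (EuclideanSpace ℝ (Fin d)) w) (e x)
      = mvfderiv (𝓡 d) e x w := by
    rw [chartRep_apply hx, FiberBundle.extend_apply_self]
  rw [koszul]
  rw [mvfderiv_inner he hx hX hW, mvfderiv_inner he hx hV hW, mvfderiv_inner he hx hV hX,
    inner_eq_metricForm he hx (VectorField.mlieBracket (𝓡 d) _ X x),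
    inner_eq_metricForm he hx (VectorField.mlieBracket (𝓡 d) _ _ x) (X x),
    inner_eq_metricForm he hx (VectorField.mlieBracket (𝓡 d) X _ x),
    chartRep_mlieBracket he hx hV hX, chartRep_mlieBracket he hx hV hW,
    chartRep_mlieBracket he hx hX hW, hv, hw, ← chartRep_apply hx X]
  simp only [map_sub, _root_.sub_apply]
  -- Symmetry of the metric brings the cancelling terms to the same form.
  rw [metricForm_symm (e x) (chartRep e X (e x)) (fderiv ℝ _ _ _),
    metricForm_symm (e x) (mvfderiv (𝓡 d) e x v) (fderiv ℝ _ _ _),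
    metricForm_symm (e x) (mvfderiv (𝓡 d) e x v) (fderiv ℝ _ _ _)]
  ring

end MetricForm

/-! ### Pointwise comparison of the covariant derivative with derivatives of components -/

section PointwiseBounds

variable {d : ℕ} {M : Type*} [TopologicalSpace M] [ChartedSpace (EuclideanSpace ℝ (Fin d)) M]
  [IsManifold (𝓡 d) ∞ M] [RiemannianBundle (fun x : M ↦ TangentSpace (𝓡 d) x)]
  {e : OpenPartialHomeomorph M (EuclideanSpace ℝ (Fin d))}

/-- The differential of the chart `e` and its inverse are bounded by `κ` for the Riemannian and
Euclidean norms. -/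
def IsBilipschitzChart (e : OpenPartialHomeomorph M (EuclideanSpace ℝ (Fin d))) (κ : ℝ) : Prop :=
  ∀ x ∈ e.source, ∀ v : TangentSpace (𝓡 d) x,
    ‖mvfderiv (𝓡 d) e x v‖ ≤ κ * ‖v‖ ∧ ‖v‖ ≤ κ * ‖mvfderiv (𝓡 d) e x v‖

theorem isBilipschitzChart_of_metric_bounds (he : e ∈ IsManifold.maximalAtlas (𝓡 d) ∞ M)
    {lam : ℝ} (hlam : 0 < lam)
    (hmetric : ∀ x ∈ e.source, ∀ w : EuclideanSpace ℝ (Fin d),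
      lam * ‖w‖ ^ 2 ≤ ‖ofChartComponents e x w‖ ^ 2 ∧
        ‖ofChartComponents e x w‖ ^ 2 ≤ lam⁻¹ * ‖w‖ ^ 2) :
    IsBilipschitzChart e (Real.sqrt lam⁻¹) := by
  intro x hx v
  have h := hmetric x hx (mvfderiv (𝓡 d) e x v)
  rw [ofChartComponents_mvfderiv he hx] at h
  have hs : Real.sqrt lam⁻¹ ^ 2 = lam⁻¹ := Real.sq_sqrt (by positivity)
  constructor
  · refine abs_le_of_sq_le_sq' ?_ (by positivity) |>.2
    rw [mul_pow, hs]
    calc ‖mvfderiv (𝓡 d) e x v‖ ^ 2 = lam⁻¹ * (lam * ‖mvfderiv (𝓡 d) e x v‖ ^ 2) := by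
          field_simp
      _ ≤ _ := by gcongr; exact h.1
  · refine abs_le_of_sq_le_sq' ?_ (by positivity) |>.2
    rw [mul_pow, hs]
    exact h.2

theorem IsBilipschitzChart.norm_ofChartComponents_le {κ : ℝ} (hκ : IsBilipschitzChart e κ)
    (he : e ∈ IsManifold.maximalAtlas (𝓡 d) ∞ M) {x : M} (hx : x ∈ e.source)
    (w : EuclideanSpace ℝ (Fin d)) : ‖ofChartComponents e x w‖ ≤ κ * ‖w‖ := by
  have := (hκ x hx (ofChartComponents e x w)).2
  rwa [mvfderiv_ofChartComponents he hx] at this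

theorem IsBilipschitzChart.norm_le_norm_ofChartComponents {κ : ℝ} (hκ : IsBilipschitzChart e κ)
    (he : e ∈ IsManifold.maximalAtlas (𝓡 d) ∞ M) {x : M} (hx : x ∈ e.source)
    (w : EuclideanSpace ℝ (Fin d)) : ‖w‖ ≤ κ * ‖ofChartComponents e x w‖ := by
  have := (hκ x hx (ofChartComponents e x w)).1
  rwa [mvfderiv_ofChartComponents he hx] at this

theorem IsBilipschitzChart.abs_metricForm_le {κ : ℝ} (hκ0 : 0 ≤ κ) (hκ : IsBilipschitzChart e κ)
    (he : e ∈ IsManifold.maximalAtlas (𝓡 d) ∞ M) {ξ : EuclideanSpace ℝ (Fin d)}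
    (hξ : ξ ∈ e.target) (a b : EuclideanSpace ℝ (Fin d)) :
    |metricForm e ξ a b| ≤ κ ^ 2 * ‖a‖ * ‖b‖ := by
  rw [metricForm_apply]
  refine (abs_real_inner_le_norm _ _).trans ?_
  calc _ ≤ (κ * ‖a‖) * (κ * ‖b‖) := mul_le_mul
          (hκ.norm_ofChartComponents_le he (e.map_target hξ) a)
          (hκ.norm_ofChartComponents_le he (e.map_target hξ) b) (norm_nonneg _) (by positivity)
    _ = _ := by ring

theorem IsBilipschitzChart.sq_norm_le_metricForm {κ : ℝ} (hκ : IsBilipschitzChart e κ)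
    (he : e ∈ IsManifold.maximalAtlas (𝓡 d) ∞ M) {ξ : EuclideanSpace ℝ (Fin d)}
    (hξ : ξ ∈ e.target) (a : EuclideanSpace ℝ (Fin d)) :
    ‖a‖ ^ 2 ≤ κ ^ 2 * metricForm e ξ a a := by
  rw [metricForm_apply, real_inner_self_eq_norm_sq, ← mul_pow]
  exact pow_le_pow_left₀ (norm_nonneg _)
    (hκ.norm_le_norm_ofChartComponents he (e.map_target hξ) a) 2

/-- In an orthonormal basis `∇X` has `d²` coefficients of size at most `m`, so its length is at most
`√(d² m²)`. -/
theorem covDerivLength_le_of_abs_koszul_le {X : Π x : M, TangentSpace (𝓡 d) x} {x : M} {m : ℝ}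
    (hm : 0 ≤ m) (h : ∀ v w, |koszul X x v w| ≤ m * ‖v‖ * ‖w‖) :
    covDerivLength X x ≤ d * m := by
  have hd : Fintype.card (Fin (Module.finrank ℝ (TangentSpace (𝓡 d) x))) = d := by
    rw [Fintype.card_fin]
    exact finrank_euclideanSpace_fin
  set b := stdOrthonormalBasis ℝ (TangentSpace (𝓡 d) x) with hb
  have h1 (i) : ‖leviCivita X x (b i)‖ ^ 2 ≤ d * m ^ 2 := by
    rw [leviCivita, ← hb, ← b.sum_sq_norm_inner_right]
    calc _ ≤ ∑ j : Fin (Module.finrank ℝ (TangentSpace (𝓡 d) x)), m ^ 2 := by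
          refine Finset.sum_le_sum fun j _ ↦ ?_
          rw [b.orthonormal.inner_right_fintype, Real.norm_eq_abs]
          have := h (b i) (b j)
          rw [b.orthonormal.1, b.orthonormal.1, mul_one, mul_one] at this
          gcongr
      _ = _ := by rw [Finset.sum_const, Finset.card_univ, hd, nsmul_eq_mul]
  rw [covDerivLength]
  refine Real.sqrt_le_iff.2 ⟨by positivity, ?_⟩
  calc _ ≤ ∑ i : Fin (Module.finrank ℝ (TangentSpace (𝓡 d) x)), d * m ^ 2 :=
        Finset.sum_le_sum fun i _ ↦ h1 i
    _ = _ := by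
      rw [Finset.sum_const, Finset.card_univ, hd, nsmul_eq_mul]
      ring

theorem abs_koszul_basis_le (X : Π x : M, TangentSpace (𝓡 d) x) (x : M)
    (i j : Fin (Module.finrank ℝ (TangentSpace (𝓡 d) x))) :
    |koszul X x (stdOrthonormalBasis ℝ (TangentSpace (𝓡 d) x) i)
      (stdOrthonormalBasis ℝ (TangentSpace (𝓡 d) x) j)| ≤ covDerivLength X x := by
  set b := stdOrthonormalBasis ℝ (TangentSpace (𝓡 d) x) with hb
  have h1 : koszul X x (b i) (b j) = inner ℝ (b j) (leviCivita X x (b i)) := by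
    rw [leviCivita, ← hb, b.orthonormal.inner_right_fintype]
  rw [h1]
  refine (abs_real_inner_le_norm _ _).trans ?_
  rw [b.orthonormal.1, one_mul, covDerivLength]
  refine Real.le_sqrt_of_sq_le ?_
  exact Finset.single_le_sum (f := fun i ↦ ‖leviCivita X x (b i)‖ ^ 2)
    (fun _ _ ↦ by positivity) (Finset.mem_univ i)

variable [IsContMDiffRiemannianBundle (𝓡 d) ∞ (EuclideanSpace ℝ (Fin d))
      (fun x : M ↦ TangentSpace (𝓡 d) x)]

/-- Bilinearity is hidden in the definition, where `v` and `w` enter through extensions; it is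
visible in the coordinate formula. -/
theorem exists_bilinear_koszul {X : Π x : M, TangentSpace (𝓡 d) x} {x : M}
    (hX : MDifferentiableAt (𝓡 d) (𝓡 d).tangent
      (fun y ↦ (⟨y, X y⟩ : TangentBundle (𝓡 d) M)) x) :
    ∃ B : TangentSpace (𝓡 d) x →ₗ[ℝ] TangentSpace (𝓡 d) x →ₗ[ℝ] ℝ,
      ∀ v w, koszul X x v w = B v w := by
  have he := IsManifold.chart_mem_maximalAtlas (I := 𝓡 d) (n := ∞) x
  have hx := mem_chart_source (EuclideanSpace ℝ (Fin d)) x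
  refine ⟨LinearMap.mk₂ ℝ (koszul X x) ?_ ?_ ?_ ?_, fun v w ↦ rfl⟩ <;>
  · intro a b c
    simp only [koszul_eq he hx hX, map_add, map_smul, _root_.add_apply, _root_.smul_apply,
      smul_eq_mul]
    ring

/-- Expansion of `v` and `w` in an orthonormal basis gives `d²` terms, each bounded by
`abs_koszul_basis_le`. -/
theorem abs_koszul_le {X : Π x : M, TangentSpace (𝓡 d) x} {x : M}
    (hX : MDifferentiableAt (𝓡 d) (𝓡 d).tangent
      (fun y ↦ (⟨y, X y⟩ : TangentBundle (𝓡 d) M)) x) (v w : TangentSpace (𝓡 d) x) :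
    |koszul X x v w| ≤ (d : ℝ) ^ 2 * covDerivLength X x * ‖v‖ * ‖w‖ := by
  obtain ⟨B, hB⟩ := exists_bilinear_koszul hX
  have hd : Fintype.card (Fin (Module.finrank ℝ (TangentSpace (𝓡 d) x))) = d := by
    rw [Fintype.card_fin]
    exact finrank_euclideanSpace_fin
  set b := stdOrthonormalBasis ℝ (TangentSpace (𝓡 d) x) with hb
  have hrepr (u : TangentSpace (𝓡 d) x) (i) : |b.repr u i| ≤ ‖u‖ := by
    rw [b.repr_apply_apply]
    refine (abs_real_inner_le_norm _ _).trans ?_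
    rw [b.orthonormal.1, one_mul]
  have h0 : 0 ≤ covDerivLength X x := Real.sqrt_nonneg _
  calc |koszul X x v w|
      = |∑ i, ∑ j, b.repr v i * (b.repr w j * koszul X x (b i) (b j))| := by
        conv_lhs => rw [hB, ← b.sum_repr v, ← b.sum_repr w]
        simp only [map_sum, map_smul, LinearMap.sum_apply, LinearMap.smul_apply, smul_eq_mul, hB,
          Finset.mul_sum]
        rw [Finset.sum_comm]
        simp only [mul_left_comm]
    _ ≤ ∑ i : Fin (Module.finrank ℝ (TangentSpace (𝓡 d) x)),
          ∑ j : Fin (Module.finrank ℝ (TangentSpace (𝓡 d) x)),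
          ‖v‖ * (‖w‖ * covDerivLength X x) := by
        refine (Finset.abs_sum_le_sum_abs _ _).trans (Finset.sum_le_sum fun i _ ↦
          (Finset.abs_sum_le_sum_abs _ _).trans (Finset.sum_le_sum fun j _ ↦ ?_))
        rw [abs_mul, abs_mul]
        exact mul_le_mul (hrepr v i) (mul_le_mul (hrepr w j) (abs_koszul_basis_le X x i j)
          (abs_nonneg _) (norm_nonneg _)) (by positivity) (norm_nonneg _)
    _ = _ := by
        simp only [Finset.sum_const, Finset.card_univ, hd, nsmul_eq_mul]
        ring

theorem koszul_sum {ι : Type*} (s : Finset ι) {X : ι → Π x : M, TangentSpace (𝓡 d) x} {x : M}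
    (hX : ∀ i ∈ s, MDifferentiableAt (𝓡 d) (𝓡 d).tangent
      (fun y ↦ (⟨y, X i y⟩ : TangentBundle (𝓡 d) M)) x)
    (hsum : MDifferentiableAt (𝓡 d) (𝓡 d).tangent
      (fun y ↦ (⟨y, ∑ i ∈ s, X i y⟩ : TangentBundle (𝓡 d) M)) x)
    (v w : TangentSpace (𝓡 d) x) :
    koszul (fun y ↦ ∑ i ∈ s, X i y) x v w = ∑ i ∈ s, koszul (X i) x v w := by
  have he := IsManifold.chart_mem_maximalAtlas (I := 𝓡 d) (n := ∞) x
  have hx := mem_chart_source (EuclideanSpace ℝ (Fin d)) x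
  set e := chartAt (EuclideanSpace ℝ (Fin d)) x
  have hrep : chartRep e (fun y ↦ ∑ i ∈ s, X i y) = fun ξ ↦ ∑ i ∈ s, chartRep e (X i) ξ := by
    ext1 ξ
    exact map_sum _ _ _
  have hdiff : ∀ i ∈ s, DifferentiableAt ℝ (chartRep e (X i)) (e x) := fun i hi ↦ by
    refine differentiableAt_chartRep he (e.map_source hx) ?_
    rw [e.left_inv hx]
    exact hX i hi
  rw [koszul_eq he hx hsum, hrep, fderiv_fun_sum hdiff,
    Finset.sum_congr rfl fun i hi ↦ koszul_eq he hx (hX i hi) v w]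
  simp only [map_sum, _root_.sum_apply, Finset.sum_add_distrib, Finset.mul_sum, mul_sub, mul_add,
    Finset.sum_sub_distrib]

/-- The connection is bounded by first derivatives of components. -/
theorem IsBilipschitzChart.abs_koszul_le_chartRep {κ : ℝ} (hκ0 : 0 ≤ κ)
    (hκ : IsBilipschitzChart e κ) (he : e ∈ IsManifold.maximalAtlas (𝓡 d) ∞ M)
    {X : Π x : M, TangentSpace (𝓡 d) x} {x : M} (hx : x ∈ e.source)
    (hX : MDifferentiableAt (𝓡 d) (𝓡 d).tangent
      (fun y ↦ (⟨y, X y⟩ : TangentBundle (𝓡 d) M)) x) (v w : TangentSpace (𝓡 d) x) :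
    |koszul X x v w| ≤ (κ ^ 4 * ‖fderiv ℝ (chartRep e X) (e x)‖
      + 3 / 2 * κ ^ 2 * ‖fderiv ℝ (metricForm e) (e x)‖ * ‖chartRep e X (e x)‖) * ‖v‖ * ‖w‖ := by
  rw [koszul_eq he hx hX]
  set G := metricForm e (e x)
  set G' := fderiv ℝ (metricForm e) (e x)
  set u := chartRep e X (e x)
  set u' := fderiv ℝ (chartRep e X) (e x)
  set a := mvfderiv (𝓡 d) e x v
  set b := mvfderiv (𝓡 d) e x w
  have ha : ‖a‖ ≤ κ * ‖v‖ := (hκ x hx v).1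
  have hb : ‖b‖ ≤ κ * ‖w‖ := (hκ x hx w).1
  have hG : |G (u' a) b| ≤ κ ^ 2 * (‖u'‖ * ‖a‖) * ‖b‖ :=
    (hκ.abs_metricForm_le hκ0 he (e.map_source hx) _ _).trans (by
      gcongr
      exact u'.le_opNorm a)
  have hG' (p q r : EuclideanSpace ℝ (Fin d)) : |G' p q r| ≤ ‖G'‖ * ‖p‖ * ‖q‖ * ‖r‖ :=
    (ContinuousLinearMap.le_opNorm₂ (G' p) q r).trans (by
      gcongr
      exact G'.le_opNorm p)
  have h1 := abs_le.1 hG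
  have h2 := abs_le.1 (hG' a u b)
  have h3 := abs_le.1 (hG' u a b)
  have h4 := abs_le.1 (hG' b a u)
  have hab : ‖a‖ * ‖b‖ ≤ κ ^ 2 * (‖v‖ * ‖w‖) :=
    (mul_le_mul ha hb (norm_nonneg _) (by positivity)).trans_eq (by ring)
  -- Three terms contain the derivative of the metric, each with weight `1/2`; hence `3/2`.
  have key : (κ ^ 2 * ‖u'‖ + 3 / 2 * ‖G'‖ * ‖u‖) * (‖a‖ * ‖b‖)
      ≤ (κ ^ 2 * ‖u'‖ + 3 / 2 * ‖G'‖ * ‖u‖) * (κ ^ 2 * (‖v‖ * ‖w‖)) := by gcongr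
  rw [abs_le]
  constructor <;> nlinarith [key, h1.1, h1.2, h2.1, h2.2, h3.1, h3.2, h4.1, h4.2]

/-- First derivatives of components are bounded by the connection. -/
theorem IsBilipschitzChart.norm_fderiv_chartRep_le {κ : ℝ} (hκ0 : 0 ≤ κ)
    (hκ : IsBilipschitzChart e κ) (he : e ∈ IsManifold.maximalAtlas (𝓡 d) ∞ M)
    {X : Π x : M, TangentSpace (𝓡 d) x} {x : M} (hx : x ∈ e.source)
    (hX : MDifferentiableAt (𝓡 d) (𝓡 d).tangent
      (fun y ↦ (⟨y, X y⟩ : TangentBundle (𝓡 d) M)) x) :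
    ‖fderiv ℝ (chartRep e X) (e x)‖ ≤ κ ^ 4 * d ^ 2 * covDerivLength X x
      + 3 / 2 * κ ^ 2 * ‖fderiv ℝ (metricForm e) (e x)‖ * ‖chartRep e X (e x)‖ := by
  have hc0 : 0 ≤ covDerivLength X x := Real.sqrt_nonneg _
  set G' := fderiv ℝ (metricForm e) (e x) with hG'def
  set u := chartRep e X (e x) with hu
  set u' := fderiv ℝ (chartRep e X) (e x) with hu'
  refine ContinuousLinearMap.opNorm_le_bound _ (by positivity) fun a ↦ ?_
  -- The second argument is chosen with components `b = u' a`, so that the leading term is `g(b,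
  -- b)`, which controls `‖b‖²` from above up to `κ²`.
  have hk := koszul_eq he hx hX (ofChartComponents e x a) (ofChartComponents e x (u' a))
  have hk' := abs_koszul_le hX (ofChartComponents e x a) (ofChartComponents e x (u' a))
  rw [mvfderiv_ofChartComponents he hx, mvfderiv_ofChartComponents he hx, ← hG'def, ← hu, ← hu']
    at hk
  set b := u' a
  have ha := hκ.norm_ofChartComponents_le he hx a
  have hb := hκ.norm_ofChartComponents_le he hx b
  have hG' (p q r : EuclideanSpace ℝ (Fin d)) : |G' p q r| ≤ ‖G'‖ * ‖p‖ * ‖q‖ * ‖r‖ :=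
    (ContinuousLinearMap.le_opNorm₂ (G' p) q r).trans (by
      gcongr
      exact G'.le_opNorm p)
  have h1 := hκ.sq_norm_le_metricForm he (e.map_source hx) b
  have h2 := abs_le.1 (hG' a u b)
  have h3 := abs_le.1 (hG' u a b)
  have h4 := abs_le.1 (hG' b a u)
  have h5 := abs_le.1 hk'
  have h6 : (d : ℝ) ^ 2 * covDerivLength X x * ‖ofChartComponents e x a‖
      * ‖ofChartComponents e x b‖ ≤ (d : ℝ) ^ 2 * covDerivLength X x * (κ * ‖a‖) * (κ * ‖b‖) := by
    gcongr
  have h7 : metricForm e (e x) b b ≤ (κ ^ 2 * d ^ 2 * covDerivLength X x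
      + 3 / 2 * ‖G'‖ * ‖u‖) * ‖a‖ * ‖b‖ := by
    nlinarith [h2.1, h2.2, h3.1, h3.2, h4.1, h4.2, h5.1, h5.2]
  -- The estimate is quadratic in `‖b‖`; one factor is divided out.
  rcases eq_or_lt_of_le (norm_nonneg b) with hb0 | hb0
  · rw [← hb0]
    positivity
  · have h8 : ‖b‖ * ‖b‖ ≤ ((κ ^ 4 * d ^ 2 * covDerivLength X x
        + 3 / 2 * κ ^ 2 * ‖G'‖ * ‖u‖) * ‖a‖) * ‖b‖ := by
      calc ‖b‖ * ‖b‖ = ‖b‖ ^ 2 := by ring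
        _ ≤ κ ^ 2 * metricForm e (e x) b b := h1
        _ ≤ κ ^ 2 * ((κ ^ 2 * d ^ 2 * covDerivLength X x
              + 3 / 2 * ‖G'‖ * ‖u‖) * ‖a‖ * ‖b‖) := by gcongr
        _ = _ := by ring
    exact le_of_mul_le_mul_right h8 hb0

end PointwiseBounds

/-! ### The determinant of the metric: bounds and change of chart -/

section GramMatrix

variable {d : ℕ} {M : Type*} [TopologicalSpace M] [ChartedSpace (EuclideanSpace ℝ (Fin d)) M]
  [IsManifold (𝓡 d) ∞ M] [RiemannianBundle (fun x : M ↦ TangentSpace (𝓡 d) x)]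
  {e e' : OpenPartialHomeomorph M (EuclideanSpace ℝ (Fin d))}

theorem dotProduct_metricMatrix_mulVec (e : OpenPartialHomeomorph M (EuclideanSpace ℝ (Fin d)))
    (ξ a b : EuclideanSpace ℝ (Fin d)) :
    dotProduct a (Matrix.mulVec (metricMatrix e (e.symm ξ)) b) = metricForm e ξ a b := by
  simp only [metricForm, dotProduct, Matrix.mulVec, _root_.sum_apply, _root_.smul_apply,
    ContinuousLinearMap.smulRight_apply, smul_eq_mul, Finset.mul_sum]
  refine Finset.sum_congr rfl fun i _ ↦ Finset.sum_congr rfl fun j _ ↦ ?_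
  simp
  ring

theorem isHermitian_metricMatrix (x : M) : (metricMatrix e x).IsHermitian := by
  ext i j
  simp only [Matrix.conjTranspose_apply, metricMatrix, star_trivial]
  exact real_inner_comm _ _

/-- The density `√(det g)` of the Riemannian measure in the coordinates of a chart. -/
def volDensity (e : OpenPartialHomeomorph M (EuclideanSpace ℝ (Fin d)))
    (ξ : EuclideanSpace ℝ (Fin d)) : ℝ :=
  Real.sqrt (metricMatrix e (e.symm ξ)).det

theorem volDensity_nonneg (ξ : EuclideanSpace ℝ (Fin d)) : 0 ≤ volDensity e ξ :=
  Real.sqrt_nonneg _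

/-- An eigenvalue is the value of the metric on a unit eigenvector, to which the bilipschitz bounds
apply. The bounds on the determinant follow, it being the product of the eigenvalues. -/
theorem IsBilipschitzChart.eigenvalues_mem {κ : ℝ} (hκ0 : 0 < κ) (hκ : IsBilipschitzChart e κ)
    (he : e ∈ IsManifold.maximalAtlas (𝓡 d) ∞ M) {ξ : EuclideanSpace ℝ (Fin d)}
    (hξ : ξ ∈ e.target) (i : Fin d) :
    (κ ^ 2)⁻¹ ≤ (isHermitian_metricMatrix (e := e) (e.symm ξ)).eigenvalues i ∧
      (isHermitian_metricMatrix (e := e) (e.symm ξ)).eigenvalues i ≤ κ ^ 2 := by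
  set hA := isHermitian_metricMatrix (e := e) (e.symm ξ)
  have hn : ‖hA.eigenvectorBasis i‖ = 1 := hA.eigenvectorBasis.orthonormal.1 i
  have h1 : hA.eigenvalues i
      = metricForm e ξ (hA.eigenvectorBasis i) (hA.eigenvectorBasis i) := by
    rw [hA.eigenvalues_eq, ← dotProduct_metricMatrix_mulVec]
    simp
  have h2 := hκ.sq_norm_le_metricForm he hξ (hA.eigenvectorBasis i)
  have h3 := hκ.abs_metricForm_le hκ0.le he hξ (hA.eigenvectorBasis i) (hA.eigenvectorBasis i)
  rw [hn] at h2 h3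
  rw [h1]
  constructor
  · rw [inv_le_iff_one_le_mul₀' (by positivity)]
    simpa using h2
  · simpa using (le_abs_self _).trans h3

theorem IsBilipschitzChart.det_metricMatrix_mem {κ : ℝ} (hκ0 : 0 < κ)
    (hκ : IsBilipschitzChart e κ)
    (he : e ∈ IsManifold.maximalAtlas (𝓡 d) ∞ M) {ξ : EuclideanSpace ℝ (Fin d)}
    (hξ : ξ ∈ e.target) :
    ((κ ^ 2)⁻¹) ^ d ≤ (metricMatrix e (e.symm ξ)).det ∧
      (metricMatrix e (e.symm ξ)).det ≤ (κ ^ 2) ^ d := by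
  have h := hκ.eigenvalues_mem hκ0 he hξ
  have hA := isHermitian_metricMatrix (e := e) (e.symm ξ)
  have h0 (i) : 0 ≤ hA.eigenvalues i := le_trans (by positivity) (h i).1
  rw [hA.det_eq_prod_eigenvalues]
  have hc (c : ℝ) : c ^ d = ∏ _i : Fin d, c := by simp
  rw [hc, hc]
  exact ⟨Finset.prod_le_prod (fun _ _ ↦ by positivity) fun i _ ↦ (h i).1,
    Finset.prod_le_prod (fun i _ ↦ h0 i) fun i _ ↦ (h i).2⟩

theorem IsBilipschitzChart.volDensity_mem {κ : ℝ} (hκ0 : 0 < κ) (hκ : IsBilipschitzChart e κ)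
    (he : e ∈ IsManifold.maximalAtlas (𝓡 d) ∞ M) {ξ : EuclideanSpace ℝ (Fin d)}
    (hξ : ξ ∈ e.target) : (κ ^ d)⁻¹ ≤ volDensity e ξ ∧ volDensity e ξ ≤ κ ^ d := by
  have h := hκ.det_metricMatrix_mem hκ0 he hξ
  constructor
  · refine Real.le_sqrt_of_sq_le (le_trans (le_of_eq ?_) h.1)
    rw [inv_pow, inv_pow, ← pow_mul, ← pow_mul, mul_comm]
  · refine Real.sqrt_le_iff.2 ⟨by positivity, h.2.trans_eq ?_⟩
    rw [← pow_mul, ← pow_mul, mul_comm]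

theorem IsBilipschitzChart.volDensity_pos {κ : ℝ} (hκ0 : 0 < κ) (hκ : IsBilipschitzChart e κ)
    (he : e ∈ IsManifold.maximalAtlas (𝓡 d) ∞ M) {ξ : EuclideanSpace ℝ (Fin d)}
    (hξ : ξ ∈ e.target) : 0 < volDensity e ξ :=
  lt_of_lt_of_le (by positivity) (hκ.volDensity_mem hκ0 he hξ).1

theorem differentiableAt_transition (he : e ∈ IsManifold.maximalAtlas (𝓡 d) ∞ M)
    (he' : e' ∈ IsManifold.maximalAtlas (𝓡 d) ∞ M) {x : M} (hx : x ∈ e.source)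
    (hx' : x ∈ e'.source) : DifferentiableAt ℝ (e ∘ e'.symm) (e' x) := by
  have h1 : MDifferentiableAt (𝓡 d) (𝓡 d) e x :=
    (mdifferentiable_of_mem_maximalAtlas he).mdifferentiableAt hx
  rw [← e'.left_inv hx'] at h1
  exact (h1.comp (e' x) ((mdifferentiable_of_mem_maximalAtlas he').mdifferentiableAt_symm
    (e'.map_source hx'))).differentiableAt

theorem ofChartComponents_transition (he : e ∈ IsManifold.maximalAtlas (𝓡 d) ∞ M)
    (he' : e' ∈ IsManifold.maximalAtlas (𝓡 d) ∞ M) {x : M} (hx : x ∈ e.source)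
    (hx' : x ∈ e'.source) (w : EuclideanSpace ℝ (Fin d)) :
    ofChartComponents e' x w
      = ofChartComponents e x (fderiv ℝ (e ∘ e'.symm) (e' x) w) := by
  have h1 : MDifferentiableAt (𝓡 d) (𝓡 d) e x :=
    (mdifferentiable_of_mem_maximalAtlas he).mdifferentiableAt hx
  have h2 : MDifferentiableAt (𝓡 d) (𝓡 d) e'.symm (e' x) :=
    (mdifferentiable_of_mem_maximalAtlas he').mdifferentiableAt_symm (e'.map_source hx')
  have h3 : fderiv ℝ (e ∘ e'.symm) (e' x) w
      = mvfderiv (𝓡 d) e x (mfderiv (𝓡 d) (𝓡 d) e'.symm (e' x) w) := by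
    rw [← mfderiv_eq_fderiv]
    exact mfderiv_comp_apply_of_eq (e' x) h1 h2 (e'.left_inv hx') w
  rw [h3, ← ofChartComponents_eq_mfderiv_symm he' hx', ofChartComponents_mvfderiv he hx]

/-- The Gram matrix changes by congruence with the Jacobian matrix `A` of the transition map: `g' =
Aᵀ g A`. -/
theorem det_metricMatrix_transition (he : e ∈ IsManifold.maximalAtlas (𝓡 d) ∞ M)
    (he' : e' ∈ IsManifold.maximalAtlas (𝓡 d) ∞ M) {x : M} (hx : x ∈ e.source)
    (hx' : x ∈ e'.source) :
    (metricMatrix e' x).det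
      = (fderiv ℝ (e ∘ e'.symm) (e' x)).det ^ 2 * (metricMatrix e x).det := by
  set J := fderiv ℝ (e ∘ e'.symm) (e' x) with hJ
  set B := (EuclideanSpace.basisFun (Fin d) ℝ).toBasis
  set A := LinearMap.toMatrix B B (J : EuclideanSpace ℝ (Fin d) →ₗ[ℝ] EuclideanSpace ℝ (Fin d))
  have hA : J.det = A.det := by
    rw [ContinuousLinearMap.det, ← LinearMap.det_toMatrix B]
  have hAij (i j) : A i j = J (EuclideanSpace.single j 1) i := by
    simp [A, B, LinearMap.toMatrix_apply]
  have h : metricMatrix e' x = A.transpose * metricMatrix e x * A := by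
    ext i j
    rw [metricMatrix, ofChartComponents_transition he he' hx hx',
      ofChartComponents_transition he he' hx hx', ← hJ]
    have h1 := metricForm_apply (e := e) (e x) (J (EuclideanSpace.single i 1))
      (J (EuclideanSpace.single j 1))
    rw [e.left_inv hx] at h1
    rw [← h1, ← dotProduct_metricMatrix_mulVec, e.left_inv hx, Matrix.mul_assoc, Matrix.mul_apply]
    simp only [dotProduct, Matrix.mulVec, Matrix.mul_apply, Matrix.transpose_apply, hAij]
  rw [h, Matrix.det_mul, Matrix.det_mul, Matrix.det_transpose, hA]
  ring

/-- The factor is exactly the Jacobian of the change of variables formula, which makes the chart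
measures compatible. -/
theorem volDensity_transition (he : e ∈ IsManifold.maximalAtlas (𝓡 d) ∞ M)
    (he' : e' ∈ IsManifold.maximalAtlas (𝓡 d) ∞ M) {x : M} (hx : x ∈ e.source)
    (hx' : x ∈ e'.source) :
    volDensity e' (e' x)
      = |(fderiv ℝ (e ∘ e'.symm) (e' x)).det| * volDensity e (e x) := by
  rw [volDensity, volDensity, e.left_inv hx, e'.left_inv hx',
    det_metricMatrix_transition he he' hx hx', Real.sqrt_mul (sq_nonneg _), Real.sqrt_sq_eq_abs]

end GramMatrix

/-! ### Gluing the chart measures into the Riemannian measure -/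

section RiemannianMeasure

variable {d : ℕ} {M : Type*} [TopologicalSpace M] [ChartedSpace (EuclideanSpace ℝ (Fin d)) M]
  [IsManifold (𝓡 d) ∞ M] [RiemannianBundle (fun x : M ↦ TangentSpace (𝓡 d) x)]
  [MeasurableSpace M] [BorelSpace M]
  {e e' : OpenPartialHomeomorph M (EuclideanSpace ℝ (Fin d))}

theorem measurableSet_inter_preimage_of_continuousOn {α β : Type*} [TopologicalSpace α]
    [MeasurableSpace α] [BorelSpace α] [TopologicalSpace β] [MeasurableSpace β] [BorelSpace β]
    {f : α → β} {s : Set α} (hs : MeasurableSet s) (hf : ContinuousOn f s) {t : Set β}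
    (ht : MeasurableSet t) : MeasurableSet (s ∩ f ⁻¹' t) := by
  have h := (continuousOn_iff_continuous_domRestrict.1 hf).measurable ht
  have h' := hs.subtype_image h
  convert h' using 1
  ext x
  simp [and_comm]

theorem measurableSet_image_chart {s : Set M} (hs : MeasurableSet s) (hse : s ⊆ e.source) :
    MeasurableSet (e '' s) := by
  rw [e.image_eq_target_inter_inv_preimage hse]
  exact measurableSet_inter_preimage_of_continuousOn e.open_target.measurableSet
    e.continuousOn_symm hs

theorem aemeasurable_symm (e : OpenPartialHomeomorph M (EuclideanSpace ℝ (Fin d))) :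
    AEMeasurable e.symm (volume.restrict e.target) :=
  e.continuousOn_symm.aemeasurable e.open_target.measurableSet

theorem chartMeasure_eq_map (e : OpenPartialHomeomorph M (EuclideanSpace ℝ (Fin d))) :
    chartMeasure e = Measure.map e.symm ((volume.restrict e.target).withDensity
      (fun ξ ↦ ENNReal.ofReal (volDensity e ξ))) := rfl

theorem aemeasurable_symm_withDensity
    (e : OpenPartialHomeomorph M (EuclideanSpace ℝ (Fin d))) :
    AEMeasurable e.symm ((volume.restrict e.target).withDensity
      (fun ξ ↦ ENNReal.ofReal (volDensity e ξ))) :=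
  (aemeasurable_symm e).mono_ac (withDensity_absolutelyContinuous _ _)

theorem chartMeasure_apply {s : Set M} (hs : MeasurableSet s) :
    chartMeasure e s
      = ∫⁻ ξ in e.target ∩ e.symm ⁻¹' s, ENNReal.ofReal (volDensity e ξ) := by
  rw [chartMeasure_eq_map, Measure.map_apply_of_aemeasurable (aemeasurable_symm_withDensity e) hs,
    withDensity_apply', Measure.restrict_restrict' e.open_target.measurableSet, Set.inter_comm]

theorem chartMeasure_inter_source {s : Set M} (hs : MeasurableSet s) :
    chartMeasure e (s ∩ e.source) = chartMeasure e s := by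
  rw [chartMeasure_apply hs, chartMeasure_apply (hs.inter e.open_source.measurableSet)]
  congr 2
  ext ξ
  simp only [Set.mem_inter_iff, Set.mem_preimage]
  exact ⟨fun h ↦ ⟨h.1, h.2.1⟩, fun h ↦ ⟨h.1, h.2, e.map_target h.1⟩⟩

theorem chartMeasure_apply_of_subset {s : Set M} (hs : MeasurableSet s) (hse : s ⊆ e.source) :
    chartMeasure e s = ∫⁻ ξ in e '' s, ENNReal.ofReal (volDensity e ξ) := by
  rw [chartMeasure_apply hs, e.image_eq_target_inter_inv_preimage hse]

/-- The chart measures agree on overlaps. -/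
theorem chartMeasure_eq_of_subset (he : e ∈ IsManifold.maximalAtlas (𝓡 d) ∞ M)
    (he' : e' ∈ IsManifold.maximalAtlas (𝓡 d) ∞ M) {s : Set M} (hs : MeasurableSet s)
    (hse : s ⊆ e.source) (hse' : s ⊆ e'.source) : chartMeasure e s = chartMeasure e' s := by
  rw [chartMeasure_apply_of_subset hs hse, chartMeasure_apply_of_subset hs hse']
  have himg : e '' s = (e ∘ e'.symm) '' (e' '' s) := by
    rw [← Set.image_comp]
    refine Set.image_congr fun x hx ↦ ?_
    simp [e'.left_inv (hse' hx)]
  have hinj : Set.InjOn (e ∘ e'.symm) (e' '' s) := by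
    rintro _ ⟨x, hx, rfl⟩ _ ⟨y, hy, rfl⟩ h
    simp only [Function.comp_apply, e'.left_inv (hse' hx), e'.left_inv (hse' hy)] at h
    rw [e.injOn (hse hx) (hse hy) h]
  have hder : ∀ ξ ∈ e' '' s, HasFDerivWithinAt (e ∘ e'.symm)
      (fderiv ℝ (e ∘ e'.symm) ξ) (e' '' s) ξ := by
    rintro _ ⟨x, hx, rfl⟩
    exact (differentiableAt_transition he he' (hse hx) (hse' hx)).hasFDerivAt.hasFDerivWithinAt
  -- Change of variables along the transition map; its Jacobian is absorbed by
  -- `volDensity_transition`.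
  rw [himg, lintegral_image_eq_lintegral_abs_det_fderiv_mul volume
    (measurableSet_image_chart hs hse') hder hinj]
  refine setLIntegral_congr_fun (measurableSet_image_chart hs hse') ?_
  rintro _ ⟨x, hx, rfl⟩
  simp only [Function.comp_apply, e'.left_inv (hse' hx)]
  rw [volDensity_transition he he' (hse hx) (hse' hx), ENNReal.ofReal_mul (abs_nonneg _)]

theorem chartMeasure_le_riemannianMeasure (he : e ∈ IsManifold.maximalAtlas (𝓡 d) ∞ M) :
    chartMeasure e ≤ riemannianMeasure d M :=
  le_iSup₂ (f := fun (e : OpenPartialHomeomorph M (EuclideanSpace ℝ (Fin d)))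
    (_ : e ∈ IsManifold.maximalAtlas (𝓡 d) ∞ M) ↦ chartMeasure (d := d) e) e he

/-- A supremum of measures is not computed set by set, so it is bounded above by one explicit
measure that dominates every chart measure. -/
theorem riemannianMeasure_apply_of_subset (he : e ∈ IsManifold.maximalAtlas (𝓡 d) ∞ M)
    {s : Set M} (hs : MeasurableSet s) (hse : s ⊆ e.source) :
    riemannianMeasure d M s = chartMeasure e s := by
  refine le_antisymm ?_ (chartMeasure_le_riemannianMeasure he s)
  have hm := e.open_source.measurableSet
  -- The majorant is `chartMeasure e` on the domain of `e` and infinite on every nonempty set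
  -- outside it; on the domain the chart measures agree.
  have hle : riemannianMeasure d M ≤ chartMeasure e + (⊤ : Measure M).restrict e.sourceᶜ := by
    refine iSup₂_le fun e' he' ↦ Measure.le_iff.2 fun t ht ↦ ?_
    rw [Measure.add_apply, Measure.restrict_apply ht, ← measure_inter_add_sdiff t hm]
    refine add_le_add ?_ ?_
    · rw [← chartMeasure_inter_source (ht.inter hm),
        ← chartMeasure_eq_of_subset he he' ((ht.inter hm).inter e'.open_source.measurableSet)
          (fun x hx ↦ hx.1.2) (fun x hx ↦ hx.2)]
      exact measure_mono fun x hx ↦ hx.1.1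
    · rcases Set.eq_empty_or_nonempty (t ∩ e.sourceᶜ) with h | h
      · rw [Set.sdiff_eq, h, measure_empty, measure_empty]
      · have : (⊤ : Measure M) (t ∩ e.sourceᶜ) = ⊤ := by
          rw [← Measure.coe_toOuterMeasure, Measure.toOuterMeasure_top, OuterMeasure.top_apply h]
        rw [this]
        exact le_top
  refine (hle s).trans_eq ?_
  rw [Measure.add_apply, Measure.restrict_apply hs,
    (Set.disjoint_compl_right_iff_subset.2 hse).inter_eq, measure_empty, add_zero]

theorem riemannianMeasure_restrict_source (he : e ∈ IsManifold.maximalAtlas (𝓡 d) ∞ M) :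
    (riemannianMeasure d M).restrict e.source = chartMeasure e := by
  ext s hs
  rw [Measure.restrict_apply hs, riemannianMeasure_apply_of_subset he
    (hs.inter e.open_source.measurableSet) Set.inter_subset_right, chartMeasure_inter_source hs]

end RiemannianMeasure

/-! ### Passing norms and integrals between a chart and the manifold -/

section Transfer

variable {d : ℕ} {M : Type*} [TopologicalSpace M] [ChartedSpace (EuclideanSpace ℝ (Fin d)) M]
  [IsManifold (𝓡 d) ∞ M] [RiemannianBundle (fun x : M ↦ TangentSpace (𝓡 d) x)]
  [MeasurableSpace M] [BorelSpace M]
  {e e' : OpenPartialHomeomorph M (EuclideanSpace ℝ (Fin d))}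

/-- The Riemannian measure has density at least `κ^{-d}` with respect to Lebesgue measure. The upper
bound `κ^d` gives the reverse comparison `restrict_source_le`. -/
theorem IsBilipschitzChart.map_symm_le {κ : ℝ} (hκ0 : 0 < κ) (hκ : IsBilipschitzChart e κ)
    (he : e ∈ IsManifold.maximalAtlas (𝓡 d) ∞ M) :
    Measure.map e.symm (volume.restrict e.target)
      ≤ ENNReal.ofReal (κ ^ d) • (riemannianMeasure d M).restrict e.source := by
  rw [riemannianMeasure_restrict_source he]
  refine Measure.le_iff.2 fun s hs ↦ ?_
  have hm := measurableSet_inter_preimage_of_continuousOn e.open_target.measurableSet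
    e.continuousOn_symm hs
  rw [Measure.map_apply_of_aemeasurable (aemeasurable_symm e) hs, Measure.smul_apply,
    chartMeasure_apply hs, Measure.restrict_apply' e.open_target.measurableSet, Set.inter_comm,
    smul_eq_mul, ← lintegral_const_mul' _ _ ENNReal.ofReal_ne_top, ← setLIntegral_one]
  refine setLIntegral_mono' hm fun ξ hξ ↦ ?_
  rw [← ENNReal.ofReal_mul (by positivity), ENNReal.one_le_ofReal]
  have h := (hκ.volDensity_mem hκ0 he hξ.1).1
  rwa [inv_le_iff_one_le_mul₀' (by positivity)] at h

theorem IsBilipschitzChart.restrict_source_le {κ : ℝ} (hκ0 : 0 < κ)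
    (hκ : IsBilipschitzChart e κ) (he : e ∈ IsManifold.maximalAtlas (𝓡 d) ∞ M) :
    (riemannianMeasure d M).restrict e.source
      ≤ ENNReal.ofReal (κ ^ d) • Measure.map e.symm (volume.restrict e.target) := by
  rw [riemannianMeasure_restrict_source he]
  refine Measure.le_iff.2 fun s hs ↦ ?_
  have hm := measurableSet_inter_preimage_of_continuousOn e.open_target.measurableSet
    e.continuousOn_symm hs
  rw [Measure.smul_apply, Measure.map_apply_of_aemeasurable (aemeasurable_symm e) hs,
    chartMeasure_apply hs, Measure.restrict_apply' e.open_target.measurableSet,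
    Set.inter_comm (e.symm ⁻¹' s), smul_eq_mul, ← setLIntegral_one,
    ← lintegral_const_mul' _ _ ENNReal.ofReal_ne_top]
  refine setLIntegral_mono' hm fun ξ hξ ↦ ?_
  rw [mul_one]
  exact ENNReal.ofReal_le_ofReal (hκ.volDensity_mem hκ0 he hξ.1).2

theorem IsBilipschitzChart.ae_symm {κ : ℝ} (hκ0 : 0 < κ) (hκ : IsBilipschitzChart e κ)
    (he : e ∈ IsManifold.maximalAtlas (𝓡 d) ∞ M) {P : M → Prop}
    (h : ∀ᵐ x ∂(riemannianMeasure d M), P x) :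
    ∀ᵐ ξ ∂(volume.restrict e.target), P (e.symm ξ) := by
  refine ae_of_ae_map (aemeasurable_symm e) ?_
  exact ((Measure.absolutelyContinuous_of_le (hκ.map_symm_le hκ0 he)).trans
    Measure.smul_absolutelyContinuous).ae_le (ae_restrict_of_ae h)

theorem IsBilipschitzChart.aestronglyMeasurable_map {κ : ℝ} (hκ0 : 0 < κ)
    (hκ : IsBilipschitzChart e κ) (he : e ∈ IsManifold.maximalAtlas (𝓡 d) ∞ M)
    {β : Type*} [TopologicalSpace β] {g : M → β}
    (hg : AEStronglyMeasurable g ((riemannianMeasure d M).restrict e.source)) :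
    AEStronglyMeasurable g (Measure.map e.symm (volume.restrict e.target)) :=
  hg.mono_ac ((Measure.absolutelyContinuous_of_le (hκ.map_symm_le hκ0 he)).trans
    Measure.smul_absolutelyContinuous)

theorem IsBilipschitzChart.eLpNorm_comp_symm_le {κ : ℝ} (hκ0 : 0 < κ)
    (hκ : IsBilipschitzChart e κ) (he : e ∈ IsManifold.maximalAtlas (𝓡 d) ∞ M)
    {p : ℝ≥0∞} (hp : p ≠ ⊤) {β : Type*} [NormedAddCommGroup β] {g : M → β}
    (hg : AEStronglyMeasurable g ((riemannianMeasure d M).restrict e.source)) :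
    eLpNorm (g ∘ e.symm) p (volume.restrict e.target)
      ≤ ENNReal.ofReal (κ ^ d) ^ (1 / p).toReal
        * eLpNorm g p ((riemannianMeasure d M).restrict e.source) := by
  rw [← eLpNorm_map_measure (hκ.aestronglyMeasurable_map hκ0 he hg) (aemeasurable_symm e)]
  refine (eLpNorm_mono_measure g (hκ.map_symm_le hκ0 he)).trans_eq ?_
  rw [eLpNorm_smul_measure_of_ne_top hp, smul_eq_mul]

theorem IsBilipschitzChart.eLpNorm_restrict_source_le {κ : ℝ} (hκ0 : 0 < κ)
    (hκ : IsBilipschitzChart e κ) (he : e ∈ IsManifold.maximalAtlas (𝓡 d) ∞ M)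
    {p : ℝ≥0∞} (hp : p ≠ ⊤) {β : Type*} [NormedAddCommGroup β] {g : M → β}
    (hg : AEStronglyMeasurable g ((riemannianMeasure d M).restrict e.source)) :
    eLpNorm g p ((riemannianMeasure d M).restrict e.source)
      ≤ ENNReal.ofReal (κ ^ d) ^ (1 / p).toReal
        * eLpNorm (g ∘ e.symm) p (volume.restrict e.target) := by
  rw [← eLpNorm_map_measure (hκ.aestronglyMeasurable_map hκ0 he hg) (aemeasurable_symm e)]
  refine (eLpNorm_mono_measure g (hκ.restrict_source_le hκ0 he)).trans_eq ?_
  rw [eLpNorm_smul_measure_of_ne_top hp, smul_eq_mul]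

theorem measurableSet_chart_preimage {K : Set (EuclideanSpace ℝ (Fin d))} (hK : MeasurableSet K) :
    MeasurableSet (e.source ∩ e ⁻¹' K) :=
  measurableSet_inter_preimage_of_continuousOn e.open_source.measurableSet e.continuousOn hK

theorem aestronglyMeasurable_indicator_chart {K : Set (EuclideanSpace ℝ (Fin d))}
    (hK : MeasurableSet K) {w : EuclideanSpace ℝ (Fin d) → ℝ} (hw : ContinuousOn w K)
    (μ : Measure M) :
    AEStronglyMeasurable ((e.source ∩ e ⁻¹' K).indicator (w ∘ e)) μ := by
  have hA : MeasurableSet (e.source ∩ e ⁻¹' K) := measurableSet_chart_preimage hK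
  rw [aestronglyMeasurable_indicator_iff hA]
  exact (hw.comp (e.continuousOn.mono Set.inter_subset_left)
    (fun x hx ↦ hx.2)).aestronglyMeasurable hA

theorem eLpNorm_indicator_comp_symm {K : Set (EuclideanSpace ℝ (Fin d))}
    (hK : MeasurableSet K) (hKe : K ⊆ e.target) (w : EuclideanSpace ℝ (Fin d) → ℝ) (p : ℝ≥0∞) :
    eLpNorm ((e.source ∩ e ⁻¹' K).indicator (w ∘ e) ∘ e.symm) p (volume.restrict e.target)
      = eLpNorm w p (volume.restrict K) := by
  have h : (e.source ∩ e ⁻¹' K).indicator (w ∘ e) ∘ e.symm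
      =ᵐ[volume.restrict e.target] K.indicator w := by
    filter_upwards [ae_restrict_mem e.open_target.measurableSet] with ξ hξ
    by_cases hξK : ξ ∈ K
    · have : e.symm ξ ∈ e.source ∩ e ⁻¹' K :=
        ⟨e.map_target hξ, by rwa [Set.mem_preimage, e.right_inv hξ]⟩
      rw [Function.comp_apply, Set.indicator_of_mem this, Set.indicator_of_mem hξK,
        Function.comp_apply, e.right_inv hξ]
    · have : e.symm ξ ∉ e.source ∩ e ⁻¹' K := fun h ↦ by
        rw [Set.mem_inter_iff, Set.mem_preimage, e.right_inv hξ] at h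
        exact hξK h.2
      rw [Function.comp_apply, Set.indicator_of_notMem this, Set.indicator_of_notMem hξK]
  rw [eLpNorm_congr_ae h, eLpNorm_indicator_eq_eLpNorm_restrict hK,
    Measure.restrict_restrict_of_subset hKe]

theorem eLpNorm_indicator_chart {K : Set (EuclideanSpace ℝ (Fin d))}
    (hK : MeasurableSet K) (w : M → ℝ) (p : ℝ≥0∞) (μ : Measure M) :
    eLpNorm ((e.source ∩ e ⁻¹' K).indicator w) p (μ.restrict e.source)
      = eLpNorm ((e.source ∩ e ⁻¹' K).indicator w) p μ := by
  have hA : MeasurableSet (e.source ∩ e ⁻¹' K) := measurableSet_chart_preimage hK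
  rw [eLpNorm_indicator_eq_eLpNorm_restrict hA, eLpNorm_indicator_eq_eLpNorm_restrict hA,
    Measure.restrict_restrict_of_subset Set.inter_subset_left]

/-- Norms in coordinates are bounded by norms on the manifold. -/
theorem IsBilipschitzChart.eLpNorm_le_of_le {κ : ℝ} (hκ0 : 0 < κ)
    (hκ : IsBilipschitzChart e κ) (he : e ∈ IsManifold.maximalAtlas (𝓡 d) ∞ M)
    {p : ℝ≥0∞} (hp : p ≠ ⊤) {K : Set (EuclideanSpace ℝ (Fin d))} (hK : MeasurableSet K)
    (hKe : K ⊆ e.target) {w : EuclideanSpace ℝ (Fin d) → ℝ} (hw : ContinuousOn w K)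
    {f : M → ℝ} (hwf : ∀ x ∈ e.source, e x ∈ K → |w (e x)| ≤ |f x|) :
    eLpNorm w p (volume.restrict K)
      ≤ ENNReal.ofReal (κ ^ d) ^ (1 / p).toReal * eLpNorm f p (riemannianMeasure d M) := by
  rw [← eLpNorm_indicator_comp_symm hK hKe]
  refine (hκ.eLpNorm_comp_symm_le hκ0 he hp
    (aestronglyMeasurable_indicator_chart hK hw _)).trans ?_
  rw [eLpNorm_indicator_chart hK]
  gcongr
  refine eLpNorm_mono fun x ↦ ?_
  by_cases hx : x ∈ e.source ∩ e ⁻¹' K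
  · rw [Set.indicator_of_mem hx]
    exact hwf x hx.1 hx.2
  · rw [Set.indicator_of_notMem hx, norm_zero]
    exact norm_nonneg _

/-- Norms on the manifold are bounded by norms in coordinates. -/
theorem IsBilipschitzChart.eLpNorm_le_of_ge {κ : ℝ} (hκ0 : 0 < κ)
    (hκ : IsBilipschitzChart e κ) (he : e ∈ IsManifold.maximalAtlas (𝓡 d) ∞ M)
    {p : ℝ≥0∞} (hp : p ≠ ⊤) {K : Set (EuclideanSpace ℝ (Fin d))} (hK : MeasurableSet K)
    (hKe : K ⊆ e.target) {w : EuclideanSpace ℝ (Fin d) → ℝ} (hw : ContinuousOn w K) :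
    eLpNorm ((e.source ∩ e ⁻¹' K).indicator (w ∘ e)) p (riemannianMeasure d M)
      ≤ ENNReal.ofReal (κ ^ d) ^ (1 / p).toReal * eLpNorm w p (volume.restrict K) := by
  rw [← eLpNorm_indicator_comp_symm hK hKe, ← eLpNorm_indicator_chart hK]
  exact hκ.eLpNorm_restrict_source_le hκ0 he hp (aestronglyMeasurable_indicator_chart hK hw _)

theorem integral_source_eq (he : e ∈ IsManifold.maximalAtlas (𝓡 d) ∞ M)
    (hρ : AEMeasurable (volDensity e) (volume.restrict e.target)) {h : M → ℝ}
    (hh : AEStronglyMeasurable h ((riemannianMeasure d M).restrict e.source)) :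
    ∫ x in e.source, h x ∂(riemannianMeasure d M)
      = ∫ ξ in e.target, volDensity e ξ * h (e.symm ξ) := by
  rw [riemannianMeasure_restrict_source he, chartMeasure_eq_map] at hh ⊢
  rw [integral_map (aemeasurable_symm_withDensity e) hh,
    integral_withDensity_eq_integral_toReal_smul₀ hρ.ennreal_ofReal
      (Eventually.of_forall fun _ ↦ ENNReal.ofReal_lt_top)]
  simp only [ENNReal.toReal_ofReal (volDensity_nonneg _), smul_eq_mul]

variable [IsContMDiffRiemannianBundle (𝓡 d) ∞ (EuclideanSpace ℝ (Fin d))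
      (fun x : M ↦ TangentSpace (𝓡 d) x)]

theorem contDiffOn_det_metricMatrix (he : e ∈ IsManifold.maximalAtlas (𝓡 d) ∞ M) :
    ContDiffOn ℝ ∞ (fun ξ ↦ (metricMatrix e (e.symm ξ)).det) e.target := by
  simp only [Matrix.det_apply]
  refine ContDiffOn.sum fun σ _ ↦ ?_
  refine ContDiffOn.const_smul _ ?_
  exact contDiffOn_prod fun i _ ↦ contDiffOn_metricMatrix he _ _

/-- The determinant is bounded away from zero, where the square root is smooth. -/
theorem IsBilipschitzChart.contDiffOn_volDensity {κ : ℝ} (hκ0 : 0 < κ)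
    (hκ : IsBilipschitzChart e κ) (he : e ∈ IsManifold.maximalAtlas (𝓡 d) ∞ M) :
    ContDiffOn ℝ ∞ (volDensity e) e.target :=
  (contDiffOn_det_metricMatrix he).sqrt fun _ hξ ↦
    (lt_of_lt_of_le (by positivity) (hκ.det_metricMatrix_mem hκ0 he hξ).1).ne'

end Transfer

/-! ### Mollification on `ℝ^d` -/

section Mollify

variable {d : ℕ} {G : Type*} [NormedAddCommGroup G] [NormedSpace ℝ G] [CompleteSpace G]

/-- A smooth probability density supported in the ball of radius `r`. -/
structure IsMollifier (k : EuclideanSpace ℝ (Fin d) → ℝ) (r : ℝ) : Prop where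
  contDiff : ContDiff ℝ ∞ k
  nonneg : ∀ ξ, 0 ≤ k ξ
  support_subset : Function.support k ⊆ Metric.ball 0 r
  integral_eq : ∫ ξ, k ξ = 1

theorem isMollifier_rescaledKernel {ζ : EuclideanSpace ℝ (Fin d) → ℝ}
    (hζ_smooth : ContDiff ℝ ∞ ζ) (hζ_nonneg : ∀ ξ, 0 ≤ ζ ξ)
    (hζ_supp : Function.support ζ ⊆ Metric.ball 0 1) (hζ_int : ∫ ξ, ζ ξ = 1) {n : ℕ}
    (hn : 1 ≤ n) : IsMollifier (rescaledKernel ζ n) ((n : ℝ)⁻¹) where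
  contDiff := contDiff_const.mul (hζ_smooth.comp (contDiff_const_smul _))
  nonneg ξ := mul_nonneg (by positivity) (hζ_nonneg _)
  support_subset ξ hξ := by
    have hn' : (0 : ℝ) < n := by exact_mod_cast hn
    have h : (n : ℝ) • ξ ∈ Function.support ζ := fun h ↦ hξ (by simp [rescaledKernel, h])
    have h' := hζ_supp h
    rw [mem_ball_zero_iff, norm_smul, Real.norm_of_nonneg hn'.le] at h'
    rw [mem_ball_zero_iff, ← one_div, lt_div_iff₀ hn', mul_comm]
    exact h'
  integral_eq := by
    have hn' : (0 : ℝ) < n := by exact_mod_cast hn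
    simp only [rescaledKernel]
    rw [integral_const_mul, Measure.integral_comp_smul, hζ_int, finrank_euclideanSpace_fin,
      smul_eq_mul, mul_one, abs_of_pos (by positivity), mul_inv_cancel₀ (by positivity)]

namespace IsMollifier

variable {k : EuclideanSpace ℝ (Fin d) → ℝ} {r : ℝ} (hk : IsMollifier k r)
include hk

theorem hasCompactSupport : HasCompactSupport k :=
  HasCompactSupport.intro (isCompact_closedBall 0 r) fun _ hx ↦ by
    by_contra h
    exact hx (Metric.ball_subset_closedBall (hk.support_subset h))

theorem eq_zero {η ξ : EuclideanSpace ℝ (Fin d)} (h : r ≤ dist ξ η) : k (η - ξ) = 0 := by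
  by_contra h'
  have := hk.support_subset h'
  rw [mem_ball_zero_iff, ← dist_eq_norm, dist_comm] at this
  linarith

theorem integrable : Integrable k := hk.contDiff.continuous.integrable_of_hasCompactSupport
  hk.hasCompactSupport

theorem integral_sub (η : EuclideanSpace ℝ (Fin d)) : ∫ ξ, k (η - ξ) = 1 := by
  rw [integral_sub_left_eq_self k volume η, hk.integral_eq]

theorem lintegral_sub (η : EuclideanSpace ℝ (Fin d)) : ∫⁻ ξ, ENNReal.ofReal (k (η - ξ)) = 1 := by
  rw [← ofReal_integral_eq_lintegral_ofReal (hk.integrable.comp_sub_left η)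
    (Eventually.of_forall fun ξ ↦ hk.nonneg _), hk.integral_sub, ENNReal.ofReal_one]

theorem lintegral_sub' (ξ : EuclideanSpace ℝ (Fin d)) : ∫⁻ η, ENNReal.ofReal (k (η - ξ)) = 1 := by
  rw [lintegral_sub_right_eq_self (fun η ↦ ENNReal.ofReal (k η)) ξ, ← hk.lintegral_sub ξ,
    lintegral_sub_left_eq_self (fun η ↦ ENNReal.ofReal (k η)) ξ]

end IsMollifier

/-- Mollification, by the kernel `k`, of a function on `T` extended by zero. -/
def mollify (k : EuclideanSpace ℝ (Fin d) → ℝ) (T : Set (EuclideanSpace ℝ (Fin d)))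
    (u : EuclideanSpace ℝ (Fin d) → G) (η : EuclideanSpace ℝ (Fin d)) : G :=
  ∫ ξ in T, k (η - ξ) • u ξ

variable {k : EuclideanSpace ℝ (Fin d) → ℝ} {r : ℝ} {T : Set (EuclideanSpace ℝ (Fin d))}
  {u : EuclideanSpace ℝ (Fin d) → G}

/-- Extending `u` by zero turns the integral over `T` into a convolution, for which smoothness and
differentiation are known. -/
theorem mollify_eq_convolution (hT : MeasurableSet T) :
    mollify k T u = convolution (T.indicator u) k (ContinuousLinearMap.lsmul ℝ ℝ).flip volume := by
  ext1 η
  rw [mollify, convolution_def, ← integral_indicator hT]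
  congr 1
  ext1 ξ
  by_cases h : ξ ∈ T <;> simp [h]

theorem locallyIntegrable_indicator (hT : MeasurableSet T) (hu : IntegrableOn u T) :
    LocallyIntegrable (T.indicator u) :=
  ((integrable_indicator_iff hT).2 hu).locallyIntegrable

namespace IsMollifier

theorem contDiff_mollify (hk : IsMollifier k r) (hT : MeasurableSet T) (hu : IntegrableOn u T) :
    ContDiff ℝ ∞ (mollify k T u) := by
  rw [mollify_eq_convolution hT]
  exact hk.hasCompactSupport.contDiff_convolution_right _ (locallyIntegrable_indicator hT hu)
    hk.contDiff

theorem integrableOn_smul (hk : IsMollifier k r) (hu : IntegrableOn u T)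
    (η : EuclideanSpace ℝ (Fin d)) : IntegrableOn (fun ξ ↦ k (η - ξ) • u ξ) T := by
  obtain ⟨C, hC⟩ := hk.hasCompactSupport.exists_bound_of_continuous hk.contDiff.continuous
  exact hu.bdd_smul C (hk.contDiff.continuous.comp
    (continuous_const.sub continuous_id)).aestronglyMeasurable
    (Eventually.of_forall fun ξ ↦ hC _)

/-- The derivative falls on the kernel, so `u` need only be integrable. -/
theorem fderiv_mollify_apply (hk : IsMollifier k r) (hT : MeasurableSet T)
    (hu : IntegrableOn u T) (η v : EuclideanSpace ℝ (Fin d)) :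
    fderiv ℝ (mollify k T u) η v = ∫ ξ in T, fderiv ℝ k (η - ξ) v • u ξ := by
  have hloc := locallyIntegrable_indicator hT hu
  have hk1 : ContDiff ℝ 1 k := hk.contDiff.of_le (by exact_mod_cast le_top)
  rw [mollify_eq_convolution hT, (hk.hasCompactSupport.hasFDerivAt_convolution_right
      (ContinuousLinearMap.lsmul ℝ ℝ).flip hloc hk1 η).fderiv,
    convolution_precompR_apply _ hloc (hk.hasCompactSupport.fderiv ℝ)
      (hk1.continuous_fderiv one_ne_zero), convolution_def, ← integral_indicator hT]
  congr 1
  ext1 ξ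
  by_cases h : ξ ∈ T <;> simp [h]

/-- For a fixed kernel, mollification maps `L¹` to `C¹`. -/
theorem exists_bound (hk : IsMollifier k r) : ∃ C : ℝ, 0 ≤ C ∧
    ∀ {T : Set (EuclideanSpace ℝ (Fin d))} {u : EuclideanSpace ℝ (Fin d) → G},
      MeasurableSet T → IntegrableOn u T → ∀ η, ‖mollify k T u η‖ ≤ C * ∫ ξ in T, ‖u ξ‖ ∧
        ‖fderiv ℝ (mollify k T u) η‖ ≤ C * ∫ ξ in T, ‖u ξ‖ := by
  obtain ⟨C, hC⟩ := hk.hasCompactSupport.exists_bound_of_continuous hk.contDiff.continuous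
  obtain ⟨C', hC'⟩ := (hk.hasCompactSupport.fderiv ℝ).exists_bound_of_continuous
    (hk.contDiff.continuous_fderiv (by simp))
  have h0 : 0 ≤ C := (norm_nonneg _).trans (hC 0)
  refine ⟨max C C', h0.trans (le_max_left _ _), fun {T u} hT hu η ↦ ⟨?_, ?_⟩⟩
  · rw [mollify, ← integral_const_mul]
    refine norm_integral_le_of_norm_le (hu.norm.const_mul _) (Eventually.of_forall fun ξ ↦ ?_)
    rw [norm_smul]
    gcongr
    exact (hC _).trans (le_max_left _ _)
  · refine ContinuousLinearMap.opNorm_le_bound _ (mul_nonneg (h0.trans (le_max_left _ _))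
      (integral_nonneg fun _ ↦ norm_nonneg _)) fun v ↦ ?_
    rw [hk.fderiv_mollify_apply hT hu, ← integral_const_mul, ← integral_mul_const]
    refine norm_integral_le_of_norm_le ((hu.norm.const_mul _).mul_const _)
      (Eventually.of_forall fun ξ ↦ ?_)
    rw [norm_smul]
    calc _ ≤ (max C C' * ‖v‖) * ‖u ξ‖ := by
          gcongr
          refine (ContinuousLinearMap.le_opNorm _ _).trans ?_
          gcongr
          exact (hC' _).trans (le_max_right _ _)
      _ = _ := by ring

theorem tsupport_sub (hk : IsMollifier k r) (η : EuclideanSpace ℝ (Fin d)) :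
    tsupport (fun ξ ↦ k (η - ξ)) ⊆ Metric.closedBall η r := by
  refine closure_minimal (fun ξ hξ ↦ ?_) Metric.isClosed_closedBall
  rw [Metric.mem_closedBall]
  by_contra! h
  exact hξ (hk.eq_zero h.le)

/-- Differentiation commutes with mollification away from the boundary. -/
theorem fderiv_mollify_eq_mollify_fderiv (hk : IsMollifier k r) (hT : IsOpen T)
    (hu : IntegrableOn u T) (hu1 : ContDiffOn ℝ 1 u T) {η : EuclideanSpace ℝ (Fin d)}
    (hη : Metric.closedBall η r ⊆ T) :
    fderiv ℝ (mollify k T u) η = mollify k T (fderiv ℝ u) η := by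
  have hcu : ContinuousOn u (Metric.closedBall η r) := hu1.continuousOn.mono hη
  have hcu' : ContinuousOn (fderiv ℝ u) (Metric.closedBall η r) :=
    (hu1.continuousOn_fderiv_of_isOpen hT le_rfl).mono hη
  have hkη : ContDiff ℝ ∞ (fun ξ ↦ k (η - ξ)) :=
    hk.contDiff.comp (contDiff_const.sub contDiff_id)
  have hsupp : ∀ ξ, ξ ∉ Metric.closedBall η r → k (η - ξ) = 0 := fun ξ hξ ↦
    hk.eq_zero (not_le.1 hξ).le
  have hfd (ξ v) : fderiv ℝ (fun ξ ↦ k (η - ξ)) ξ v = - fderiv ℝ k (η - ξ) v := by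
    have h1 : HasFDerivAt k (fderiv ℝ k (η - ξ)) (η - ξ) :=
      ((hk.contDiff.differentiable (by simp)) _).hasFDerivAt
    have h2 : HasFDerivAt (fun ξ ↦ k (η - ξ)) _ ξ := h1.comp ξ ((hasFDerivAt_id ξ).const_sub η)
    rw [h2.fderiv]
    simp
  have hsupp' : ∀ ξ, ξ ∉ Metric.closedBall η r → fderiv ℝ (fun ξ ↦ k (η - ξ)) ξ = 0 := fun ξ hξ ↦ by
    by_contra h
    exact hξ (hk.tsupport_sub η (support_fderiv_subset ℝ h))
  have hint {F : EuclideanSpace ℝ (Fin d) → G} (hF : ContinuousOn F (Metric.closedBall η r))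
      (h0 : ∀ ξ, ξ ∉ Metric.closedBall η r → F ξ = 0) : Integrable F := by
    refine (integrableOn_iff_integrable_of_support_subset (s := Metric.closedBall η r) ?_).1
      (hF.integrableOn_compact (isCompact_closedBall η r))
    intro ξ hξ
    by_contra h
    exact hξ (h0 ξ h)
  have hkc := hkη.continuous
  have hkc' (v) : Continuous (fun ξ ↦ fderiv ℝ (fun ξ ↦ k (η - ξ)) ξ v) :=
    (hkη.continuous_fderiv (by simp)).clm_apply continuous_const
  have hset {F : EuclideanSpace ℝ (Fin d) → G}
      (h0 : ∀ ξ, ξ ∉ Metric.closedBall η r → F ξ = 0) : ∫ ξ in T, F ξ = ∫ ξ, F ξ :=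
    setIntegral_eq_integral_of_forall_compl_eq_zero fun ξ hξ ↦ h0 ξ fun h ↦ hξ (hη h)
  ext1 v
  rw [hk.fderiv_mollify_apply hT.measurableSet hu, mollify]
  have hap : (∫ ξ in T, k (η - ξ) • fderiv ℝ u ξ) v = ∫ ξ in T, k (η - ξ) • fderiv ℝ u ξ v := by
    rw [ContinuousLinearMap.integral_apply]
    · rfl
    · refine Integrable.integrableOn ?_
      refine (integrableOn_iff_integrable_of_support_subset (s := Metric.closedBall η r) ?_).1
        ((hkc.continuousOn.smul hcu').integrableOn_compact (isCompact_closedBall η r))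
      intro ξ hξ
      by_contra h
      exact hξ (by simp [hsupp ξ h])
  rw [hap, hset (fun ξ hξ ↦ by
    have := hfd ξ v
    rw [hsupp' ξ hξ] at this
    simp only [_root_.zero_apply, zero_eq_neg] at this
    rw [this, zero_smul]), hset (fun ξ hξ ↦ by simp [hsupp ξ hξ])]
  -- The kernel is supported in a ball inside `T`, so there is no boundary term. The sign from
  -- integration by parts cancels the one from differentiating `k(η - ξ)` in `ξ`.
  rw [integral_smul_fderiv_eq_neg_fderiv_smul_of_integrable]
  · simp only [hfd, neg_smul, integral_neg, neg_neg]
  · exact hint ((hkc' v).continuousOn.smul hcu) fun ξ hξ ↦ by simp [hsupp' ξ hξ]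
  · exact hint (hkc.continuousOn.smul (hcu'.clm_apply continuousOn_const))
      fun ξ hξ ↦ by simp [hsupp ξ hξ]
  · exact hint (hkc.continuousOn.smul hcu) fun ξ hξ ↦ by simp [hsupp ξ hξ]
  · exact fun ξ _ ↦ (hkη.differentiable (by simp)) ξ
  · exact fun ξ hξ ↦ (hu1.contDiffAt (hT.mem_nhds (hη (hk.tsupport_sub η hξ)))).differentiableAt
      one_ne_zero

/-- The kernel is a probability density on the ball, so the left side is the norm of an average of
`u - c` over that ball. -/
theorem norm_mollify_sub_le (hk : IsMollifier k r)
    {η : EuclideanSpace ℝ (Fin d)} {c : G} {ε : ℝ} (hη : Metric.ball η r ⊆ T)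
    (hu : IntegrableOn (fun ξ ↦ k (η - ξ) • u ξ) T)
    (hε : ∀ ξ ∈ Metric.ball η r, ‖u ξ - c‖ ≤ ε) : ‖mollify k T u η - c‖ ≤ ε := by
  have hkη : Integrable (fun ξ ↦ k (η - ξ)) := hk.integrable.comp_sub_left η
  have hset : ∫ ξ in T, k (η - ξ) = 1 := by
    rw [setIntegral_eq_integral_of_forall_compl_eq_zero, hk.integral_sub]
    intro ξ hξ
    exact hk.eq_zero (not_lt.1 fun h ↦ hξ (hη h))
  have hc : mollify k T u η - c = ∫ ξ in T, k (η - ξ) • (u ξ - c) := by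
    simp only [smul_sub]
    rw [MeasureTheory.integral_sub hu (hkη.integrableOn.smul_const c), integral_smul_const,
      hset, one_smul,
      mollify]
  have hε' : ε = ∫ ξ in T, k (η - ξ) * ε := by rw [integral_mul_const, hset, one_mul]
  rw [hc, hε']
  refine norm_integral_le_of_norm_le (hkη.integrableOn.mul_const ε)
    (Eventually.of_forall fun ξ ↦ ?_)
  rw [norm_smul, Real.norm_of_nonneg (hk.nonneg _)]
  by_cases h : ξ ∈ Metric.ball η r
  · exact mul_le_mul_of_nonneg_left (hε ξ h) (hk.nonneg _)
  · rw [hk.eq_zero (not_lt.1 h), zero_mul, zero_mul]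

/-- Only values of `u` on the ball of radius `r` matter, hence the restriction to `K'`. -/
theorem enorm_mollify_le (hk : IsMollifier k r)
    {K' : Set (EuclideanSpace ℝ (Fin d))} {η : EuclideanSpace ℝ (Fin d)}
    (hη : Metric.ball η r ⊆ K') :
    ‖mollify k T u η‖ₑ ≤ ∫⁻ ξ, ENNReal.ofReal (k (η - ξ)) * K'.indicator (fun ξ ↦ ‖u ξ‖ₑ) ξ := by
  rw [mollify]
  refine (enorm_integral_le_lintegral_enorm _).trans ?_
  refine (setLIntegral_le_lintegral _ _).trans (lintegral_mono fun ξ ↦ ?_)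
  by_cases h : ξ ∈ Metric.ball η r
  · rw [Set.indicator_of_mem (hη h), enorm_smul, ← ofReal_norm,
      Real.norm_of_nonneg (hk.nonneg _)]
  · simp [hk.eq_zero (not_lt.1 h)]

/-- Mollification is a contraction in `L^p`, up to enlarging the domain. -/
theorem eLpNorm_mollify_le (hk : IsMollifier k r)
    {K K' : Set (EuclideanSpace ℝ (Fin d))} (hK : MeasurableSet K) (hK' : MeasurableSet K')
    (hKK' : ∀ η ∈ K, Metric.ball η r ⊆ K') {p : ℝ≥0∞} (hp : 1 ≤ p) (hp' : p ≠ ⊤)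
    (hu : AEStronglyMeasurable u (volume.restrict K')) :
    eLpNorm (mollify k T u) p (volume.restrict K) ≤ eLpNorm u p (volume.restrict K') := by
  have hp0 : p ≠ 0 := (zero_lt_one.trans_le hp).ne'
  have hq : 1 ≤ p.toReal := by
    rw [← ENNReal.toReal_one]
    exact ENNReal.toReal_mono hp' hp
  have hkm (η : EuclideanSpace ℝ (Fin d)) : Measurable fun ξ ↦ ENNReal.ofReal (k (η - ξ)) :=
    (hk.contDiff.continuous.comp (continuous_const.sub continuous_id)).measurable.ennreal_ofReal
  set w : EuclideanSpace ℝ (Fin d) → ℝ≥0∞ := K'.indicator (fun ξ ↦ ‖u ξ‖ₑ) with hw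
  have hwm : AEMeasurable w volume := (aemeasurable_indicator_iff hK').2 hu.enorm
  -- Jensen's inequality for the probability measure `k(η - ξ) dξ`, in the form `L^1 ≤ L^p`.
  have hjensen (η : EuclideanSpace ℝ (Fin d)) :
      (∫⁻ ξ, ENNReal.ofReal (k (η - ξ)) * w ξ) ^ p.toReal
        ≤ ∫⁻ ξ, ENNReal.ofReal (k (η - ξ)) * w ξ ^ p.toReal := by
    set μ := volume.withDensity fun ξ ↦ ENNReal.ofReal (k (η - ξ))
    have hμ : IsProbabilityMeasure μ := ⟨by
      rw [withDensity_apply _ MeasurableSet.univ, Measure.restrict_univ, hk.lintegral_sub]⟩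
    have hwμ : AEMeasurable w μ := hwm.mono_ac (withDensity_absolutelyContinuous _ _)
    have h1 := eLpNorm_le_eLpNorm_of_exponent_le hp hwμ.aestronglyMeasurable
    rw [eLpNorm_one_eq_lintegral_enorm, eLpNorm_eq_lintegral_rpow_enorm_toReal hp0 hp'] at h1
    simp only [enorm_eq_self] at h1
    have h2 := ENNReal.rpow_le_rpow h1 (zero_le_one.trans hq)
    rw [← ENNReal.rpow_mul, one_div, inv_mul_cancel₀ (zero_lt_one.trans_le hq).ne',
      ENNReal.rpow_one] at h2
    rwa [lintegral_withDensity_eq_lintegral_mul₀ (hkm η).aemeasurable hwm,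
      lintegral_withDensity_eq_lintegral_mul₀ (hkm η).aemeasurable (hwm.pow_const _)] at h2
  rw [eLpNorm_eq_lintegral_rpow_enorm_toReal hp0 hp',
    eLpNorm_eq_lintegral_rpow_enorm_toReal hp0 hp']
  refine ENNReal.rpow_le_rpow ?_ (by positivity)
  calc ∫⁻ η in K, ‖mollify k T u η‖ₑ ^ p.toReal
      ≤ ∫⁻ η in K, ∫⁻ ξ, ENNReal.ofReal (k (η - ξ)) * w ξ ^ p.toReal := by
        refine setLIntegral_mono' hK fun η hη ↦ (ENNReal.rpow_le_rpow
          (hk.enorm_mollify_le (hKK' η hη)) (by positivity)).trans (hjensen η)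
    _ ≤ ∫⁻ η, ∫⁻ ξ, ENNReal.ofReal (k (η - ξ)) * w ξ ^ p.toReal := setLIntegral_le_lintegral _ _
    -- Tonelli; the kernel also has integral one in `η`.
    _ = ∫⁻ ξ, ∫⁻ η, ENNReal.ofReal (k (η - ξ)) * w ξ ^ p.toReal := by
        refine lintegral_lintegral_swap (AEMeasurable.mul ?_ ?_)
        · exact (hk.contDiff.continuous.comp
            (continuous_fst.sub continuous_snd)).measurable.ennreal_ofReal.aemeasurable
        · exact (hwm.pow_const _).comp_snd
    _ = ∫⁻ ξ, w ξ ^ p.toReal := by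
        refine lintegral_congr fun ξ ↦ ?_
        rw [lintegral_mul_const, hk.lintegral_sub', one_mul]
        exact (hk.contDiff.continuous.comp
          (continuous_id.sub continuous_const)).measurable.ennreal_ofReal
    _ = ∫⁻ ξ in K', ‖u ξ‖ₑ ^ p.toReal := by
        rw [← lintegral_indicator hK']
        refine lintegral_congr fun ξ ↦ ?_
        by_cases h : ξ ∈ K'
        · simp [hw, h]
        · simp [hw, h, (zero_lt_one.trans_le hq)]

end IsMollifier

end Mollify

/-! ### Euclidean Sobolev norms of mollified functions -/

section LocalSobolev

variable {d : ℕ} {G : Type*} [NormedAddCommGroup G] [NormedSpace ℝ G] [CompleteSpace G]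

/-- The `W^{1,p}` norm over `K` of a function with values in a normed space. -/
def localSobolevNorm (p : ℝ≥0∞) (K : Set (EuclideanSpace ℝ (Fin d)))
    (u : EuclideanSpace ℝ (Fin d) → G) : ℝ≥0∞ :=
  eLpNorm u p (volume.restrict K) + eLpNorm (fderiv ℝ u) p (volume.restrict K)

variable {k : EuclideanSpace ℝ (Fin d) → ℝ} {r : ℝ} {K K' T : Set (EuclideanSpace ℝ (Fin d))}
  {p : ℝ≥0∞} {u v : EuclideanSpace ℝ (Fin d) → G}

theorem localSobolevNorm_mono_set (h : K ⊆ K') :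
    localSobolevNorm p K u ≤ localSobolevNorm p K' u :=
  add_le_add (eLpNorm_mono_measure _ (Measure.restrict_mono h le_rfl))
    (eLpNorm_mono_measure _ (Measure.restrict_mono h le_rfl))

theorem localSobolevNorm_add_le (hp : 1 ≤ p) (hT : IsOpen T) (hK : MeasurableSet K) (hKT : K ⊆ T)
    (hu : ContDiffOn ℝ 1 u T) (hv : ContDiffOn ℝ 1 v T) :
    localSobolevNorm p K (fun ξ ↦ u ξ + v ξ)
      ≤ localSobolevNorm p K u + localSobolevNorm p K v := by
  have hd {w : EuclideanSpace ℝ (Fin d) → G} (hw : ContDiffOn ℝ 1 w T) :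
      AEStronglyMeasurable w (volume.restrict K) ∧
        AEStronglyMeasurable (fderiv ℝ w) (volume.restrict K) :=
    ⟨(hw.continuousOn.mono hKT).aestronglyMeasurable hK,
      ((hw.continuousOn_fderiv_of_isOpen hT le_rfl).mono hKT).aestronglyMeasurable hK⟩
  have hfd : fderiv ℝ (fun ξ ↦ u ξ + v ξ) =ᵐ[volume.restrict K] fderiv ℝ u + fderiv ℝ v := by
    filter_upwards [ae_restrict_mem hK] with ξ hξ
    have hξ' := hT.mem_nhds (hKT hξ)
    exact fderiv_add ((hu.contDiffAt hξ').differentiableAt one_ne_zero)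
      ((hv.contDiffAt hξ').differentiableAt one_ne_zero)
  rw [localSobolevNorm, eLpNorm_congr_ae hfd]
  refine (add_le_add (eLpNorm_add_le (hd hu).1 (hd hv).1 hp)
    (eLpNorm_add_le (hd hu).2 (hd hv).2 hp)).trans_eq ?_
  rw [localSobolevNorm, localSobolevNorm]
  ring

theorem localSobolevNorm_le_of_bound (hK : MeasurableSet K) {c : ℝ}
    (h : ∀ ξ ∈ K, ‖u ξ‖ ≤ c ∧ ‖fderiv ℝ u ξ‖ ≤ c) :
    localSobolevNorm p K u ≤ 2 * volume K ^ p.toReal⁻¹ * ENNReal.ofReal c := by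
  have h1 := eLpNorm_le_of_ae_bound (p := p) (μ := volume.restrict K)
    ((ae_restrict_mem hK).mono fun ξ hξ ↦ (h ξ hξ).1)
  have h2 := eLpNorm_le_of_ae_bound (p := p) (μ := volume.restrict K)
    ((ae_restrict_mem hK).mono fun ξ hξ ↦ (h ξ hξ).2)
  rw [Measure.restrict_apply_univ] at h1 h2
  refine (add_le_add h1 h2).trans_eq ?_
  ring

theorem tendsto_zero_of_eventually_le {α : Type*} {l : Filter α} {f : α → ℝ≥0∞} {B : ℝ≥0∞}
    (hB : B ≠ ⊤) (h : ∀ ε : ℝ, 0 < ε → ∀ᶠ n in l, f n ≤ B * ENNReal.ofReal ε) :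
    Tendsto f l (𝓝 0) := by
  refine ENNReal.tendsto_nhds_zero.2 fun ε hε ↦ ?_
  have hlim : Tendsto (fun δ : ℝ ↦ B * ENNReal.ofReal δ) (𝓝[>] 0) (𝓝 0) := by
    have h1 : Tendsto (fun δ : ℝ ↦ B * ENNReal.ofReal δ) (𝓝 0) (𝓝 (B * ENNReal.ofReal 0)) :=
      ENNReal.Tendsto.const_mul ENNReal.continuous_ofReal.continuousAt (Or.inr hB)
    rw [ENNReal.ofReal_zero, mul_zero] at h1
    exact h1.mono_left nhdsWithin_le_nhds
  obtain ⟨δ, hδ, hδ0⟩ := ((ENNReal.tendsto_nhds_zero.1 hlim ε hε).and self_mem_nhdsWithin).exists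
  exact (h δ hδ0).mono fun n hn ↦ hn.trans hδ

namespace IsMollifier

theorem integrableOn_smul_of_continuousOn (hk : IsMollifier k r)
    {η : EuclideanSpace ℝ (Fin d)} (hu : ContinuousOn u (Metric.closedBall η r)) :
    Integrable (fun ξ ↦ k (η - ξ) • u ξ) := by
  refine (integrableOn_iff_integrable_of_support_subset (s := Metric.closedBall η r) ?_).1
    (((hk.contDiff.continuous.comp (continuous_const.sub continuous_id)).continuousOn.smul
      hu).integrableOn_compact (isCompact_closedBall η r))
  intro ξ hξ
  by_contra h
  exact hξ (by simp [hk.eq_zero (not_le.1 h).le])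

/-- The `L^p` contraction is applied to `u` and, since differentiation commutes with mollification
on `K`, to its derivative. The bound does not depend on the kernel. -/
theorem localSobolevNorm_mollify_le (hk : IsMollifier k r) (hT : IsOpen T) (hK : MeasurableSet K)
    (hK' : MeasurableSet K') (hKK' : ∀ η ∈ K, Metric.closedBall η r ⊆ K') (hKT : K' ⊆ T)
    (hp : 1 ≤ p) (hp' : p ≠ ⊤) (hu : IntegrableOn u T) (hu1 : ContDiffOn ℝ 1 u T) :
    localSobolevNorm p K (mollify k T u) ≤ localSobolevNorm p K' u := by
  have hball : ∀ η ∈ K, Metric.ball η r ⊆ K' := fun η hη ↦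
    Metric.ball_subset_closedBall.trans (hKK' η hη)
  refine add_le_add (hk.eLpNorm_mollify_le hK hK' hball hp hp'
    ((hu1.continuousOn.mono hKT).aestronglyMeasurable hK')) ?_
  have h : fderiv ℝ (mollify k T u) =ᵐ[volume.restrict K] mollify k T (fderiv ℝ u) := by
    filter_upwards [ae_restrict_mem hK] with η hη
    exact hk.fderiv_mollify_eq_mollify_fderiv hT hu hu1 ((hKK' η hη).trans hKT)
  rw [eLpNorm_congr_ae h]
  exact hk.eLpNorm_mollify_le hK hK' hball hp hp'
    (((hu1.continuousOn_fderiv_of_isOpen hT le_rfl).mono hKT).aestronglyMeasurable hK')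

/-- Here `u` has no derivative and the constant depends on the kernel. It serves at fixed `n` for
the remainder `Y_i - X`, which is small only in norms without derivatives. -/
theorem exists_localSobolevNorm_mollify_le (hk : IsMollifier k r) (hK : IsCompact K)
    (p : ℝ≥0∞) : ∃ C : ℝ≥0∞, C ≠ ⊤ ∧
    ∀ {T : Set (EuclideanSpace ℝ (Fin d))} {u : EuclideanSpace ℝ (Fin d) → G},
      MeasurableSet T → IntegrableOn u T →
        localSobolevNorm p K (mollify k T u) ≤ C * eLpNorm u 1 (volume.restrict T) := by
  obtain ⟨C, hC0, hC⟩ := hk.exists_bound (G := G)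
  refine ⟨2 * volume K ^ p.toReal⁻¹ * ENNReal.ofReal C, ?_, fun {T u} hT hu ↦ ?_⟩
  · exact ENNReal.mul_ne_top (ENNReal.mul_ne_top (by simp)
      (ENNReal.rpow_ne_top_of_nonneg (by positivity) hK.measure_lt_top.ne)) ENNReal.ofReal_ne_top
  · refine (localSobolevNorm_le_of_bound hK.measurableSet fun η _ ↦ hC hT hu η).trans_eq ?_
    rw [ENNReal.ofReal_mul hC0, ofReal_integral_norm_eq_lintegral_enorm hu,
      eLpNorm_one_eq_lintegral_enorm]
    ring

end IsMollifier

/-- On the compact set `K'` both `u` and its derivative are uniformly continuous, so their averages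
over balls of radius `1/n` converge uniformly on `K`. -/
theorem tendsto_localSobolevNorm_mollify_sub {ζ : EuclideanSpace ℝ (Fin d) → ℝ}
    (hζ : ∀ n : ℕ, 1 ≤ n → IsMollifier (rescaledKernel ζ n) ((n : ℝ)⁻¹)) (hT : IsOpen T)
    (hK : IsCompact K) (hK' : IsCompact K') {δ : ℝ} (hδ : 0 < δ)
    (hKK' : ∀ η ∈ K, Metric.closedBall η δ ⊆ K') (hKT : K' ⊆ T)
    (hu : IntegrableOn u T) (hu1 : ContDiffOn ℝ 1 u T) :
    Tendsto (fun n ↦ localSobolevNorm p K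
      (fun ξ ↦ u ξ - mollify (rescaledKernel ζ n) T u ξ)) atTop (𝓝 0) := by
  have hB : 2 * volume K ^ p.toReal⁻¹ ≠ ⊤ := ENNReal.mul_ne_top (by simp)
      (ENNReal.rpow_ne_top_of_nonneg (by positivity) hK.measure_lt_top.ne)
  refine tendsto_zero_of_eventually_le hB fun ε hε ↦ ?_
  have hc := hu1.continuousOn.mono hKT
  have hc' := (hu1.continuousOn_fderiv_of_isOpen hT le_rfl).mono hKT
  obtain ⟨δ₁, hδ₁, h₁⟩ := Metric.uniformContinuousOn_iff.1
    (hK'.uniformContinuousOn_of_continuous hc) ε hε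
  obtain ⟨δ₂, hδ₂, h₂⟩ := Metric.uniformContinuousOn_iff.1
    (hK'.uniformContinuousOn_of_continuous hc') ε hε
  -- The radius must keep the ball in `K'` and respect the moduli of continuity of `u` and of its
  -- derivative.
  have hlim : ∀ᶠ n : ℕ in atTop, (n : ℝ)⁻¹ < min δ (min δ₁ δ₂) :=
    (tendsto_inv_atTop_nhds_zero_nat (𝕜 := ℝ)).eventually_lt_const (by positivity)
  filter_upwards [hlim, eventually_ge_atTop 1] with n hn hn1
  have hk := hζ n hn1
  set r := ((n : ℝ)⁻¹)
  have hrδ : r < δ := hn.trans_le (min_le_left _ _)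
  have hr1 : r < δ₁ := hn.trans_le ((min_le_right _ _).trans (min_le_left _ _))
  have hr2 : r < δ₂ := hn.trans_le ((min_le_right _ _).trans (min_le_right _ _))
  refine localSobolevNorm_le_of_bound hK.measurableSet fun η hη ↦ ?_
  have hball : Metric.closedBall η r ⊆ K' := (Metric.closedBall_subset_closedBall hrδ.le).trans
    (hKK' η hη)
  have hηK : η ∈ K' := hKK' η hη (Metric.mem_closedBall_self hδ.le)
  have hη' := Metric.ball_subset_closedBall.trans (hball.trans hKT)
  constructor
  · rw [norm_sub_rev]
    refine hk.norm_mollify_sub_le hη' (hk.integrableOn_smul hu η) fun ξ hξ ↦ ?_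
    rw [← dist_eq_norm]
    exact (h₁ ξ (hball (Metric.ball_subset_closedBall hξ)) η hηK
      ((Metric.mem_ball.1 hξ).trans hr1)).le
  · rw [fderiv_fun_sub ((hu1.contDiffAt (hT.mem_nhds (hKT hηK))).differentiableAt one_ne_zero)
      (((hk.contDiff_mollify hT.measurableSet hu).differentiable (by simp)) η), norm_sub_rev,
      hk.fderiv_mollify_eq_mollify_fderiv hT hu hu1 (hball.trans hKT)]
    refine hk.norm_mollify_sub_le hη'
      (hk.integrableOn_smul_of_continuousOn (hc'.mono hball)).integrableOn fun ξ hξ ↦ ?_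
    rw [← dist_eq_norm]
    exact (h₂ ξ (hball (Metric.ball_subset_closedBall hξ)) η hηK
      ((Metric.mem_ball.1 hξ).trans hr2)).le

end LocalSobolev

/-! ### Assembling vector fields from components with the partition of unity -/

section Assemble

variable {d : ℕ} {M : Type*} [TopologicalSpace M] [ChartedSpace (EuclideanSpace ℝ (Fin d)) M]
  [IsManifold (𝓡 d) ∞ M] {ι : Type*} [Fintype ι]
  {φ : ι → OpenPartialHomeomorph M (EuclideanSpace ℝ (Fin d))}
  {ψ : SmoothPartitionOfUnity ι (𝓡 d) M Set.univ}

/-- The image in the chart `φ α` of the support of `ψ α`. -/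
def chartSupport (φ : ι → OpenPartialHomeomorph M (EuclideanSpace ℝ (Fin d)))
    (ψ : SmoothPartitionOfUnity ι (𝓡 d) M Set.univ) (α : ι) : Set (EuclideanSpace ℝ (Fin d)) :=
  φ α '' tsupport (ψ α)

/-- The vector field `∑_α ψ_α u_α^k ∂_{ξ^k_α}`. -/
def assembleField (φ : ι → OpenPartialHomeomorph M (EuclideanSpace ℝ (Fin d)))
    (ψ : SmoothPartitionOfUnity ι (𝓡 d) M Set.univ)
    (u : ι → EuclideanSpace ℝ (Fin d) → EuclideanSpace ℝ (Fin d)) (x : M) :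
    TangentSpace (𝓡 d) x :=
  ∑ α, ψ α x • ofChartComponents (φ α) x (u α (φ α x))

theorem sum_partition (ψ : SmoothPartitionOfUnity ι (𝓡 d) M Set.univ) (x : M) :
    ∑ α, ψ α x = 1 := by
  rw [← finsum_eq_sum_of_fintype]
  exact ψ.sum_eq_one (Set.mem_univ x)

theorem exists_mem_tsupport (ψ : SmoothPartitionOfUnity ι (𝓡 d) M Set.univ) (x : M) :
    ∃ α, x ∈ tsupport (ψ α) := by
  by_contra! h
  have h1 := sum_partition ψ x
  rw [Finset.sum_eq_zero fun α _ ↦ image_eq_zero_of_notMem_tsupport (h α)] at h1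
  exact zero_ne_one h1

theorem assembleField_sub (u v : ι → EuclideanSpace ℝ (Fin d) → EuclideanSpace ℝ (Fin d)) (x : M) :
    assembleField φ ψ (fun α ξ ↦ u α ξ - v α ξ) x
      = assembleField φ ψ u x - assembleField φ ψ v x := by
  simp only [assembleField, ofChartComponents_sub, smul_sub, Finset.sum_sub_distrib]

theorem mollifiedField_eq_assembleField (ζ : EuclideanSpace ℝ (Fin d) → ℝ)
    (X : Π x : M, TangentSpace (𝓡 d) x) (n : ℕ) :
    mollifiedField ζ φ ψ X n = assembleField φ ψ fun α ↦
      mollify (rescaledKernel ζ n) (φ α).target (chartRep (φ α) X) := rfl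

variable (hφ : ∀ α, φ α ∈ IsManifold.maximalAtlas (𝓡 d) ∞ M)
  (hψ : ψ.IsSubordinate (fun α ↦ (φ α).source))

include hψ in
theorem chartSupport_subset (α : ι) : chartSupport φ ψ α ⊆ (φ α).target := by
  rintro _ ⟨x, hx, rfl⟩
  exact (φ α).map_source (hψ α hx)

include hψ in
theorem isCompact_chartSupport [CompactSpace M] (α : ι) : IsCompact (chartSupport φ ψ α) :=
  (isClosed_tsupport _).isCompact.image_of_continuousOn ((φ α).continuousOn.mono (hψ α))

include hψ in
theorem source_inter_preimage_chartSupport (α : ι) :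
    (φ α).source ∩ φ α ⁻¹' chartSupport φ ψ α = tsupport (ψ α) := by
  ext x
  constructor
  · rintro ⟨hx, y, hy, hxy⟩
    rwa [← (φ α).injOn (hψ α hy) hx hxy]
  · exact fun hx ↦ ⟨hψ α hx, x, hx, rfl⟩

include hφ hψ

/-- Each summand equals `ψ_α X`, and the cut-off functions sum to one. Thus `X` and `X_n` are
assembled in the same way, and their difference is assembled from differences of components. -/
theorem assembleField_chartRep (X : Π x : M, TangentSpace (𝓡 d) x) :
    assembleField φ ψ (fun α ↦ chartRep (φ α) X) = X := by
  ext1 x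
  have h (α) : ψ α x • ofChartComponents (φ α) x (chartRep (φ α) X (φ α x)) = ψ α x • X x := by
    by_cases hx : x ∈ tsupport (ψ α)
    · rw [chartRep_apply (hψ α hx), ofChartComponents_mvfderiv (hφ α) (hψ α hx)]
    · rw [image_eq_zero_of_notMem_tsupport hx, zero_smul, zero_smul]
  rw [assembleField, Finset.sum_congr rfl fun α _ ↦ h α, ← Finset.sum_smul, sum_partition,
    one_smul]

theorem contMDiff_summand {α : ι} {u : EuclideanSpace ℝ (Fin d) → EuclideanSpace ℝ (Fin d)}
    (hu : ContDiffOn ℝ ∞ u (φ α).target) :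
    IsSmoothField (fun x : M ↦ ψ α x • ofChartComponents (φ α) x (u (φ α x))) := by
  refine ContMDiffOn.smul_section_of_tsupport (u := (φ α).source)
    (s := fun x ↦ ofChartComponents (φ α) x (u (φ α x))) (ψ := ψ α)
    (ψ α).contMDiff.contMDiffOn (φ α).open_source (hψ α) fun x hx ↦ ?_
  exact (contMDiffAt_ofChartComponents (hφ α) hx (hu.contDiffAt
    ((φ α).open_target.mem_nhds ((φ α).map_source hx)))).contMDiffWithinAt

theorem isSmoothField_assembleField
    {u : ι → EuclideanSpace ℝ (Fin d) → EuclideanSpace ℝ (Fin d)}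
    (hu : ∀ α, ContDiffOn ℝ ∞ (u α) (φ α).target) : IsSmoothField (assembleField φ ψ u) :=
  ContMDiff.sum_section fun α _ ↦ contMDiff_summand hφ hψ (hu α)

/-- One `δ` serves all charts because there are finitely many; it is the room left for the kernels.
-/
theorem exists_cthickening [CompactSpace M] : ∃ δ : ℝ, 0 < δ ∧ ∀ α,
    IsCompact (Metric.cthickening δ (chartSupport φ ψ α)) ∧
      Metric.cthickening δ (chartSupport φ ψ α) ⊆ (φ α).target := by
  have h : ∀ᶠ δ : ℝ in 𝓝[>] 0, ∀ α,
      Metric.cthickening δ (chartSupport φ ψ α) ⊆ (φ α).target := by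
    refine eventually_all.2 fun α ↦ ?_
    obtain ⟨δ, hδ, h⟩ := (isCompact_chartSupport hψ α).exists_cthickening_subset_open
      (φ α).open_target (chartSupport_subset hψ α)
    filter_upwards [nhdsWithin_le_nhds (Iio_mem_nhds hδ)] with δ' hδ'
    exact (Metric.cthickening_mono hδ'.le _).trans h
  obtain ⟨δ, hδ, hδ0⟩ := (h.and self_mem_nhdsWithin).exists
  exact ⟨δ, hδ0, fun α ↦ ⟨(isCompact_chartSupport hψ α).cthickening, hδ α⟩⟩

omit hφ in
/-- The representative of a cut-off function in a chart is smooth on the target of the chart. -/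
theorem contDiffOn_partition_symm (hφ : ∀ α, φ α ∈ IsManifold.maximalAtlas (𝓡 d) ∞ M) (α : ι) :
    ContDiffOn ℝ ∞ (ψ α ∘ (φ α).symm) (φ α).target := fun ξ hξ ↦
  (((ψ α).contMDiff _).comp ξ (contMDiffAt_symm_of_mem_maximalAtlas (hφ α)
    hξ)).contDiffAt.contDiffWithinAt

end Assemble

/-! ### Finite measure and integrability of components -/

section Norms

variable {d : ℕ} {M : Type*} [TopologicalSpace M] [CompactSpace M]
  [ChartedSpace (EuclideanSpace ℝ (Fin d)) M]
  [IsManifold (𝓡 d) ∞ M] {ι : Type*} [Fintype ι]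
  [RiemannianBundle (fun x : M ↦ TangentSpace (𝓡 d) x)]
  [MeasurableSpace M] [BorelSpace M]
  {φ : ι → OpenPartialHomeomorph M (EuclideanSpace ℝ (Fin d))}
  {ψ : SmoothPartitionOfUnity ι (𝓡 d) M Set.univ}
  (hφ : ∀ α, φ α ∈ IsManifold.maximalAtlas (𝓡 d) ∞ M)
  (hψ : ψ.IsSubordinate (fun α ↦ (φ α).source))
  {κ : ℝ} (hκ0 : 0 < κ) (hκ : ∀ α, IsBilipschitzChart (φ α) κ)
include hφ hψ hκ0 hκ

/-- `M` is covered by the finitely many supports of the `ψ_α`. Their images in the charts are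
compact, hence of finite Lebesgue measure, and the density is bounded. -/
theorem isFiniteMeasure_riemannianMeasure : IsFiniteMeasure (riemannianMeasure d M) := by
  refine ⟨?_⟩
  have hcov : (Set.univ : Set M) ⊆ ⋃ α, tsupport (ψ α) := fun x _ ↦
    Set.mem_iUnion.2 (exists_mem_tsupport ψ x)
  refine (measure_mono hcov).trans_lt ((measure_iUnion_fintype_le _ _).trans_lt ?_)
  refine ENNReal.sum_lt_top.2 fun α _ ↦ ?_
  have hm : MeasurableSet (tsupport (ψ α)) := (isClosed_tsupport _).measurableSet
  have h := Measure.le_iff.1 ((hκ α).restrict_source_le hκ0 (hφ α)) _ hm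
  rw [Measure.restrict_apply hm, Set.inter_eq_left.2 (hψ α), Measure.smul_apply,
    Measure.map_apply_of_aemeasurable (aemeasurable_symm _) hm,
    Measure.restrict_apply' (φ α).open_target.measurableSet, Set.inter_comm,
    ← (φ α).image_eq_target_inter_inv_preimage (hψ α)] at h
  exact h.trans_lt (ENNReal.mul_lt_top ENNReal.ofReal_lt_top
    (isCompact_chartSupport hψ α).measure_lt_top)

/-- The target need not be bounded; its volume is controlled by the finite Riemannian measure of the
chart domain. -/
theorem volume_target_lt_top (α : ι) : volume (φ α).target < ⊤ := by
  have := isFiniteMeasure_riemannianMeasure hφ hψ hκ0 hκ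
  have h := (hκ α).map_symm_le hκ0 (hφ α) Set.univ
  rw [Measure.map_apply_of_aemeasurable (aemeasurable_symm _) MeasurableSet.univ,
    Set.preimage_univ, Measure.restrict_apply_univ] at h
  exact h.trans_lt (ENNReal.mul_lt_top ENNReal.ofReal_lt_top (measure_lt_top _ _))

omit hψ in
theorem aestronglyMeasurable_chartRep {X : Π x : M, TangentSpace (𝓡 d) x}
    (hX : IsMeasurableField X) (α : ι) :
    AEStronglyMeasurable (chartRep (φ α) X) (volume.restrict (φ α).target) :=
  ((hκ α).aestronglyMeasurable_map hκ0 (hφ α)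
    (hX (φ α) (hφ α)).aestronglyMeasurable).comp_aemeasurable (aemeasurable_symm _)

omit hψ in
theorem eLpNorm_chartRep_le {X : Π x : M, TangentSpace (𝓡 d) x} (hX : IsMeasurableField X)
    {p : ℝ≥0∞} (hp : p ≠ ⊤) (α : ι) :
    eLpNorm (chartRep (φ α) X) p (volume.restrict (φ α).target)
      ≤ ENNReal.ofReal (κ ^ d) ^ (1 / p).toReal * (ENNReal.ofReal κ * fieldLpNorm p X) := by
  refine ((hκ α).eLpNorm_comp_symm_le hκ0 (hφ α) hp
    (hX (φ α) (hφ α)).aestronglyMeasurable).trans ?_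
  gcongr
  have hle : ∀ᵐ x ∂((riemannianMeasure d M).restrict (φ α).source),
      ‖chartComponents (φ α) X x‖ ≤ κ * ‖(‖X x‖ : ℝ)‖ := by
    filter_upwards [ae_restrict_mem (φ α).open_source.measurableSet] with x hx
    rw [norm_norm]
    exact (hκ α x hx (X x)).1
  refine (eLpNorm_le_mul_eLpNorm_of_ae_le_mul hle p).trans ?_
  rw [fieldLpNorm]
  exact mul_le_mul_right (eLpNorm_mono_measure _ Measure.restrict_le_self) _

/-- Hölder's inequality on the target, which has finite volume. -/
theorem exists_eLpNorm_one_chartRep_le {p : ℝ≥0∞} (hp : 1 ≤ p) (hp' : p ≠ ⊤) (α : ι) :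
    ∃ C : ℝ≥0∞, C ≠ ⊤ ∧ ∀ X : Π x : M, TangentSpace (𝓡 d) x, IsMeasurableField X →
      eLpNorm (chartRep (φ α) X) 1 (volume.restrict (φ α).target) ≤ C * fieldLpNorm p X := by
  have hv := volume_target_lt_top hφ hψ hκ0 hκ α
  have hq : 0 ≤ 1 / (1 : ℝ≥0∞).toReal - 1 / p.toReal := by
    have : (1 : ℝ) ≤ p.toReal := by
      rw [← ENNReal.toReal_one]
      exact ENNReal.toReal_mono hp' hp
    rw [ENNReal.toReal_one, sub_nonneg]
    exact one_div_le_one_div_of_le one_pos this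
  refine ⟨ENNReal.ofReal (κ ^ d) ^ (1 / p).toReal * ENNReal.ofReal κ
    * volume (φ α).target ^ (1 / (1 : ℝ≥0∞).toReal - 1 / p.toReal), ?_, fun X hX ↦ ?_⟩
  · exact ENNReal.mul_ne_top (ENNReal.mul_ne_top (ENNReal.rpow_ne_top_of_nonneg
      ENNReal.toReal_nonneg ENNReal.ofReal_ne_top) ENNReal.ofReal_ne_top)
      (ENNReal.rpow_ne_top_of_nonneg hq hv.ne)
  · refine (eLpNorm_le_eLpNorm_mul_rpow_measure_univ hp
      (aestronglyMeasurable_chartRep hφ hκ0 hκ hX α)).trans ?_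
    rw [Measure.restrict_apply_univ]
    refine (mul_le_mul_left (eLpNorm_chartRep_le hφ hκ0 hκ hX hp' α) _).trans_eq ?_
    ring

theorem integrableOn_chartRep {X : Π x : M, TangentSpace (𝓡 d) x} (hX : IsMeasurableField X)
    {p : ℝ≥0∞} (hp : 1 ≤ p) (hp' : p ≠ ⊤) (hXp : fieldLpNorm p X < ⊤) (α : ι) :
    IntegrableOn (chartRep (φ α) X) (φ α).target := by
  obtain ⟨C, hC, h⟩ := exists_eLpNorm_one_chartRep_le hφ hψ hκ0 hκ hp hp' α
  refine memLp_one_iff_integrable.1 ⟨aestronglyMeasurable_chartRep hφ hκ0 hκ hX α, ?_⟩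
  exact (h X hX).trans_lt (ENNReal.mul_lt_top hC.lt_top hXp)

end Norms

/-! ### Measurability and boundedness of smooth fields -/

section MeasurableFields

variable {d : ℕ} {M : Type*} [TopologicalSpace M]
  [ChartedSpace (EuclideanSpace ℝ (Fin d)) M]
  [IsManifold (𝓡 d) ∞ M]
  [RiemannianBundle (fun x : M ↦ TangentSpace (𝓡 d) x)]
  [MeasurableSpace M] [BorelSpace M]

theorem IsMeasurableField.sub {X Y : Π x : M, TangentSpace (𝓡 d) x} (hX : IsMeasurableField X)
    (hY : IsMeasurableField Y) : IsMeasurableField (fun x ↦ X x - Y x) := by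
  intro e he
  have h : chartComponents e (fun x ↦ X x - Y x) = chartComponents e X - chartComponents e Y := by
    ext1 x
    exact map_sub _ _ _
  rw [h]
  exact (hX e he).sub (hY e he)

theorem continuousOn_chartComponents {e : OpenPartialHomeomorph M (EuclideanSpace ℝ (Fin d))}
    (he : e ∈ IsManifold.maximalAtlas (𝓡 d) ∞ M) {X : Π x : M, TangentSpace (𝓡 d) x}
    (hX : IsSmoothField X) : ContinuousOn (chartComponents e X) e.source := by
  refine ((contDiffOn_chartRep he hX).continuousOn.comp e.continuousOn
    (fun x hx ↦ e.map_source hx)).congr fun x hx ↦ ?_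
  rw [Function.comp_apply, chartRep, e.left_inv hx]

theorem IsSmoothField.isMeasurableField {X : Π x : M, TangentSpace (𝓡 d) x}
    (hX : IsSmoothField X) : IsMeasurableField X := fun _ he ↦
  (continuousOn_chartComponents he hX).aemeasurable
    (OpenPartialHomeomorph.open_source _).measurableSet

theorem IsSmoothField.sub {X Y : Π x : M, TangentSpace (𝓡 d) x}
    (hX : IsSmoothField X) (hY : IsSmoothField Y) : IsSmoothField (fun x ↦ X x - Y x) :=
  ContMDiff.sub_section hX hY

variable [IsContMDiffRiemannianBundle (𝓡 d) ∞ (EuclideanSpace ℝ (Fin d))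
      (fun x : M ↦ TangentSpace (𝓡 d) x)]

theorem IsSmoothField.continuous_norm {X : Π x : M, TangentSpace (𝓡 d) x}
    (hX : IsSmoothField X) : Continuous fun x ↦ ‖X x‖ := by
  have h : ContMDiff (𝓡 d) 𝓘(ℝ, ℝ) ∞ (fun x ↦ (inner ℝ (X x) (X x) : ℝ)) :=
    ContMDiff.inner_bundle hX hX
  simp only [norm_eq_sqrt_real_inner]
  exact h.continuous.sqrt

theorem IsSmoothField.exists_bound [CompactSpace M] {X : Π x : M, TangentSpace (𝓡 d) x}
    (hX : IsSmoothField X) : ∃ C : ℝ, ∀ x, ‖X x‖ ≤ C := by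
  obtain ⟨C, hC⟩ := isCompact_univ.exists_bound_of_continuousOn hX.continuous_norm.continuousOn
  exact ⟨C, fun x ↦ by simpa using hC x (Set.mem_univ x)⟩

theorem IsSmoothField.fieldLpNorm_lt_top [CompactSpace M]
    [IsFiniteMeasure (riemannianMeasure d M)] {X : Π x : M, TangentSpace (𝓡 d) x}
    (hX : IsSmoothField X) (p : ℝ≥0∞) : fieldLpNorm p X < ⊤ := by
  obtain ⟨C, hC⟩ := hX.exists_bound
  exact (MemLp.of_bound hX.continuous_norm.aestronglyMeasurable C
    (Eventually.of_forall fun x ↦ by simpa using hC x)).2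

end MeasurableFields

/-! ### Equivalence of the Sobolev norm with local Sobolev norms of components -/

section SobolevEquivalence

variable {d : ℕ} {M : Type*} [TopologicalSpace M] [CompactSpace M]
  [ChartedSpace (EuclideanSpace ℝ (Fin d)) M]
  [IsManifold (𝓡 d) ∞ M] {ι : Type*} [Fintype ι]
  [RiemannianBundle (fun x : M ↦ TangentSpace (𝓡 d) x)]
  [IsContMDiffRiemannianBundle (𝓡 d) ∞ (EuclideanSpace ℝ (Fin d))
      (fun x : M ↦ TangentSpace (𝓡 d) x)]
  {φ : ι → OpenPartialHomeomorph M (EuclideanSpace ℝ (Fin d))}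
  {ψ : SmoothPartitionOfUnity ι (𝓡 d) M Set.univ}

theorem IsSmoothField.mdifferentiableAt {X : Π x : M, TangentSpace (𝓡 d) x}
    (hX : IsSmoothField X) (x : M) : MDifferentiableAt (𝓡 d) (𝓡 d).tangent
      (fun y ↦ (⟨y, X y⟩ : TangentBundle (𝓡 d) M)) x :=
  (hX x).mdifferentiableAt (by simp)

theorem covDerivLength_nonneg (X : Π x : M, TangentSpace (𝓡 d) x) (x : M) :
    0 ≤ covDerivLength X x :=
  Real.sqrt_nonneg _

/-- Locality of the connection; it disposes of points outside the support of `ψ_α`. -/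
theorem koszul_eq_zero_of_eventuallyEq_zero {X : Π x : M, TangentSpace (𝓡 d) x} {x : M}
    (hX : MDifferentiableAt (𝓡 d) (𝓡 d).tangent
      (fun y ↦ (⟨y, X y⟩ : TangentBundle (𝓡 d) M)) x)
    (h : ∀ᶠ y in 𝓝 x, X y = 0) (v w : TangentSpace (𝓡 d) x) : koszul X x v w = 0 := by
  have he := IsManifold.chart_mem_maximalAtlas (I := 𝓡 d) (n := ∞) x
  have hx := mem_chart_source (EuclideanSpace ℝ (Fin d)) x
  set e := chartAt (EuclideanSpace ℝ (Fin d)) x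
  have hrep : chartRep e X =ᶠ[𝓝 (e x)] fun _ ↦ 0 := by
    have ht : Tendsto e.symm (𝓝 (e x)) (𝓝 x) := e.tendsto_symm hx
    filter_upwards [ht.eventually h] with ξ hξ
    rw [chartRep, chartComponents, hξ, map_zero]
  rw [koszul_eq he hx hX, hrep.fderiv_eq, hrep.eq_of_nhds]
  simp

/-- The metric is bounded on the whole chart, but its derivatives are controlled only on compact
subsets. All Sobolev estimates are therefore made on such subsets. -/
theorem exists_fderiv_metricForm_bound {e : OpenPartialHomeomorph M (EuclideanSpace ℝ (Fin d))}
    (he : e ∈ IsManifold.maximalAtlas (𝓡 d) ∞ M) {K : Set (EuclideanSpace ℝ (Fin d))}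
    (hK : IsCompact K) (hKe : K ⊆ e.target) :
    ∃ B : ℝ, 0 ≤ B ∧ ∀ ξ ∈ K, ‖fderiv ℝ (metricForm e) ξ‖ ≤ B := by
  obtain ⟨B, hB⟩ := hK.exists_bound_of_continuousOn
    (((contDiffOn_metricForm he).continuousOn_fderiv_of_isOpen e.open_target
      (by simp)).mono hKe)
  exact ⟨max B 0, le_max_right _ _, fun ξ hξ ↦ (hB ξ hξ).trans (le_max_left _ _)⟩

variable (hφ : ∀ α, φ α ∈ IsManifold.maximalAtlas (𝓡 d) ∞ M)
  (hψ : ψ.IsSubordinate (fun α ↦ (φ α).source))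
  {κ : ℝ} (hκ0 : 0 < κ) (hκ : ∀ α, IsBilipschitzChart (φ α) κ)
include hφ hψ hκ0 hκ

/-- Pointwise bounds for a summand of the assembled field and for its covariant derivative. -/
theorem exists_summand_bound (α : ι) : ∃ A : ℝ, 0 ≤ A ∧
    ∀ u : EuclideanSpace ℝ (Fin d) → EuclideanSpace ℝ (Fin d), ContDiffOn ℝ ∞ u (φ α).target →
      ∀ x ∈ tsupport (ψ α),
        ‖ψ α x • ofChartComponents (φ α) x (u (φ α x))‖
            ≤ A * (‖u (φ α x)‖ + ‖fderiv ℝ u (φ α x)‖) ∧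
        ∀ v w, |koszul (fun y ↦ ψ α y • ofChartComponents (φ α) y (u (φ α y))) x v w|
            ≤ A * (‖u (φ α x)‖ + ‖fderiv ℝ u (φ α x)‖) * ‖v‖ * ‖w‖ := by
  obtain ⟨B, hB0, hB⟩ := exists_fderiv_metricForm_bound (hφ α) (isCompact_chartSupport hψ α)
    (chartSupport_subset hψ α)
  obtain ⟨P, hP⟩ := (isCompact_chartSupport hψ α).exists_bound_of_continuousOn
    (((contDiffOn_partition_symm hψ hφ α).continuousOn_fderiv_of_isOpen (φ α).open_target
      (by simp)).mono (chartSupport_subset hψ α))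
  -- `κ` bounds the field, `κ^4 (1 + P)` the derivative of the product `ψ u`, and `3/2 κ² B` the
  -- Christoffel terms.
  refine ⟨κ + κ ^ 4 * (1 + max P 0) + 3 / 2 * κ ^ 2 * B, by positivity,
    fun u hu x hxs ↦ ?_⟩
  have hx : x ∈ (φ α).source := hψ α hxs
  have hxt := (φ α).map_source hx
  have hnhds := (φ α).open_target.mem_nhds hxt
  have hψ0 : 0 ≤ ψ α x := ψ.nonneg α x
  have hψ1 : ψ α x ≤ 1 := ψ.le_one α x
  have hxK : φ α x ∈ chartSupport φ ψ α := ⟨x, hxs, rfl⟩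
  have hP' : ‖fderiv ℝ (ψ α ∘ (φ α).symm) (φ α x)‖ ≤ max P 0 :=
    (hP _ hxK).trans (le_max_left _ _)
  set a := ‖u (φ α x)‖ with ha
  set b := ‖fderiv ℝ u (φ α x)‖ with hb
  have ha0 : 0 ≤ a := norm_nonneg _
  have hb0 : 0 ≤ b := norm_nonneg _
  have hQ0 : 0 ≤ max P 0 := le_max_right _ _
  set Q := max P 0
  constructor
  · rw [norm_smul, Real.norm_of_nonneg hψ0]
    calc ψ α x * ‖ofChartComponents (φ α) x (u (φ α x))‖ ≤ 1 * (κ * a) := by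
          gcongr
          exact (hκ α).norm_ofChartComponents_le (hφ α) hx _
      _ ≤ (κ + κ ^ 4 * (1 + Q) + 3 / 2 * κ ^ 2 * B) * (a + b) := by
          rw [one_mul]
          gcongr
          · have : 0 ≤ κ ^ 4 * (1 + Q) + 3 / 2 * κ ^ 2 * B := by positivity
            linarith
          · linarith
  · intro v w
    have hZ := (contMDiff_summand hφ hψ hu).mdifferentiableAt x
    have hrep : chartRep (φ α) (fun y ↦ ψ α y • ofChartComponents (φ α) y (u (φ α y)))
        =ᶠ[𝓝 (φ α x)] fun ξ ↦ (ψ α ∘ (φ α).symm) ξ • u ξ := by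
      filter_upwards [hnhds] with ξ hξ
      rw [chartRep, chartComponents, map_smul, mvfderiv_ofChartComponents (hφ α)
        ((φ α).map_target hξ), (φ α).right_inv hξ, Function.comp_apply]
    have hd := ((contDiffOn_partition_symm hψ hφ α).contDiffAt hnhds).differentiableAt (by simp)
    have hdu := (hu.contDiffAt hnhds).differentiableAt (by simp)
    refine ((hκ α).abs_koszul_le_chartRep hκ0.le (hφ α) hx hZ v w).trans ?_
    rw [hrep.fderiv_eq, hrep.eq_of_nhds, fderiv_fun_smul hd hdu]
    have h1 : ‖(ψ α ∘ (φ α).symm) (φ α x)‖ ≤ 1 := by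
      rw [Function.comp_apply, (φ α).left_inv hx, Real.norm_of_nonneg hψ0]
      exact hψ1
    have h2 : ‖(ψ α ∘ (φ α).symm) (φ α x) • fderiv ℝ u (φ α x)
        + (fderiv ℝ (ψ α ∘ (φ α).symm) (φ α x)).smulRight (u (φ α x))‖ ≤ b + Q * a := by
      refine (norm_add_le _ _).trans (add_le_add ?_ ?_)
      · rw [norm_smul]
        exact mul_le_of_le_one_left (norm_nonneg _) h1
      · rw [ContinuousLinearMap.norm_smulRight_apply]
        gcongr
    have h3 : ‖(ψ α ∘ (φ α).symm) (φ α x) • u (φ α x)‖ ≤ a := by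
      rw [norm_smul]
      exact mul_le_of_le_one_left (norm_nonneg _) h1
    gcongr
    calc _ ≤ κ ^ 4 * (b + Q * a) + 3 / 2 * κ ^ 2 * B * a := by
          gcongr
          exact hB _ hxK
      _ ≤ _ := by
          have : 0 ≤ κ * (a + b) + κ ^ 4 * (a + Q * b) + 3 / 2 * κ ^ 2 * B * b := by positivity
          linarith

variable [MeasurableSpace M] [BorelSpace M]

/-- The Sobolev norm of an assembled field is bounded by the local norms of its coordinates. -/
theorem exists_smoothSobolevNorm_assembleField_le {p : ℝ≥0∞} (hp : 1 ≤ p) (hp' : p ≠ ⊤) :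
    ∃ C : ℝ≥0∞, C ≠ ⊤ ∧
      ∀ u : ι → EuclideanSpace ℝ (Fin d) → EuclideanSpace ℝ (Fin d),
        (∀ α, ContDiffOn ℝ ∞ (u α) (φ α).target) →
        smoothSobolevNorm p (assembleField φ ψ u)
          ≤ C * ∑ α, localSobolevNorm p (chartSupport φ ψ α) (u α) := by
  choose A hA0 hA using exists_summand_bound hφ hψ hκ0 hκ
  have hS0 : 0 ≤ ∑ α, A α := Finset.sum_nonneg fun α _ ↦ hA0 α
  have hAS (α) : A α ≤ ∑ α, A α := Finset.single_le_sum (fun α _ ↦ hA0 α) (Finset.mem_univ α)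
  set S := ∑ α, A α
  set c := ENNReal.ofReal (κ ^ d) ^ (1 / p).toReal
  -- The `1` is for the field and `d` for its covariant derivative, by
  -- `covDerivLength_le_of_abs_koszul_le`; `c` compares the measures and `S` dominates every `A α`.
  refine ⟨(1 + d) * (c * ENNReal.ofReal S), ?_, fun u hu ↦ ?_⟩
  · exact ENNReal.mul_ne_top (by simp) (ENNReal.mul_ne_top (ENNReal.rpow_ne_top_of_nonneg
      ENNReal.toReal_nonneg ENNReal.ofReal_ne_top) ENNReal.ofReal_ne_top)
  -- `g α` carries `w α` to the manifold, cut off to the support of `ψ α`. The function `S * ∑ α, g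
  -- α` dominates both the field and its Koszul form pointwise.
  let w (α : ι) (ξ : EuclideanSpace ℝ (Fin d)) : ℝ := ‖u α ξ‖ + ‖fderiv ℝ (u α) ξ‖
  let g (α : ι) : M → ℝ :=
    ((φ α).source ∩ φ α ⁻¹' chartSupport φ ψ α).indicator (w α ∘ φ α)
  have hg0 (α x) : 0 ≤ g α x :=
    Set.indicator_nonneg (fun y _ ↦ add_nonneg (norm_nonneg _) (norm_nonneg _)) x
  have hgs (α x) (hx : x ∈ tsupport (ψ α)) : g α x = w α (φ α x) := by
    rw [← source_inter_preimage_chartSupport hψ] at hx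
    exact Set.indicator_of_mem hx _
  have hw (α) : ContinuousOn (w α) (chartSupport φ ψ α) :=
    ((hu α).continuousOn.norm.add ((hu α).continuousOn_fderiv_of_isOpen (φ α).open_target
      (by simp)).norm).mono (chartSupport_subset hψ α)
  have hm (α) : MeasurableSet (chartSupport φ ψ α) := (isCompact_chartSupport hψ α).measurableSet
  have hgn (α) : eLpNorm (g α) p (riemannianMeasure d M)
      ≤ c * localSobolevNorm p (chartSupport φ ψ α) (u α) := by
    refine ((hκ α).eLpNorm_le_of_ge hκ0 (hφ α) hp' (hm α) (chartSupport_subset hψ α)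
      (hw α)).trans ?_
    gcongr
    have h1 := ((hu α).continuousOn.norm.mono (chartSupport_subset hψ α)).aestronglyMeasurable
      (μ := volume) (hm α)
    have h2 := (((hu α).continuousOn_fderiv_of_isOpen (φ α).open_target
      (by simp)).norm.mono (chartSupport_subset hψ α)).aestronglyMeasurable
      (μ := volume) (hm α)
    refine (eLpNorm_add_le h1 h2 hp).trans_eq ?_
    rw [localSobolevNorm, eLpNorm_norm, eLpNorm_norm]
  have hsum : eLpNorm (fun x ↦ S * ∑ α, g α x) p (riemannianMeasure d M)
      ≤ c * ENNReal.ofReal S * ∑ α, localSobolevNorm p (chartSupport φ ψ α) (u α) := by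
    have h1 : eLpNorm (fun x ↦ ∑ α, g α x) p (riemannianMeasure d M)
        ≤ ∑ α, eLpNorm (g α) p (riemannianMeasure d M) := by
      have := eLpNorm_sum_le (μ := riemannianMeasure d M) (s := Finset.univ) (f := g)
        (fun α _ ↦ aestronglyMeasurable_indicator_chart (hm α) (hw α) _) hp
      convert this using 2
      ext1 x
      rw [Finset.sum_apply]
    have h2 : eLpNorm (fun x ↦ S * ∑ α, g α x) p (riemannianMeasure d M)
        = ENNReal.ofReal S * eLpNorm (fun x ↦ ∑ α, g α x) p (riemannianMeasure d M) := by
      have := eLpNorm_const_smul S (fun x ↦ ∑ α, g α x) p (riemannianMeasure d M)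
      rw [Real.enorm_eq_ofReal hS0] at this
      exact this
    rw [h2, mul_comm c, mul_assoc, Finset.mul_sum]
    gcongr
    exact h1.trans (Finset.sum_le_sum fun α _ ↦ hgn α)
  have hpt (α : ι) (x : M) :
      ‖ψ α x • ofChartComponents (φ α) x (u α (φ α x))‖ ≤ S * g α x ∧
      ∀ v w, |koszul (fun y ↦ ψ α y • ofChartComponents (φ α) y (u α (φ α y))) x v w|
        ≤ S * g α x * ‖v‖ * ‖w‖ := by
    by_cases hx : x ∈ tsupport (ψ α)
    · obtain ⟨h1, h2⟩ := hA α (u α) (hu α) x hx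
      rw [hgs α x hx]
      have h3 : A α * w α (φ α x) ≤ S * w α (φ α x) :=
        mul_le_mul_of_nonneg_right (hAS α) (by positivity)
      refine ⟨h1.trans h3, fun v w ↦ (h2 v w).trans ?_⟩
      gcongr
    · have hS : 0 ≤ S * g α x := mul_nonneg hS0 (hg0 α x)
      constructor
      · rwa [image_eq_zero_of_notMem_tsupport hx, zero_smul, norm_zero]
      · intro v w
        rw [koszul_eq_zero_of_eventuallyEq_zero
          ((contMDiff_summand hφ hψ (hu α)).mdifferentiableAt x), abs_zero]
        · positivity
        · filter_upwards [(isClosed_tsupport (ψ α)).isOpen_compl.mem_nhds hx] with y hy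
          rw [image_eq_zero_of_notMem_tsupport hy, zero_smul]
  have hT0 (x) : 0 ≤ S * ∑ α, g α x := mul_nonneg hS0 (Finset.sum_nonneg fun α _ ↦ hg0 α x)
  have hb1 : fieldLpNorm p (assembleField φ ψ u)
      ≤ eLpNorm (fun x ↦ S * ∑ α, g α x) p (riemannianMeasure d M) := by
    refine eLpNorm_mono_real fun x ↦ ?_
    rw [norm_norm, assembleField, Finset.mul_sum]
    exact (norm_sum_le _ _).trans (Finset.sum_le_sum fun α _ ↦ (hpt α x).1)
  have hb2 : eLpNorm (covDerivLength (assembleField φ ψ u)) p (riemannianMeasure d M)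
      ≤ d * eLpNorm (fun x ↦ S * ∑ α, g α x) p (riemannianMeasure d M) := by
    have := eLpNorm_const_smul (d : ℝ) (fun x ↦ S * ∑ α, g α x) p (riemannianMeasure d M)
    rw [Real.enorm_natCast] at this
    rw [← this]
    refine eLpNorm_mono_real fun x ↦ ?_
    rw [Real.norm_of_nonneg (covDerivLength_nonneg _ x)]
    refine covDerivLength_le_of_abs_koszul_le (hT0 x) fun v w ↦ ?_
    have := koszul_sum Finset.univ (X := fun α y ↦ ψ α y • ofChartComponents (φ α) y (u α (φ α y)))
      (x := x) (fun α _ ↦ (contMDiff_summand hφ hψ (hu α)).mdifferentiableAt x)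
      ((isSmoothField_assembleField hφ hψ hu).mdifferentiableAt x) v w
    change |koszul (fun y ↦ ∑ α, ψ α y • ofChartComponents (φ α) y (u α (φ α y))) x v w| ≤ _
    beta_reduce
    rw [this, Finset.mul_sum, Finset.sum_mul, Finset.sum_mul]
    exact (Finset.abs_sum_le_sum_abs _ _).trans (Finset.sum_le_sum fun α _ ↦ (hpt α x).2 v w)
  calc smoothSobolevNorm p (assembleField φ ψ u)
      ≤ (1 + d) * eLpNorm (fun x ↦ S * ∑ α, g α x) p (riemannianMeasure d M) := by
        rw [add_mul, one_mul]
        exact add_le_add hb1 hb2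
    _ ≤ _ := by
        rw [mul_assoc (1 + (d : ℝ≥0∞))]
        gcongr

omit hψ in
/-- The local norms of the coordinates of a smooth field are bounded by its Sobolev norm. -/
theorem exists_localSobolevNorm_chartRep_le {p : ℝ≥0∞} (hp : 1 ≤ p) (hp' : p ≠ ⊤) (α : ι)
    {K : Set (EuclideanSpace ℝ (Fin d))} (hK : IsCompact K) (hKe : K ⊆ (φ α).target) :
    ∃ C : ℝ≥0∞, C ≠ ⊤ ∧ ∀ Z : Π x : M, TangentSpace (𝓡 d) x, IsSmoothField Z →
      localSobolevNorm p K (chartRep (φ α) Z) ≤ C * smoothSobolevNorm p Z := by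
  obtain ⟨B, hB0, hB⟩ := exists_fderiv_metricForm_bound (hφ α) hK hKe
  set c := ENNReal.ofReal (κ ^ d) ^ (1 / p).toReal
  have hc : c ≠ ⊤ := ENNReal.rpow_ne_top_of_nonneg ENNReal.toReal_nonneg ENNReal.ofReal_ne_top
  set c₁ := κ ^ 4 * (d : ℝ) ^ 2
  set c₂ := 3 / 2 * κ ^ 2 * B
  have hc₁ : 0 ≤ c₁ := by positivity
  have hc₂ : 0 ≤ c₂ := by positivity
  refine ⟨c * ENNReal.ofReal κ + c * ENNReal.ofReal (c₂ * κ) + c * ENNReal.ofReal c₁, ?_,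
    fun Z hZ ↦ ?_⟩
  · simp only [ne_eq, ENNReal.add_eq_top, not_or]
    exact ⟨⟨ENNReal.mul_ne_top hc ENNReal.ofReal_ne_top,
      ENNReal.mul_ne_top hc ENNReal.ofReal_ne_top⟩, ENNReal.mul_ne_top hc ENNReal.ofReal_ne_top⟩
  have hcont : ContinuousOn (chartRep (φ α) Z) K :=
    (contDiffOn_chartRep (hφ α) hZ).continuousOn.mono hKe
  have hcont' : ContinuousOn (fderiv ℝ (chartRep (φ α) Z)) K :=
    ((contDiffOn_chartRep (hφ α) hZ).continuousOn_fderiv_of_isOpen (φ α).open_target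
      (by simp)).mono hKe
  have hrep (x) (hx : x ∈ (φ α).source) : ‖chartRep (φ α) Z (φ α x)‖ ≤ κ * ‖Z x‖ := by
    rw [chartRep_apply hx]
    exact (hκ α x hx (Z x)).1
  have hconst (a : ℝ) (ha : 0 ≤ a) (f : M → ℝ) :
      eLpNorm (fun x ↦ a * f x) p (riemannianMeasure d M)
        = ENNReal.ofReal a * eLpNorm f p (riemannianMeasure d M) := by
    have := eLpNorm_const_smul a f p (riemannianMeasure d M)
    rw [Real.enorm_eq_ofReal ha] at this
    exact this
  have h0 : eLpNorm (chartRep (φ α) Z) p (volume.restrict K)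
      ≤ c * (ENNReal.ofReal κ * fieldLpNorm p Z) := by
    rw [← eLpNorm_norm, fieldLpNorm, ← hconst κ hκ0.le]
    refine (hκ α).eLpNorm_le_of_le hκ0 (hφ α) hp' hK.measurableSet hKe hcont.norm
      fun x hx _ ↦ ?_
    rw [abs_norm, abs_of_nonneg (by positivity)]
    exact hrep x hx
  -- The triangle inequality in `L^p` needs measurable summands, whereas `covDerivLength` is defined
  -- through bases chosen point by point. So `w` is split as `w ≤ max (w - b) 0 + b`, with both
  -- pieces continuous in coordinates; only then is the first piece compared with `covDerivLength`.
  let b (ξ : EuclideanSpace ℝ (Fin d)) : ℝ := c₂ * ‖chartRep (φ α) Z ξ‖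
  let w (ξ : EuclideanSpace ℝ (Fin d)) : ℝ := ‖fderiv ℝ (chartRep (φ α) Z) ξ‖
  have hbc : ContinuousOn b K := continuousOn_const.mul hcont.norm
  have hwc : ContinuousOn (fun ξ ↦ max (w ξ - b ξ) 0) K :=
    (hcont'.norm.sub hbc).sup continuousOn_const
  have h1 : eLpNorm b p (volume.restrict K)
      ≤ c * (ENNReal.ofReal (c₂ * κ) * fieldLpNorm p Z) := by
    rw [fieldLpNorm, ← hconst _ (by positivity)]
    refine (hκ α).eLpNorm_le_of_le hκ0 (hφ α) hp' hK.measurableSet hKe hbc fun x hx _ ↦ ?_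
    rw [abs_of_nonneg (by positivity), abs_of_nonneg (by positivity), mul_assoc]
    exact mul_le_mul_of_nonneg_left (hrep x hx) hc₂
  have h2 : eLpNorm (fun ξ ↦ max (w ξ - b ξ) 0) p (volume.restrict K)
      ≤ c * (ENNReal.ofReal c₁ * eLpNorm (covDerivLength Z) p (riemannianMeasure d M)) := by
    rw [← hconst _ hc₁]
    refine (hκ α).eLpNorm_le_of_le hκ0 (hφ α) hp' hK.measurableSet hKe hwc fun x hx hxK ↦ ?_
    have hcov : 0 ≤ covDerivLength Z x := Real.sqrt_nonneg _
    rw [abs_of_nonneg (le_max_right _ _), abs_of_nonneg (by positivity)]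
    refine max_le ?_ (by positivity)
    have h3 := (hκ α).norm_fderiv_chartRep_le hκ0.le (hφ α) hx (hZ.mdifferentiableAt x)
    have h4 : 3 / 2 * κ ^ 2 * ‖fderiv ℝ (metricForm (φ α)) (φ α x)‖ * ‖chartRep (φ α) Z (φ α x)‖
        ≤ b (φ α x) := by
      simp only [b, c₂]
      gcongr
      exact hB _ hxK
    simp only [w]
    linarith
  have h3 : eLpNorm (fderiv ℝ (chartRep (φ α) Z)) p (volume.restrict K)
      ≤ eLpNorm (fun ξ ↦ max (w ξ - b ξ) 0) p (volume.restrict K)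
        + eLpNorm b p (volume.restrict K) := by
    refine (eLpNorm_mono_real (g := (fun ξ ↦ max (w ξ - b ξ) 0) + b) fun ξ ↦ ?_).trans
      (eLpNorm_add_le (hwc.aestronglyMeasurable hK.measurableSet)
        (hbc.aestronglyMeasurable hK.measurableSet) hp)
    have := le_max_left (w ξ - b ξ) 0
    rw [Pi.add_apply]
    linarith
  calc localSobolevNorm p K (chartRep (φ α) Z)
      ≤ c * (ENNReal.ofReal κ * fieldLpNorm p Z)
        + (c * (ENNReal.ofReal c₁ * eLpNorm (covDerivLength Z) p (riemannianMeasure d M))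
          + c * (ENNReal.ofReal (c₂ * κ) * fieldLpNorm p Z)) :=
        add_le_add h0 (h3.trans (add_le_add h2 h1))
    _ = (c * ENNReal.ofReal κ + c * ENNReal.ofReal (c₂ * κ)) * fieldLpNorm p Z
        + c * ENNReal.ofReal c₁ * eLpNorm (covDerivLength Z) p (riemannianMeasure d M) := by ring
    _ ≤ _ := by
        rw [smoothSobolevNorm, mul_add]
        gcongr ?_ * _ + ?_ * _
        · exact le_self_add
        · exact le_add_self

end SobolevEquivalence

/-! ### Convergence of the mollified fields -/

section Convergence

variable {d : ℕ} {G : Type*} [NormedAddCommGroup G] [NormedSpace ℝ G] [CompleteSpace G]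

theorem IsMollifier.mollify_sub {k : EuclideanSpace ℝ (Fin d) → ℝ} {r : ℝ} (hk : IsMollifier k r)
    {T : Set (EuclideanSpace ℝ (Fin d))} {u v : EuclideanSpace ℝ (Fin d) → G}
    (hu : IntegrableOn u T) (hv : IntegrableOn v T) (η : EuclideanSpace ℝ (Fin d)) :
    mollify k T (fun ξ ↦ u ξ - v ξ) η = mollify k T u η - mollify k T v η := by
  rw [mollify, mollify, mollify,
    ← MeasureTheory.integral_sub (hk.integrableOn_smul hu η) (hk.integrableOn_smul hv η)]
  simp only [smul_sub]

variable {M : Type*} [TopologicalSpace M] [CompactSpace M]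
  [ChartedSpace (EuclideanSpace ℝ (Fin d)) M]
  [IsManifold (𝓡 d) ∞ M] {ι : Type*} [Fintype ι]
  [RiemannianBundle (fun x : M ↦ TangentSpace (𝓡 d) x)]
  [IsContMDiffRiemannianBundle (𝓡 d) ∞ (EuclideanSpace ℝ (Fin d))
      (fun x : M ↦ TangentSpace (𝓡 d) x)]
  {φ : ι → OpenPartialHomeomorph M (EuclideanSpace ℝ (Fin d))}
  {ψ : SmoothPartitionOfUnity ι (𝓡 d) M Set.univ}

theorem chartRep_sub (e : OpenPartialHomeomorph M (EuclideanSpace ℝ (Fin d)))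
    (X Y : Π x : M, TangentSpace (𝓡 d) x) :
    chartRep e (fun x ↦ X x - Y x) = fun ξ ↦ chartRep e X ξ - chartRep e Y ξ := by
  ext1 ξ
  exact map_sub _ _ _

variable (hφ : ∀ α, φ α ∈ IsManifold.maximalAtlas (𝓡 d) ∞ M)
  (hψ : ψ.IsSubordinate (fun α ↦ (φ α).source))
  {κ : ℝ} (hκ0 : 0 < κ) (hκ : ∀ α, IsBilipschitzChart (φ α) κ)
  [MeasurableSpace M] [BorelSpace M]
include hφ hψ hκ0 hκ

/-- `X` is written as `Y_j - (Y_j - X)` with `Y_j` smooth and at `L^p` distance less than one from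
`X`. -/
theorem MemSobolev.integrableOn_chartRep {p : ℝ≥0∞} (hp : 1 ≤ p) (hp' : p ≠ ⊤)
    {X : Π x : M, TangentSpace (𝓡 d) x} (hX : MemSobolev p X) (α : ι) :
    IntegrableOn (chartRep (φ α) X) (φ α).target := by
  have := isFiniteMeasure_riemannianMeasure hφ hψ hκ0 hκ
  obtain ⟨Y, hXm, hY, -, hlim⟩ := hX
  obtain ⟨j, hj⟩ := (hlim.eventually (gt_mem_nhds zero_lt_one)).exists
  have h1 := RiemannianMollification.integrableOn_chartRep hφ hψ hκ0 hκ (hY j).isMeasurableField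
    hp hp' ((hY j).fieldLpNorm_lt_top p) α
  have h2 := RiemannianMollification.integrableOn_chartRep hφ hψ hκ0 hκ
    ((hY j).isMeasurableField.sub hXm) hp hp' (hj.trans ENNReal.one_lt_top) α
  refine (h1.sub h2).congr (Eventually.of_forall fun ξ ↦ ?_)
  rw [chartRep_sub]
  exact sub_sub_cancel _ _

variable {ζ : EuclideanSpace ℝ (Fin d) → ℝ}
  (hζ : ∀ n : ℕ, 1 ≤ n → IsMollifier (rescaledKernel ζ n) ((n : ℝ)⁻¹))
include hζ

theorem isSmoothField_mollifiedField {X : Π x : M, TangentSpace (𝓡 d) x}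
    (hX : ∀ α, IntegrableOn (chartRep (φ α) X) (φ α).target) {n : ℕ} (hn : 1 ≤ n) :
    IsSmoothField (mollifiedField ζ φ ψ X n) := by
  rw [mollifiedField_eq_assembleField]
  exact isSmoothField_assembleField hφ hψ fun α ↦
    ((hζ n hn).contDiff_mollify (φ α).open_target.measurableSet (hX α)).contDiffOn

/-- The mollification error in the coordinates of a chart, with `Z` an intermediate smooth field
and `W` an approximation of the mollified field. -/
theorem localSobolevNorm_sub_mollify_le {p : ℝ≥0∞} (hp : 1 ≤ p) (hp' : p ≠ ⊤) {δ : ℝ}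
    (α : ι) {n : ℕ} (hn : 1 ≤ n) (hnδ : (n : ℝ)⁻¹ ≤ δ)
    (hδ : IsCompact (Metric.cthickening δ (chartSupport φ ψ α)) ∧
      Metric.cthickening δ (chartSupport φ ψ α) ⊆ (φ α).target)
    {X Y Z W : Π x : M, TangentSpace (𝓡 d) x}
    (hX : IntegrableOn (chartRep (φ α) X) (φ α).target) (hY : IsSmoothField Y)
    (hZ : IsSmoothField Z) (hW : IsSmoothField W) :
    localSobolevNorm p (chartSupport φ ψ α)
        (fun ξ ↦ chartRep (φ α) Y ξ
          - mollify (rescaledKernel ζ n) (φ α).target (chartRep (φ α) X) ξ)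
      ≤ localSobolevNorm p (chartSupport φ ψ α) (chartRep (φ α) (fun x ↦ Y x - Z x))
        + localSobolevNorm p (chartSupport φ ψ α) (fun ξ ↦ chartRep (φ α) Z ξ
            - mollify (rescaledKernel ζ n) (φ α).target (chartRep (φ α) Z) ξ)
        + localSobolevNorm p (Metric.cthickening δ (chartSupport φ ψ α))
            (chartRep (φ α) (fun x ↦ Z x - W x))
        + localSobolevNorm p (chartSupport φ ψ α)
            (mollify (rescaledKernel ζ n) (φ α).target
              (chartRep (φ α) (fun x ↦ W x - X x))) := by
  have := isFiniteMeasure_riemannianMeasure hφ hψ hκ0 hκ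
  have hK := (isCompact_chartSupport hψ α).measurableSet
  have hKT := chartSupport_subset (φ := φ) hψ α
  have hT := (φ α).open_target
  have hk := hζ n hn
  have hint {V : Π x : M, TangentSpace (𝓡 d) x} (hV : IsSmoothField V) :
      IntegrableOn (chartRep (φ α) V) (φ α).target :=
    RiemannianMollification.integrableOn_chartRep hφ hψ hκ0 hκ hV.isMeasurableField hp hp'
      (hV.fieldLpNorm_lt_top p) α
  have hC {V : Π x : M, TangentSpace (𝓡 d) x} (hV : IsSmoothField V) :
      ContDiffOn ℝ 1 (chartRep (φ α) V) (φ α).target :=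
    (contDiffOn_chartRep (hφ α) hV).of_le (le_trans one_le_two two_le_infty)
  have hCm {v : EuclideanSpace ℝ (Fin d) → EuclideanSpace ℝ (Fin d)}
      (hv : IntegrableOn v (φ α).target) :
      ContDiffOn ℝ 1 (mollify (rescaledKernel ζ n) (φ α).target v) (φ α).target :=
    ((hk.contDiff_mollify hT.measurableSet hv).of_le
      (le_trans one_le_two two_le_infty)).contDiffOn
  have hZW : localSobolevNorm p (chartSupport φ ψ α)
      (mollify (rescaledKernel ζ n) (φ α).target (chartRep (φ α) (fun x ↦ Z x - W x)))
      ≤ localSobolevNorm p (Metric.cthickening δ (chartSupport φ ψ α))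
            (chartRep (φ α) (fun x ↦ Z x - W x)) :=
    hk.localSobolevNorm_mollify_le hT hK hδ.1.measurableSet
      (fun η hη ↦ (Metric.closedBall_subset_closedBall hnδ).trans
        (Metric.closedBall_subset_cthickening hη δ)) hδ.2 hp hp' (hint (hZ.sub hW)) (hC (hZ.sub hW))
  have hWX : IntegrableOn (chartRep (φ α) (fun x ↦ W x - X x)) (φ α).target := by
    rw [chartRep_sub]
    exact (hint hW).sub hX
  -- Telescoping through `Z` and `W`, using linearity of mollification.
  have heq : (fun ξ ↦ chartRep (φ α) Y ξ
      - mollify (rescaledKernel ζ n) (φ α).target (chartRep (φ α) X) ξ)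
      = fun ξ ↦ ((chartRep (φ α) (fun x ↦ Y x - Z x) ξ + (chartRep (φ α) Z ξ
            - mollify (rescaledKernel ζ n) (φ α).target (chartRep (φ α) Z) ξ))
        + mollify (rescaledKernel ζ n) (φ α).target (chartRep (φ α) (fun x ↦ Z x - W x)) ξ)
        + mollify (rescaledKernel ζ n) (φ α).target (chartRep (φ α) (fun x ↦ W x - X x)) ξ := by
    ext1 ξ
    rw [chartRep_sub, chartRep_sub, chartRep_sub, hk.mollify_sub (hint hZ) (hint hW),
      hk.mollify_sub (hint hW) hX]
    beta_reduce
    abel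
  have hCZ := (hC hZ).sub (hCm (hint hZ))
  rw [heq]
  refine (localSobolevNorm_add_le hp hT hK hKT (((hC (hY.sub hZ)).add hCZ).add
    (hCm (hint (hZ.sub hW)))) (hCm hWX)).trans ?_
  gcongr
  refine (localSobolevNorm_add_le hp hT hK hKT ((hC (hY.sub hZ)).add hCZ)
    (hCm (hint (hZ.sub hW)))).trans ?_
  gcongr
  exact localSobolevNorm_add_le hp hT hK hKT (hC (hY.sub hZ)) hCZ

/-- The fields `Y_j - X_n` represent `X - X_n`, so it suffices to bound their norms for large `j`.
In `localSobolevNorm_sub_mollify_le` the intermediate fields are `Y_m`, fixed by the Cauchy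
property, and `Y_i`, sent to the limit with `n` and `j` fixed. -/
theorem tendsto_sobolevNorm_sub_mollifiedField {p : ℝ≥0∞} (hp : 1 ≤ p) (hp' : p ≠ ⊤)
    {X : Π x : M, TangentSpace (𝓡 d) x} (hX : MemSobolev p X) :
    Tendsto (fun n : ℕ ↦ sobolevNorm p (fun x ↦ X x - mollifiedField ζ φ ψ X n x))
      atTop (𝓝 0) := by
  have := isFiniteMeasure_riemannianMeasure hφ hψ hκ0 hκ
  have hXi := hX.integrableOn_chartRep hφ hψ hκ0 hκ hp hp'
  obtain ⟨Y, hXm, hY, hYc, hYl⟩ := hX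
  obtain ⟨δ, hδ0, hδ⟩ := exists_cthickening hφ hψ
  obtain ⟨C, hC, hSle⟩ := exists_smoothSobolevNorm_assembleField_le hφ hψ hκ0 hκ hp hp'
  choose L hL hLle using fun α ↦ exists_localSobolevNorm_chartRep_le hφ hκ0 hκ hp hp' α
    (hδ α).1 (hδ α).2
  choose D hD hDle using fun α ↦ exists_eLpNorm_one_chartRep_le hφ hψ hκ0 hκ hp hp' α
  -- The three terms belong to `Y_j - Y_m`, to the mollification error of `Y_m`, and to the
  -- mollification of `Y_m - Y_i`.
  have hB : C * ∑ α, (L α + 1 + L α) ≠ ⊤ := ENNReal.mul_ne_top hC (ENNReal.sum_ne_top.2 fun α _ ↦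
    by simp [hL α])
  refine tendsto_zero_of_eventually_le hB fun ε hε ↦ ?_
  have hε' : 0 < ENNReal.ofReal ε := ENNReal.ofReal_pos.2 hε
  obtain ⟨⟨m₁, m₂⟩, hm⟩ := eventually_atTop.1 (hYc.eventually (gt_mem_nhds hε'))
  set m := max m₁ m₂
  have hYY (i j) (hi : m ≤ i) (hj : m ≤ j) :
      smoothSobolevNorm p (fun x ↦ Y i x - Y j x) ≤ ENNReal.ofReal ε :=
    (hm (i, j) ⟨(le_max_left _ _).trans hi, (le_max_right _ _).trans hj⟩).le
  have hYint : ∀ α, IntegrableOn (chartRep (φ α) (Y m)) (φ α).target :=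
    RiemannianMollification.integrableOn_chartRep hφ hψ hκ0 hκ (hY m).isMeasurableField hp hp'
      ((hY m).fieldLpNorm_lt_top p)
  have hconv : ∀ᶠ n : ℕ in atTop, ∀ α, localSobolevNorm p (chartSupport φ ψ α)
      (fun ξ ↦ chartRep (φ α) (Y m) ξ
        - mollify (rescaledKernel ζ n) (φ α).target (chartRep (φ α) (Y m)) ξ)
      ≤ ENNReal.ofReal ε := by
    refine eventually_all.2 fun α ↦ ?_
    refine ((tendsto_localSobolevNorm_mollify_sub hζ (φ α).open_target
      (isCompact_chartSupport hψ α) (hδ α).1 hδ0 (fun η hη ↦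
        Metric.closedBall_subset_cthickening hη δ) (hδ α).2 (hYint α)
      ((contDiffOn_chartRep (hφ α) (hY m)).of_le
        (le_trans one_le_two two_le_infty))).eventually (gt_mem_nhds hε')).mono fun n hn ↦ hn.le
  have hnδ : ∀ᶠ n : ℕ in atTop, (n : ℝ)⁻¹ < δ :=
    (tendsto_inv_atTop_nhds_zero_nat (𝕜 := ℝ)).eventually_lt_const hδ0
  filter_upwards [hconv, hnδ, eventually_ge_atTop 1] with n hn hnδ hn1
  have hXn := isSmoothField_mollifiedField hφ hψ hκ0 hκ hζ hXi hn1
  have happrox : IsSobolevApprox p (fun x ↦ X x - mollifiedField ζ φ ψ X n x)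
      (fun j x ↦ Y j x - mollifiedField ζ φ ψ X n x) := by
    refine ⟨hXm.sub hXn.isMeasurableField, fun j ↦ (hY j).sub hXn, ?_, ?_⟩
    · simpa only [sub_sub_sub_cancel_right] using hYc
    · simpa only [sub_sub_sub_cancel_right] using hYl
  refine (iInf₂_le _ happrox).trans (limsup_le_of_le (by isBoundedDefault) ?_)
  filter_upwards [eventually_ge_atTop m] with j hj
  -- `E` depends on `n`; this is harmless because its term tends to zero as `i → ∞` at fixed `n`.
  choose E hE hEle using fun α ↦ (hζ n hn1).exists_localSobolevNorm_mollify_le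
    (G := EuclideanSpace ℝ (Fin d)) (isCompact_chartSupport (φ := φ) hψ α) p
  have hbound (i : ℕ) (hi : m ≤ i) :
      smoothSobolevNorm p (fun x ↦ Y j x - mollifiedField ζ φ ψ X n x)
        ≤ C * ∑ α, (L α + 1 + L α) * ENNReal.ofReal ε
          + C * (∑ α, E α * D α) * fieldLpNorm p (fun x ↦ Y i x - X x) := by
    have hfield : (fun x ↦ Y j x - mollifiedField ζ φ ψ X n x) = assembleField φ ψ
        (fun α ξ ↦ chartRep (φ α) (Y j) ξ
          - mollify (rescaledKernel ζ n) (φ α).target (chartRep (φ α) X) ξ) := by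
      ext1 x
      rw [assembleField_sub, assembleField_chartRep hφ hψ, mollifiedField_eq_assembleField]
    rw [hfield]
    refine (hSle _ fun α ↦ (contDiffOn_chartRep (hφ α) (hY j)).sub
      ((hζ n hn1).contDiff_mollify (φ α).open_target.measurableSet (hXi α)).contDiffOn).trans ?_
    rw [mul_assoc C, ← mul_add]
    gcongr
    rw [Finset.sum_mul, ← Finset.sum_add_distrib]
    refine Finset.sum_le_sum fun α _ ↦ ?_
    refine (localSobolevNorm_sub_mollify_le hφ hψ hκ0 hκ hζ hp hp' α hn1 hnδ.le (hδ α) (hXi α)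
      (hY j) (hY m) (hY i)).trans ?_
    have h1 : localSobolevNorm p (chartSupport φ ψ α) (chartRep (φ α) (fun x ↦ Y j x - Y m x))
        ≤ L α * ENNReal.ofReal ε :=
      (localSobolevNorm_mono_set (Metric.self_subset_cthickening _)).trans
        ((hLle α _ ((hY j).sub (hY m))).trans (mul_le_mul_right (hYY j m hj le_rfl) _))
    have h2 : localSobolevNorm p (Metric.cthickening δ (chartSupport φ ψ α))
        (chartRep (φ α) (fun x ↦ Y m x - Y i x)) ≤ L α * ENNReal.ofReal ε :=
      (hLle α _ ((hY m).sub (hY i))).trans (mul_le_mul_right (hYY m i le_rfl hi) _)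
    have hm' := (hY i).isMeasurableField.sub hXm
    have h3 : localSobolevNorm p (chartSupport φ ψ α)
        (mollify (rescaledKernel ζ n) (φ α).target (chartRep (φ α) (fun x ↦ Y i x - X x)))
        ≤ E α * D α * fieldLpNorm p (fun x ↦ Y i x - X x) := by
      have hi : IntegrableOn (chartRep (φ α) (fun x ↦ Y i x - X x)) (φ α).target := by
        rw [chartRep_sub]
        exact (RiemannianMollification.integrableOn_chartRep hφ hψ hκ0 hκ
          (hY i).isMeasurableField hp hp' ((hY i).fieldLpNorm_lt_top p) α).sub (hXi α)
      refine (hEle α (φ α).open_target.measurableSet hi).trans ?_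
      rw [mul_assoc]
      exact mul_le_mul_right (hDle α _ hm') _
    refine (add_le_add (add_le_add (add_le_add h1 (hn α)) h2) h3).trans_eq ?_
    ring
  have hlim : Tendsto (fun i ↦ C * ∑ α, (L α + 1 + L α) * ENNReal.ofReal ε
      + C * (∑ α, E α * D α) * fieldLpNorm p (fun x ↦ Y i x - X x)) atTop
      (𝓝 (C * ∑ α, (L α + 1 + L α) * ENNReal.ofReal ε + C * (∑ α, E α * D α) * 0)) :=
    tendsto_const_nhds.add (ENNReal.Tendsto.const_mul hYl (Or.inr
      (ENNReal.mul_ne_top hC (ENNReal.sum_ne_top.2 fun α _ ↦ ENNReal.mul_ne_top (hE α) (hD α)))))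
  rw [mul_zero, add_zero] at hlim
  refine (ge_of_tendsto hlim ((eventually_ge_atTop m).mono hbound)).trans_eq ?_
  rw [mul_assoc, Finset.sum_mul]

end Convergence

/-! ### Divergence and integration by parts on `ℝ^d` -/

section EuclideanDivergence

variable {d : ℕ} {F G : EuclideanSpace ℝ (Fin d) → EuclideanSpace ℝ (Fin d)}
  {g : EuclideanSpace ℝ (Fin d) → ℝ} {ξ : EuclideanSpace ℝ (Fin d)}
  {T K : Set (EuclideanSpace ℝ (Fin d))}

/-- The divergence of a vector field on `ℝ^d`. -/
def euclideanDiv (F : EuclideanSpace ℝ (Fin d) → EuclideanSpace ℝ (Fin d))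
    (ξ : EuclideanSpace ℝ (Fin d)) : ℝ :=
  ∑ k, fderiv ℝ F ξ (EuclideanSpace.single k 1) k

theorem abs_euclideanDiv_le (F : EuclideanSpace ℝ (Fin d) → EuclideanSpace ℝ (Fin d))
    (ξ : EuclideanSpace ℝ (Fin d)) : |euclideanDiv F ξ| ≤ d * ‖fderiv ℝ F ξ‖ := by
  refine (Finset.abs_sum_le_sum_abs _ _).trans ?_
  refine (Finset.sum_le_card_nsmul _ _ ‖fderiv ℝ F ξ‖ fun k _ ↦ ?_).trans_eq (by simp)
  refine (PiLp.norm_apply_le (fderiv ℝ F ξ (EuclideanSpace.single k 1)) k).trans ?_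
  refine ((fderiv ℝ F ξ).le_opNorm _).trans_eq ?_
  rw [PiLp.norm_single, norm_one, mul_one]

theorem sum_apply_single_mul (L : EuclideanSpace ℝ (Fin d) →L[ℝ] ℝ)
    (v : EuclideanSpace ℝ (Fin d)) : ∑ k, L (EuclideanSpace.single k 1) * v k = L v := by
  conv_rhs => rw [← (EuclideanSpace.basisFun (Fin d) ℝ).sum_repr v]
  simp only [map_sum, map_smul, EuclideanSpace.basisFun_repr, EuclideanSpace.basisFun_apply,
    smul_eq_mul, mul_comm]

theorem euclideanDiv_smul (hg : DifferentiableAt ℝ g ξ) (hF : DifferentiableAt ℝ F ξ) :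
    euclideanDiv (fun η ↦ g η • F η) ξ = g ξ * euclideanDiv F ξ + fderiv ℝ g ξ (F ξ) := by
  rw [euclideanDiv, fderiv_fun_smul hg hF, euclideanDiv, Finset.mul_sum,
    ← sum_apply_single_mul (fderiv ℝ g ξ), ← Finset.sum_add_distrib]
  rfl

theorem euclideanDiv_congr (h : F =ᶠ[𝓝 ξ] G) : euclideanDiv F ξ = euclideanDiv G ξ := by
  rw [euclideanDiv, euclideanDiv, h.fderiv_eq]

theorem euclideanDiv_eq_zero (h : F =ᶠ[𝓝 ξ] fun _ ↦ 0) : euclideanDiv F ξ = 0 := by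
  rw [euclideanDiv, h.fderiv_eq]
  simp

theorem continuousOn_euclideanDiv (hT : IsOpen T) (hF : ContDiffOn ℝ 1 F T) :
    ContinuousOn (euclideanDiv F) T := by
  refine continuousOn_finsetSum _ fun k _ ↦ ?_
  exact (PiLp.continuous_apply 2 _ k).comp_continuousOn
    ((hF.continuousOn_fderiv_of_isOpen hT le_rfl).clm_apply continuousOn_const)

/-- Each partial derivative of a compactly supported component has zero integral, by integrating by
parts against the constant `1`. -/
theorem integral_euclideanDiv_eq_zero (hF : ContDiff ℝ 1 F) (hc : HasCompactSupport F) :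
    ∫ ξ, euclideanDiv F ξ = 0 := by
  have hk (k : Fin d) : ContDiff ℝ 1 (fun ξ ↦ F ξ k) := contDiff_euclidean.1 hF k
  have hck (k : Fin d) : HasCompactSupport (fun ξ ↦ F ξ k) :=
    hc.comp_left (g := fun v : EuclideanSpace ℝ (Fin d) ↦ v k) rfl
  have hcd (k : Fin d) : Continuous (fun ξ ↦ fderiv ℝ (fun η ↦ F η k) ξ
      (EuclideanSpace.single k 1)) :=
    ((hk k).continuous_fderiv one_ne_zero).clm_apply continuous_const
  have hcc (k : Fin d) : HasCompactSupport (fun ξ ↦ fderiv ℝ (fun η ↦ F η k) ξ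
      (EuclideanSpace.single k 1)) := ((hck k).fderiv ℝ).comp_left
        (g := fun L : EuclideanSpace ℝ (Fin d) →L[ℝ] ℝ ↦ L (EuclideanSpace.single k 1)) rfl
  have hI (k : Fin d) := (hcd k).integrable_of_hasCompactSupport (μ := volume) (hcc k)
  have hz (k : Fin d) : ∫ ξ, fderiv ℝ (fun η ↦ F η k) ξ (EuclideanSpace.single k 1) = 0 := by
    have h := integral_mul_fderiv_eq_neg_fderiv_mul_of_integrable (μ := volume)
      (f := fun ξ ↦ F ξ k) (g := fun _ ↦ (1 : ℝ)) (v := EuclideanSpace.single k 1)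
      (by simpa using hI k) (by simp)
      (by simpa using (hk k).continuous.integrable_of_hasCompactSupport (hck k))
      (fun ξ _ ↦ (hk k).differentiable one_ne_zero ξ) (fun ξ _ ↦ by fun_prop)
    simpa using h
  have heq : euclideanDiv F
      = fun ξ ↦ ∑ k, fderiv ℝ (fun η ↦ F η k) ξ (EuclideanSpace.single k 1) := by
    ext1 ξ
    refine Finset.sum_congr rfl fun k _ ↦ ?_
    have h := ((EuclideanSpace.proj k : EuclideanSpace ℝ (Fin d) →L[ℝ] ℝ).hasFDerivAt.comp ξ
      (hF.differentiable one_ne_zero ξ).hasFDerivAt).fderiv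
    have h' := DFunLike.congr_fun h (EuclideanSpace.single k 1)
    exact h'.symm
  rw [heq, integral_finsetSum _ fun k _ ↦ hI k, Finset.sum_eq_zero fun k _ ↦ hz k]

variable {V : Type*} [NormedAddCommGroup V] [NormedSpace ℝ V]
  {f : EuclideanSpace ℝ (Fin d) → V}

theorem indicator_eventuallyEq_zero (hK : IsCompact K) (h0 : ∀ η ∈ T, η ∉ K → f η = 0)
    (hξ : ξ ∉ K) : T.indicator f =ᶠ[𝓝 ξ] fun _ ↦ 0 := by
  filter_upwards [hK.isClosed.isOpen_compl.mem_nhds hξ] with η hη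
  by_cases h : η ∈ T
  · rw [Set.indicator_of_mem h, h0 η h hη]
  · exact Set.indicator_of_notMem h _

/-- Extension by zero is smooth since the function already vanishes near every boundary point of
`T`. -/
theorem contDiff_indicator {n : WithTop ℕ∞} (hT : IsOpen T) (hK : IsCompact K) (hKT : K ⊆ T)
    (hf : ContDiffOn ℝ n f T) (h0 : ∀ η ∈ T, η ∉ K → f η = 0) :
    ContDiff ℝ n (T.indicator f) := by
  refine contDiff_iff_contDiffAt.2 fun ξ ↦ ?_
  by_cases hξ : ξ ∈ T
  · refine (hf.contDiffAt (hT.mem_nhds hξ)).congr_of_eventuallyEq ?_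
    filter_upwards [hT.mem_nhds hξ] with η hη using Set.indicator_of_mem hη _
  · exact contDiffAt_const.congr_of_eventuallyEq
      (indicator_eventuallyEq_zero hK h0 fun h ↦ hξ (hKT h))

theorem integrableOn_of_continuousOn_of_eq_zero (hT : IsOpen T) (hK : IsCompact K) (hKT : K ⊆ T)
    (hf : ContinuousOn f T) (h0 : ∀ η ∈ T, η ∉ K → f η = 0) : IntegrableOn f T :=
  ((hf.mono hKT).integrableOn_compact hK).of_forall_sdiff_eq_zero hT.measurableSet
    fun η hη ↦ h0 η hη.1 hη.2

/-- Integration by parts on an open set. -/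
theorem setIntegral_mul_euclideanDiv (hT : IsOpen T) (hK : IsCompact K) (hKT : K ⊆ T)
    (hF : ContDiffOn ℝ 1 F T) (h0 : ∀ η ∈ T, η ∉ K → F η = 0) (hg : ContDiffOn ℝ 1 g T) :
    ∫ ξ in T, g ξ * euclideanDiv F ξ = - ∫ ξ in T, fderiv ℝ g ξ (F ξ) := by
  have h0' : ∀ η ∈ T, η ∉ K → g η • F η = 0 := fun η hη hηK ↦ by rw [h0 η hη hηK, smul_zero]
  have hH : ContDiff ℝ 1 (T.indicator fun ξ ↦ g ξ • F ξ) :=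
    contDiff_indicator hT hK hKT (hg.smul hF) h0'
  have hHc : HasCompactSupport (T.indicator fun ξ ↦ g ξ • F ξ) :=
    HasCompactSupport.intro hK fun ξ hξ ↦ (indicator_eventuallyEq_zero hK h0' hξ).eq_of_nhds
  -- The product rule; the formula then follows from the vanishing integral of the divergence of `g
  -- F` extended by zero.
  have hdiv : euclideanDiv (T.indicator fun ξ ↦ g ξ • F ξ)
      = T.indicator fun ξ ↦ g ξ * euclideanDiv F ξ + fderiv ℝ g ξ (F ξ) := by
    ext1 ξ
    by_cases hξ : ξ ∈ T
    · have hn := hT.mem_nhds hξ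
      rw [Set.indicator_of_mem hξ, ← euclideanDiv_smul
        ((hg.contDiffAt hn).differentiableAt one_ne_zero)
        ((hF.contDiffAt hn).differentiableAt one_ne_zero)]
      refine euclideanDiv_congr ?_
      filter_upwards [hn] with η hη using Set.indicator_of_mem hη _
    · rw [Set.indicator_of_notMem hξ]
      exact euclideanDiv_eq_zero (indicator_eventuallyEq_zero hK h0' fun h ↦ hξ (hKT h))
  have h := integral_euclideanDiv_eq_zero hH hHc
  rw [hdiv, integral_indicator hT.measurableSet, integral_add] at h
  · exact eq_neg_of_add_eq_zero_left h
  · refine integrableOn_of_continuousOn_of_eq_zero hT hK hKT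
      (hg.continuousOn.mul (continuousOn_euclideanDiv hT hF)) fun η hη hηK ↦ ?_
    rw [euclideanDiv_eq_zero, mul_zero]
    filter_upwards [hT.mem_nhds hη, hK.isClosed.isOpen_compl.mem_nhds hηK] with θ hθ hθK
    exact h0 θ hθ hθK
  · refine integrableOn_of_continuousOn_of_eq_zero hT hK hKT
      ((hg.continuousOn_fderiv_of_isOpen hT le_rfl).clm_apply hF.continuousOn) fun η hη hηK ↦ ?_
    rw [h0 η hη hηK, map_zero]

end EuclideanDivergence

/-! ### Riemannian divergence in a chart -/

section ChartDivergence

variable {d : ℕ} {M : Type*} [TopologicalSpace M] [ChartedSpace (EuclideanSpace ℝ (Fin d)) M]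
  [IsManifold (𝓡 d) ∞ M] [RiemannianBundle (fun x : M ↦ TangentSpace (𝓡 d) x)]
  [IsContMDiffRiemannianBundle (𝓡 d) ∞ (EuclideanSpace ℝ (Fin d))
      (fun x : M ↦ TangentSpace (𝓡 d) x)]
  [MeasurableSpace M] [BorelSpace M]
  {e : OpenPartialHomeomorph M (EuclideanSpace ℝ (Fin d))}
  {K : Set (EuclideanSpace ℝ (Fin d))}

theorem contDiffOn_comp_symm (he : e ∈ IsManifold.maximalAtlas (𝓡 d) ∞ M) {f : M → ℝ}
    (hf : ContMDiff (𝓡 d) 𝓘(ℝ, ℝ) ∞ f) : ContDiffOn ℝ ∞ (f ∘ e.symm) e.target := fun ξ hξ ↦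
  ((hf _).comp ξ (contMDiffAt_symm_of_mem_maximalAtlas he hξ)).contDiffAt.contDiffWithinAt

theorem aestronglyMeasurable_comp_chart {g : EuclideanSpace ℝ (Fin d) → ℝ}
    (hg : ContinuousOn g e.target) :
    AEStronglyMeasurable (g ∘ e) ((riemannianMeasure d M).restrict e.source) :=
  (hg.comp e.continuousOn fun _ hx ↦ e.map_source hx).aestronglyMeasurable
    e.open_source.measurableSet

theorem integrable_indicator_comp_chart [IsFiniteMeasure (riemannianMeasure d M)]
    (hK : IsCompact K) (hKe : K ⊆ e.target)
    {g : EuclideanSpace ℝ (Fin d) → ℝ} (hg : ContinuousOn g e.target)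
    (h0 : ∀ ξ ∈ e.target, ξ ∉ K → g ξ = 0) :
    Integrable (e.source.indicator (g ∘ e)) (riemannianMeasure d M) := by
  obtain ⟨C, hC⟩ := hK.exists_bound_of_continuousOn (hg.mono hKe)
  refine Integrable.of_bound ((aestronglyMeasurable_indicator_iff
    e.open_source.measurableSet).2 (aestronglyMeasurable_comp_chart hg)) (max C 0)
    (Eventually.of_forall fun x ↦ ?_)
  by_cases hx : x ∈ e.source
  · rw [Set.indicator_of_mem hx, Function.comp_apply]
    by_cases hxK : e x ∈ K
    · exact (hC _ hxK).trans (le_max_left _ _)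
    · rw [h0 _ (e.map_source hx) hxK, norm_zero]
      exact le_max_right _ _
  · rw [Set.indicator_of_notMem hx, norm_zero]
    exact le_max_right _ _

variable {κ : ℝ}

theorem IsBilipschitzChart.aemeasurable_volDensity (hκ0 : 0 < κ) (hκ : IsBilipschitzChart e κ)
    (he : e ∈ IsManifold.maximalAtlas (𝓡 d) ∞ M) :
    AEMeasurable (volDensity e) (volume.restrict e.target) :=
  (hκ.contDiffOn_volDensity hκ0 he).continuousOn.aemeasurable e.open_target.measurableSet

theorem IsBilipschitzChart.integral_indicator_comp_chart (hκ0 : 0 < κ)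
    (hκ : IsBilipschitzChart e κ) (he : e ∈ IsManifold.maximalAtlas (𝓡 d) ∞ M)
    {g : EuclideanSpace ℝ (Fin d) → ℝ} (hg : ContinuousOn g e.target) :
    ∫ x, e.source.indicator (g ∘ e) x ∂(riemannianMeasure d M)
      = ∫ ξ in e.target, volDensity e ξ * g ξ := by
  rw [integral_indicator e.open_source.measurableSet, integral_source_eq he
    (hκ.aemeasurable_volDensity hκ0 he) (aestronglyMeasurable_comp_chart hg)]
  refine setIntegral_congr_fun e.open_target.measurableSet fun ξ hξ ↦ ?_
  rw [Function.comp_apply, e.right_inv hξ]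

/-- The Riemannian divergence `ρ⁻¹ ∂_k (ρ u^k)` of `u^k ∂_{ξ^k}`, in the coordinates of a chart. -/
def chartDiv (e : OpenPartialHomeomorph M (EuclideanSpace ℝ (Fin d)))
    (u : EuclideanSpace ℝ (Fin d) → EuclideanSpace ℝ (Fin d)) (ξ : EuclideanSpace ℝ (Fin d)) :
    ℝ :=
  (volDensity e ξ)⁻¹ * euclideanDiv (fun η ↦ volDensity e η • u η) ξ

theorem chartDiv_eq_zero {u : EuclideanSpace ℝ (Fin d) → EuclideanSpace ℝ (Fin d)}
    (hK : IsCompact K) (h0 : ∀ ξ ∈ e.target, ξ ∉ K → u ξ = 0) {ξ : EuclideanSpace ℝ (Fin d)}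
    (hξ : ξ ∈ e.target) (hξK : ξ ∉ K) : chartDiv e u ξ = 0 := by
  rw [chartDiv, euclideanDiv_eq_zero, mul_zero]
  filter_upwards [e.open_target.mem_nhds hξ, hK.isClosed.isOpen_compl.mem_nhds hξK] with η hη hηK
  rw [h0 η hη hηK, smul_zero]

/-- Separates the Euclidean divergence from a term of order zero, the logarithmic derivative of the
density applied to `u`. -/
theorem IsBilipschitzChart.chartDiv_eq (hκ0 : 0 < κ) (hκ : IsBilipschitzChart e κ)
    (he : e ∈ IsManifold.maximalAtlas (𝓡 d) ∞ M)
    {u : EuclideanSpace ℝ (Fin d) → EuclideanSpace ℝ (Fin d)} {ξ : EuclideanSpace ℝ (Fin d)}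
    (hξ : ξ ∈ e.target) (hu : DifferentiableAt ℝ u ξ) :
    chartDiv e u ξ = euclideanDiv u ξ + (volDensity e ξ)⁻¹ * fderiv ℝ (volDensity e) ξ (u ξ) := by
  have hρ := (hκ.volDensity_pos hκ0 he hξ).ne'
  rw [chartDiv, euclideanDiv_smul (((hκ.contDiffOn_volDensity hκ0 he).contDiffAt
    (e.open_target.mem_nhds hξ)).differentiableAt (by simp)) hu]
  field_simp

theorem IsBilipschitzChart.contDiffOn_volDensity_smul (hκ0 : 0 < κ) (hκ : IsBilipschitzChart e κ)
    (he : e ∈ IsManifold.maximalAtlas (𝓡 d) ∞ M)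
    {u : EuclideanSpace ℝ (Fin d) → EuclideanSpace ℝ (Fin d)} (hu : ContDiffOn ℝ 1 u e.target) :
    ContDiffOn ℝ 1 (fun ξ ↦ volDensity e ξ • u ξ) e.target :=
  ((hκ.contDiffOn_volDensity hκ0 he).of_le (le_trans one_le_two two_le_infty)).smul hu

theorem IsBilipschitzChart.continuousOn_chartDiv (hκ0 : 0 < κ) (hκ : IsBilipschitzChart e κ)
    (he : e ∈ IsManifold.maximalAtlas (𝓡 d) ∞ M)
    {u : EuclideanSpace ℝ (Fin d) → EuclideanSpace ℝ (Fin d)} (hu : ContDiffOn ℝ 1 u e.target) :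
    ContinuousOn (chartDiv e u) e.target :=
  ((hκ.contDiffOn_volDensity hκ0 he).continuousOn.inv₀
    fun _ hξ ↦ (hκ.volDensity_pos hκ0 he hξ).ne').mul
    (continuousOn_euclideanDiv e.open_target (hκ.contDiffOn_volDensity_smul hκ0 he hu))

/-- The divergence theorem for a vector field supported in a chart. -/
theorem IsBilipschitzChart.integral_chartDiv_mul (hκ0 : 0 < κ) (hκ : IsBilipschitzChart e κ)
    (he : e ∈ IsManifold.maximalAtlas (𝓡 d) ∞ M) (hK : IsCompact K) (hKe : K ⊆ e.target)
    {u : EuclideanSpace ℝ (Fin d) → EuclideanSpace ℝ (Fin d)} (hu : ContDiffOn ℝ 1 u e.target)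
    (h0 : ∀ ξ ∈ e.target, ξ ∉ K → u ξ = 0) {f : M → ℝ} (hf : ContMDiff (𝓡 d) 𝓘(ℝ, ℝ) ∞ f) :
    ∫ x, e.source.indicator (chartDiv e u ∘ e) x * f x ∂(riemannianMeasure d M)
      = - ∫ x, e.source.indicator ((fun ξ ↦ fderiv ℝ (f ∘ e.symm) ξ (u ξ)) ∘ e) x
          ∂(riemannianMeasure d M) := by
  have hf' : ContDiffOn ℝ 1 (f ∘ e.symm) e.target :=
    (contDiffOn_comp_symm he hf).of_le (le_trans one_le_two two_le_infty)
  have h1 : (fun x ↦ e.source.indicator (chartDiv e u ∘ e) x * f x)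
      = e.source.indicator ((fun ξ ↦ chartDiv e u ξ * (f ∘ e.symm) ξ) ∘ e) := by
    ext1 x
    by_cases hx : x ∈ e.source
    · rw [Set.indicator_of_mem hx, Set.indicator_of_mem hx, Function.comp_apply,
        Function.comp_apply, Function.comp_apply, e.left_inv hx]
    · rw [Set.indicator_of_notMem hx, Set.indicator_of_notMem hx, zero_mul]
  rw [h1, hκ.integral_indicator_comp_chart hκ0 he
      (g := fun ξ ↦ chartDiv e u ξ * (f ∘ e.symm) ξ)
      ((hκ.continuousOn_chartDiv hκ0 he hu).mul hf'.continuousOn),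
    hκ.integral_indicator_comp_chart hκ0 he (g := fun ξ ↦ fderiv ℝ (f ∘ e.symm) ξ (u ξ))
      ((hf'.continuousOn_fderiv_of_isOpen e.open_target le_rfl).clm_apply hu.continuousOn)]
  -- Euclidean integration by parts for `ρ u`; the density of the measure cancels the factor `ρ⁻¹`
  -- in the divergence.
  have h := setIntegral_mul_euclideanDiv e.open_target hK hKe
    (hκ.contDiffOn_volDensity_smul hκ0 he hu)
    (fun η hη hηK ↦ by rw [h0 η hη hηK, smul_zero]) hf'
  refine Eq.trans (setIntegral_congr_fun e.open_target.measurableSet fun ξ hξ ↦ ?_)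
    (h.trans (congrArg Neg.neg (setIntegral_congr_fun e.open_target.measurableSet fun ξ _ ↦ ?_)))
  · have hρ := (hκ.volDensity_pos hκ0 he hξ).ne'
    simp only [chartDiv]
    field_simp
  · exact map_smul _ _ _

end ChartDivergence

/-! ### Logarithmic derivative of the density on compact sets -/

section ChartDensity

variable {d : ℕ} {M : Type*} [TopologicalSpace M] [ChartedSpace (EuclideanSpace ℝ (Fin d)) M]
  [IsManifold (𝓡 d) ∞ M] [RiemannianBundle (fun x : M ↦ TangentSpace (𝓡 d) x)]
  [IsContMDiffRiemannianBundle (𝓡 d) ∞ (EuclideanSpace ℝ (Fin d))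
      (fun x : M ↦ TangentSpace (𝓡 d) x)]
  [MeasurableSpace M] [BorelSpace M]
  {e : OpenPartialHomeomorph M (EuclideanSpace ℝ (Fin d))}
  {K : Set (EuclideanSpace ℝ (Fin d))} {κ : ℝ}

theorem IsBilipschitzChart.exists_logDeriv_volDensity_bound (hκ0 : 0 < κ)
    (hκ : IsBilipschitzChart e κ) (he : e ∈ IsManifold.maximalAtlas (𝓡 d) ∞ M)
    (hK : IsCompact K) (hKe : K ⊆ e.target) : ∃ R : ℝ, 0 ≤ R ∧ ∀ ξ ∈ K, ∀ w,
      |(volDensity e ξ)⁻¹ * fderiv ℝ (volDensity e) ξ w| ≤ R * ‖w‖ := by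
  have hρ := hκ.contDiffOn_volDensity hκ0 he
  obtain ⟨R, hR⟩ := hK.exists_bound_of_continuousOn (((hρ.continuousOn.inv₀
      fun _ hξ ↦ (hκ.volDensity_pos hκ0 he hξ).ne').smul
      (hρ.continuousOn_fderiv_of_isOpen e.open_target (by simp))).mono hKe)
  refine ⟨max R 0, le_max_right _ _, fun ξ hξ w ↦ ?_⟩
  have h := ((((volDensity e)⁻¹ • fderiv ℝ (volDensity e)) ξ).le_opNorm w).trans
    (mul_le_mul_of_nonneg_right ((hR ξ hξ).trans (le_max_left _ 0)) (norm_nonneg w))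
  exact h

end ChartDensity

/-! ### Divergence of an assembled field -/

section AssembledDivergence

variable {d : ℕ} {M : Type*} [TopologicalSpace M] [CompactSpace M]
  [ChartedSpace (EuclideanSpace ℝ (Fin d)) M]
  [IsManifold (𝓡 d) ∞ M] {ι : Type*} [Fintype ι]
  [RiemannianBundle (fun x : M ↦ TangentSpace (𝓡 d) x)]
  [IsContMDiffRiemannianBundle (𝓡 d) ∞ (EuclideanSpace ℝ (Fin d))
      (fun x : M ↦ TangentSpace (𝓡 d) x)]
  [MeasurableSpace M] [BorelSpace M]
  {φ : ι → OpenPartialHomeomorph M (EuclideanSpace ℝ (Fin d))}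
  {ψ : SmoothPartitionOfUnity ι (𝓡 d) M Set.univ}
  {u : ι → EuclideanSpace ℝ (Fin d) → EuclideanSpace ℝ (Fin d)}

/-- The components, in the chart `φ α`, of the summand `α` of the assembled field. -/
def summandRep (φ : ι → OpenPartialHomeomorph M (EuclideanSpace ℝ (Fin d)))
    (ψ : SmoothPartitionOfUnity ι (𝓡 d) M Set.univ)
    (u : ι → EuclideanSpace ℝ (Fin d) → EuclideanSpace ℝ (Fin d)) (α : ι)
    (ξ : EuclideanSpace ℝ (Fin d)) : EuclideanSpace ℝ (Fin d) :=
  (ψ α ∘ (φ α).symm) ξ • u α ξ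

/-- The divergence of the assembled field. -/
def assembledDiv (φ : ι → OpenPartialHomeomorph M (EuclideanSpace ℝ (Fin d)))
    (ψ : SmoothPartitionOfUnity ι (𝓡 d) M Set.univ)
    (u : ι → EuclideanSpace ℝ (Fin d) → EuclideanSpace ℝ (Fin d)) (x : M) : ℝ :=
  ∑ α, (φ α).source.indicator (chartDiv (φ α) (summandRep φ ψ u α) ∘ φ α) x

theorem summandRep_eq_zero {α : ι} {ξ : EuclideanSpace ℝ (Fin d)} (hξ : ξ ∈ (φ α).target)
    (hξK : ξ ∉ chartSupport φ ψ α) : summandRep φ ψ u α ξ = 0 := by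
  have h : (φ α).symm ξ ∉ tsupport (ψ α) := fun h ↦ hξK ⟨_, h, (φ α).right_inv hξ⟩
  rw [summandRep, Function.comp_apply, image_eq_zero_of_notMem_tsupport h, zero_smul]

variable (hφ : ∀ α, φ α ∈ IsManifold.maximalAtlas (𝓡 d) ∞ M)
  (hψ : ψ.IsSubordinate (fun α ↦ (φ α).source))
  {κ : ℝ} (hκ0 : 0 < κ) (hκ : ∀ α, IsBilipschitzChart (φ α) κ)
include hφ hψ

theorem mvfderiv_assembleField {f : M → ℝ} (hf : ContMDiff (𝓡 d) 𝓘(ℝ, ℝ) ∞ f) (x : M) :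
    mvfderiv (𝓡 d) f x (assembleField φ ψ u x) = ∑ α, (φ α).source.indicator
      ((fun ξ ↦ fderiv ℝ (f ∘ (φ α).symm) ξ (summandRep φ ψ u α ξ)) ∘ φ α) x := by
  rw [assembleField, map_sum]
  refine Finset.sum_congr rfl fun α _ ↦ ?_
  by_cases hx : x ∈ (φ α).source
  · rw [Set.indicator_of_mem hx, mvfderiv_eq_fderiv_comp_symm (hφ α) hx
      ((hf x).mdifferentiableAt (by simp)), map_smul (mvfderiv (𝓡 d) (φ α) x),
      mvfderiv_ofChartComponents (hφ α) hx, Function.comp_apply, summandRep, Function.comp_apply,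
      (φ α).left_inv hx]
  · rw [Set.indicator_of_notMem hx, image_eq_zero_of_notMem_tsupport fun h ↦ hx (hψ α h),
      zero_smul, map_zero]

theorem contDiffOn_summandRep {α : ι} (hu : ContDiffOn ℝ ∞ (u α) (φ α).target) :
    ContDiffOn ℝ 1 (summandRep φ ψ u α) (φ α).target :=
  ((contDiffOn_partition_symm hψ hφ α).smul hu).of_le (le_trans one_le_two two_le_infty)

include hκ0 hκ

/-- Each summand has compact support in its chart, where `integral_chartDiv_mul` applies; the
identities are summed over the charts. -/
theorem isDivergence_assembleField (hu : ∀ α, ContDiffOn ℝ ∞ (u α) (φ α).target) :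
    IsDivergence (assembleField φ ψ u) (assembledDiv φ ψ u) := by
  have := isFiniteMeasure_riemannianMeasure hφ hψ hκ0 hκ
  have hs := isSmoothField_assembleField hφ hψ hu
  have hC (α) := contDiffOn_summandRep hφ hψ (hu α)
  have hK (α) := isCompact_chartSupport (φ := φ) hψ α
  have hKT (α) := chartSupport_subset (φ := φ) hψ α
  have hdiv (α) := (hκ α).continuousOn_chartDiv hκ0 (hφ α) (hC α)
  have hzero (α) : ∀ ξ ∈ (φ α).target, ξ ∉ chartSupport φ ψ α → summandRep φ ψ u α ξ = 0 :=
    fun ξ ↦ summandRep_eq_zero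
  have hdiv0 (α) : ∀ ξ ∈ (φ α).target, ξ ∉ chartSupport φ ψ α →
      chartDiv (φ α) (summandRep φ ψ u α) ξ = 0 :=
    fun ξ ↦ chartDiv_eq_zero (hK α) (hzero α)
  have hint (α) := integrable_indicator_comp_chart (hK α) (hKT α) (hdiv α) (hdiv0 α)
  refine ⟨hs.isMeasurableField, hs.fieldLpNorm_lt_top 1, integrable_finsetSum _ fun α _ ↦ hint α,
    fun f hf ↦ ?_⟩
  have hf' (α) : ContDiffOn ℝ 1 (f ∘ (φ α).symm) (φ α).target :=
    (contDiffOn_comp_symm (hφ α) hf).of_le (le_trans one_le_two two_le_infty)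
  obtain ⟨B, hB⟩ := isCompact_univ.exists_bound_of_continuousOn hf.continuous.continuousOn
  simp only [mvfderiv_assembleField hφ hψ hf, assembledDiv, Finset.sum_mul]
  rw [integral_finsetSum, integral_finsetSum, ← Finset.sum_neg_distrib]
  · exact Finset.sum_congr rfl fun α _ ↦
      (hκ α).integral_chartDiv_mul hκ0 (hφ α) (hK α) (hKT α) (hC α) (hzero α) hf
  · exact fun α _ ↦ integrable_indicator_comp_chart (hK α) (hKT α)
      (g := fun ξ ↦ fderiv ℝ (f ∘ (φ α).symm) ξ (summandRep φ ψ u α ξ))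
      (((hf' α).continuousOn_fderiv_of_isOpen (φ α).open_target le_rfl).clm_apply
        (hC α).continuousOn) fun ξ hξ hξK ↦ by rw [hzero α ξ hξ hξK, map_zero]
  · exact fun α _ ↦ (hint α).mul_bdd hf.continuous.aestronglyMeasurable
      (Eventually.of_forall fun x ↦ hB x (Set.mem_univ x))

/-- A lower bound of the divergence of the assembled field. -/
theorem exists_neg_le_assembledDiv : ∃ B : ℝ, 0 ≤ B ∧
    ∀ u : ι → EuclideanSpace ℝ (Fin d) → EuclideanSpace ℝ (Fin d),
      (∀ α, ContDiffOn ℝ ∞ (u α) (φ α).target) → ∀ m N : ℝ, 0 ≤ m → 0 ≤ N →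
      (∀ α, ∀ η ∈ chartSupport φ ψ α, -m ≤ euclideanDiv (u α) η ∧ ‖u α η‖ ≤ N) →
      ∀ x, -(Fintype.card ι * m + B * N) ≤ assembledDiv φ ψ u x := by
  have hK (α) := isCompact_chartSupport (φ := φ) hψ α
  have hKT (α) := chartSupport_subset (φ := φ) hψ α
  choose P hP using fun α ↦ (hK α).exists_bound_of_continuousOn
    (((contDiffOn_partition_symm hψ hφ α).continuousOn_fderiv_of_isOpen (φ α).open_target
      (by simp)).mono (hKT α))
  choose R hR0 hR using fun α ↦
    (hκ α).exists_logDeriv_volDensity_bound hκ0 (hφ α) (hK α) (hKT α)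
  refine ⟨∑ α, (max (P α) 0 + R α), Finset.sum_nonneg fun α _ ↦
    add_nonneg (le_max_right _ _) (hR0 α),
    fun u hu m N hm hN h x ↦ ?_⟩
  have hsum : -(Fintype.card ι * m + (∑ α, (max (P α) 0 + R α)) * N)
      = ∑ α, -(m + (max (P α) 0 + R α) * N) := by
    rw [Finset.sum_neg_distrib, Finset.sum_add_distrib (f := fun _ ↦ m), Finset.sum_mul]
    simp
  rw [hsum, assembledDiv]
  refine Finset.sum_le_sum fun α _ ↦ ?_
  have hneg : -(m + (max (P α) 0 + R α) * N) ≤ 0 := by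
    have := hR0 α
    rw [neg_nonpos]
    positivity
  by_cases hx : x ∈ (φ α).source
  · rw [Set.indicator_of_mem hx, Function.comp_apply]
    have hξ := (φ α).map_source hx
    have hn := (φ α).open_target.mem_nhds hξ
    by_cases hxK : φ α x ∈ chartSupport φ ψ α
    · obtain ⟨h1, h2⟩ := h α _ hxK
      have hdψ := ((contDiffOn_partition_symm hψ hφ α).contDiffAt hn).differentiableAt (by simp)
      have hdu := ((hu α).contDiffAt hn).differentiableAt (by simp)
      have hP' := (hP α _ hxK).trans (le_max_left _ 0)
      have hψ0 : 0 ≤ ψ α x := ψ.nonneg α x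
      have hψ1 : ψ α x ≤ 1 := ψ.le_one α x
      rw [(hκ α).chartDiv_eq hκ0 (hφ α) hξ (u := summandRep φ ψ u α) (hdψ.smul hdu)]
      change _ ≤ euclideanDiv (fun ξ ↦ (ψ α ∘ (φ α).symm) ξ • u α ξ) (φ α x) + _ *
        fderiv ℝ (volDensity (φ α)) (φ α x) ((ψ α ∘ (φ α).symm) (φ α x) • u α (φ α x))
      rw [euclideanDiv_smul hdψ hdu, Function.comp_apply (f := ψ α), (φ α).left_inv hx, map_smul,
        smul_eq_mul]
      -- The divergence of the summand is now `ψ div u + dψ(u) + ρ⁻¹ ψ dρ(u)`. The first term is at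
      -- least `-m` because `0 ≤ ψ ≤ 1`; the others are bounded by `max P 0 * N` and `R * N`.
      have h3 := abs_le.1 ((ContinuousLinearMap.le_opNorm _ _).trans
        (mul_le_mul hP' h2 (norm_nonneg _) (le_max_right _ _)))
      have h4 := abs_le.1 ((hR α _ hxK (u α (φ α x))).trans
        (mul_le_mul_of_nonneg_left h2 (hR0 α)))
      set D := fderiv ℝ (volDensity (φ α)) (φ α x) (u α (φ α x))
      set ρ := (volDensity (φ α) (φ α x))⁻¹
      have hRN : 0 ≤ R α * N := mul_nonneg (hR0 α) hN
      have h5 : -m ≤ ψ α x * euclideanDiv (u α) (φ α x) := by nlinarith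
      have h6 : -(R α * N) ≤ ρ * (ψ α x * D) := by
        rw [mul_left_comm]
        nlinarith
      linarith [h3.1]
    · rw [chartDiv_eq_zero (hK α) (fun ξ ↦ summandRep_eq_zero) hξ hxK]
      exact hneg
  · rw [Set.indicator_of_notMem hx]
    exact hneg

end AssembledDivergence

/-! ### Divergence of mollified components -/

section MollifiedDivergence

variable {d : ℕ} {k : EuclideanSpace ℝ (Fin d) → ℝ} {r : ℝ}
  {T : Set (EuclideanSpace ℝ (Fin d))}
  {v : EuclideanSpace ℝ (Fin d) → EuclideanSpace ℝ (Fin d)}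

theorem integrableOn_clm_apply (hT : MeasurableSet T)
    {L : EuclideanSpace ℝ (Fin d) → EuclideanSpace ℝ (Fin d) →L[ℝ] ℝ} (hL : ContinuousOn L T)
    {C : ℝ} (hC : ∀ ξ ∈ T, ‖L ξ‖ ≤ C) (hv : IntegrableOn v T) :
    IntegrableOn (fun ξ ↦ L ξ (v ξ)) T := by
  refine (hv.norm.const_mul C).mono'
    ((ContinuousLinearMap.id ℝ (EuclideanSpace ℝ (Fin d) →L[ℝ] ℝ)).aestronglyMeasurable_comp₂
      (hL.aestronglyMeasurable hT) hv.aestronglyMeasurable) ?_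
  filter_upwards [ae_restrict_mem hT] with ξ hξ
  exact ((L ξ).le_opNorm _).trans (mul_le_mul_of_nonneg_right (hC ξ hξ) (norm_nonneg _))

namespace IsMollifier

theorem integrableOn_fderiv_apply (hk : IsMollifier k r) (hT : MeasurableSet T)
    (hv : IntegrableOn v T) (η : EuclideanSpace ℝ (Fin d)) :
    IntegrableOn (fun ξ ↦ fderiv ℝ k (η - ξ) (v ξ)) T := by
  obtain ⟨C, hC⟩ := (hk.hasCompactSupport.fderiv ℝ).exists_bound_of_continuous
    (hk.contDiff.continuous_fderiv (by simp))
  exact integrableOn_clm_apply hT ((hk.contDiff.continuous_fderiv (by simp)).comp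
    (continuous_const.sub continuous_id)).continuousOn (fun ξ _ ↦ hC _) hv

/-- All derivatives fall on the kernel; the trace over coordinates reassembles the differential of
`k` applied to `v`. -/
theorem euclideanDiv_mollify (hk : IsMollifier k r) (hT : MeasurableSet T)
    (hv : IntegrableOn v T) (η : EuclideanSpace ℝ (Fin d)) :
    euclideanDiv (mollify k T v) η = ∫ ξ in T, fderiv ℝ k (η - ξ) (v ξ) := by
  obtain ⟨C, hC⟩ := (hk.hasCompactSupport.fderiv ℝ).exists_bound_of_continuous
    (hk.contDiff.continuous_fderiv (by simp))
  have hi (j : Fin d) :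
      IntegrableOn (fun ξ ↦ fderiv ℝ k (η - ξ) (EuclideanSpace.single j 1) • v ξ) T := by
    refine hv.bdd_smul C (((hk.contDiff.continuous_fderiv (by simp)).comp
      (continuous_const.sub continuous_id)).clm_apply continuous_const).aestronglyMeasurable
      (Eventually.of_forall fun ξ ↦ ?_)
    refine ((fderiv ℝ k (η - ξ)).le_opNorm _).trans ?_
    rw [PiLp.norm_single, norm_one, mul_one]
    exact hC _
  have hc (j : Fin d) : fderiv ℝ (mollify k T v) η (EuclideanSpace.single j 1) j
      = ∫ ξ in T, fderiv ℝ k (η - ξ) (EuclideanSpace.single j 1) * v ξ j := by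
    rw [hk.fderiv_mollify_apply hT hv]
    exact ((EuclideanSpace.proj j : EuclideanSpace ℝ (Fin d) →L[ℝ] ℝ).integral_comp_comm
      (hi j)).symm
  rw [euclideanDiv, Finset.sum_congr rfl fun j _ ↦ hc j, ← integral_finsetSum]
  · simp only [sum_apply_single_mul]
  · exact fun j _ ↦ (EuclideanSpace.proj j : EuclideanSpace ℝ (Fin d) →L[ℝ] ℝ).integrable_comp
      (hi j)

theorem setIntegral_sub (hk : IsMollifier k r) {η : EuclideanSpace ℝ (Fin d)}
    (hη : Metric.closedBall η r ⊆ T) : ∫ ξ in T, k (η - ξ) = 1 := by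
  rw [setIntegral_eq_integral_of_forall_compl_eq_zero, hk.integral_sub]
  exact fun ξ hξ ↦ hk.eq_zero (not_lt.1 fun h ↦ hξ (hη h.le))

/-- The kernel has total mass one, and the part outside `T` only loses mass, so this holds up to the
boundary of `T`. -/
theorem norm_mollify_le (hk : IsMollifier k r) {η : EuclideanSpace ℝ (Fin d)} {N : ℝ}
    (hN : ∀ᵐ ξ ∂(volume.restrict T), ‖v ξ‖ ≤ N) (hN0 : 0 ≤ N) : ‖mollify k T v η‖ ≤ N := by
  have hi : Integrable (fun ξ ↦ k (η - ξ) * N) := (hk.integrable.comp_sub_left η).mul_const N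
  refine (norm_integral_le_of_norm_le hi.integrableOn (hN.mono fun ξ hξ ↦ ?_)).trans ?_
  · rw [norm_smul, Real.norm_of_nonneg (hk.nonneg _)]
    exact mul_le_mul_of_nonneg_left hξ (hk.nonneg _)
  · refine (setIntegral_le_integral hi (Eventually.of_forall fun ξ ↦
      mul_nonneg (hk.nonneg _) hN0)).trans_eq ?_
    rw [integral_mul_const, hk.integral_sub, one_mul]

end IsMollifier

end MollifiedDivergence

/-! ### Testing the divergence inside a chart -/

section ChartTest

variable {d : ℕ} {M : Type*} [TopologicalSpace M] [ChartedSpace (EuclideanSpace ℝ (Fin d)) M]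
  {e : OpenPartialHomeomorph M (EuclideanSpace ℝ (Fin d))}
  {K : Set (EuclideanSpace ℝ (Fin d))} {g : EuclideanSpace ℝ (Fin d) → ℝ}

/-- In a Hausdorff space the compact set `e.symm '' K` is closed, so the function vanishes near
every point outside the chart domain. This makes its extension by zero a smooth test function on
`M`. -/
theorem indicator_comp_chart_eventuallyEq_zero [T2Space M] (hK : IsCompact K)
    (hKe : K ⊆ e.target) (h0 : ∀ ξ ∈ e.target, ξ ∉ K → g ξ = 0) {x : M} (hx : x ∉ e.source) :
    e.source.indicator (g ∘ e) =ᶠ[𝓝 x] fun _ ↦ 0 := by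
  have hc : IsClosed (e.symm '' K) :=
    (hK.image_of_continuousOn (e.continuousOn_symm.mono hKe)).isClosed
  have hxc : x ∉ e.symm '' K := by
    rintro ⟨ξ, hξ, rfl⟩
    exact hx (e.map_target (hKe hξ))
  filter_upwards [hc.isOpen_compl.mem_nhds hxc] with y hy
  by_cases hys : y ∈ e.source
  · rw [Set.indicator_of_mem hys, Function.comp_apply]
    exact h0 _ (e.map_source hys) fun h ↦ hy ⟨_, h, e.left_inv hys⟩
  · exact Set.indicator_of_notMem hys _

theorem indicator_comp_chart_comp_symm :
    Set.EqOn (e.source.indicator (g ∘ e) ∘ e.symm) g e.target := fun ξ hξ ↦ by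
  rw [Function.comp_apply, Set.indicator_of_mem (e.map_target hξ), Function.comp_apply,
    e.right_inv hξ]

theorem contMDiff_indicator_comp_chart [IsManifold (𝓡 d) ∞ M] [T2Space M]
    (he : e ∈ IsManifold.maximalAtlas (𝓡 d) ∞ M) (hK : IsCompact K) (hKe : K ⊆ e.target)
    (hg : ContDiffOn ℝ ∞ g e.target) (h0 : ∀ ξ ∈ e.target, ξ ∉ K → g ξ = 0) :
    ContMDiff (𝓡 d) 𝓘(ℝ, ℝ) ∞ (e.source.indicator (g ∘ e)) := by
  intro x
  by_cases hx : x ∈ e.source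
  · have h : ContMDiffAt (𝓡 d) 𝓘(ℝ, ℝ) ∞ (g ∘ e) x :=
      ((hg.contDiffAt (e.open_target.mem_nhds (e.map_source hx))).contMDiffAt).comp x
        (contMDiffAt_of_mem_maximalAtlas he hx)
    refine h.congr_of_eventuallyEq ?_
    filter_upwards [e.open_source.mem_nhds hx] with y hy using Set.indicator_of_mem hy _
  · exact contMDiffAt_const.congr_of_eventuallyEq
      (indicator_comp_chart_eventuallyEq_zero hK hKe h0 hx)

variable [IsManifold (𝓡 d) ∞ M] [RiemannianBundle (fun x : M ↦ TangentSpace (𝓡 d) x)]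
  [IsContMDiffRiemannianBundle (𝓡 d) ∞ (EuclideanSpace ℝ (Fin d))
      (fun x : M ↦ TangentSpace (𝓡 d) x)]
  [MeasurableSpace M] [BorelSpace M] {κ : ℝ}

/-- The definition of the divergence, tested with a function supported in a chart. -/
theorem IsDivergence.setIntegral_chart_eq [T2Space M] (hκ0 : 0 < κ) (hκ : IsBilipschitzChart e κ)
    (he : e ∈ IsManifold.maximalAtlas (𝓡 d) ∞ M) {X : Π x : M, TangentSpace (𝓡 d) x}
    {h : M → ℝ} (hX : IsDivergence X h) (hK : IsCompact K) (hKe : K ⊆ e.target)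
    (hg : ContDiffOn ℝ ∞ g e.target) (h0 : ∀ ξ ∈ e.target, ξ ∉ K → g ξ = 0) :
    ∫ ξ in e.target, volDensity e ξ * (h (e.symm ξ) * g ξ)
      = - ∫ ξ in e.target, volDensity e ξ * fderiv ℝ g ξ (chartRep e X ξ) := by
  obtain ⟨hXm, -, hh, hXf⟩ := hX
  have hf := contMDiff_indicator_comp_chart he hK hKe hg h0
  have hρ := hκ.aemeasurable_volDensity hκ0 he
  set f := e.source.indicator (g ∘ e) with hfdef
  have hL : ∫ x, h x * f x ∂(riemannianMeasure d M)
      = ∫ ξ in e.target, volDensity e ξ * (h (e.symm ξ) * g ξ) := by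
    rw [← setIntegral_eq_integral_of_forall_compl_eq_zero (s := e.source)
      fun x hx ↦ by rw [hfdef, Set.indicator_of_notMem hx, mul_zero],
      integral_source_eq he hρ (h := fun x ↦ h x * f x)
        (hh.aestronglyMeasurable.restrict.mul hf.continuous.aestronglyMeasurable)]
    refine setIntegral_congr_fun e.open_target.measurableSet fun ξ hξ ↦ ?_
    rw [← indicator_comp_chart_comp_symm (g := g) hξ]
    rfl
  have hmv (x) (hx : x ∈ e.source) : mvfderiv (𝓡 d) f x (X x)
      = fderiv ℝ g (e x) (chartComponents e X x) := by
    rw [mvfderiv_eq_fderiv_comp_symm he hx ((hf x).mdifferentiableAt (by simp)),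
      (indicator_comp_chart_comp_symm.eventuallyEq_of_mem
        (e.open_target.mem_nhds (e.map_source hx))).fderiv_eq]
    rfl
  have hmeas : AEStronglyMeasurable (fun x ↦ mvfderiv (𝓡 d) f x (X x))
      ((riemannianMeasure d M).restrict e.source) := by
    have h1 : AEStronglyMeasurable (fun x ↦ fderiv ℝ g (e x))
        ((riemannianMeasure d M).restrict e.source) :=
      ((hg.continuousOn_fderiv_of_isOpen e.open_target (by simp)).comp e.continuousOn
        fun _ hx ↦ e.map_source hx).aestronglyMeasurable e.open_source.measurableSet
    refine ((ContinuousLinearMap.id ℝ (EuclideanSpace ℝ (Fin d) →L[ℝ] ℝ)).aestronglyMeasurable_comp₂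
      h1 (hXm e he).aestronglyMeasurable).congr ?_
    filter_upwards [ae_restrict_mem e.open_source.measurableSet] with x hx
    exact (hmv x hx).symm
  have hR : ∫ x, mvfderiv (𝓡 d) f x (X x) ∂(riemannianMeasure d M)
      = ∫ ξ in e.target, volDensity e ξ * fderiv ℝ g ξ (chartRep e X ξ) := by
    rw [← setIntegral_eq_integral_of_forall_compl_eq_zero (s := e.source), integral_source_eq he hρ
      hmeas]
    · refine setIntegral_congr_fun e.open_target.measurableSet fun ξ hξ ↦ ?_
      beta_reduce
      rw [hmv _ (e.map_target hξ), e.right_inv hξ]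
      rfl
    · intro x hx
      have hz := indicator_comp_chart_eventuallyEq_zero hK hKe h0 hx
      have hm : mvfderiv (𝓡 d) f x = 0 := by
        rw [mvfderiv, (show f =ᶠ[𝓝 x] fun _ ↦ 0 from hz).mfderiv_eq, mfderiv_const]
        rfl
      rw [hm]
      rfl
  rw [← hL, ← hR]
  exact hXf f hf

theorem IsBilipschitzChart.integrableOn_comp_symm (hκ0 : 0 < κ) (hκ : IsBilipschitzChart e κ)
    (he : e ∈ IsManifold.maximalAtlas (𝓡 d) ∞ M) {h : M → ℝ}
    (hh : Integrable h (riemannianMeasure d M)) : IntegrableOn (h ∘ e.symm) e.target := by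
  refine memLp_one_iff_integrable.1 ⟨(hκ.aestronglyMeasurable_map hκ0 he
    hh.aestronglyMeasurable.restrict).comp_aemeasurable (aemeasurable_symm e), ?_⟩
  refine (hκ.eLpNorm_comp_symm_le hκ0 he ENNReal.one_ne_top
    hh.aestronglyMeasurable.restrict).trans_lt (ENNReal.mul_lt_top (by simp) ?_)
  exact (memLp_one_iff_integrable.2 hh.restrict).2

theorem IsBilipschitzChart.ae_norm_chartRep_le (hκ0 : 0 < κ) (hκ : IsBilipschitzChart e κ)
    (he : e ∈ IsManifold.maximalAtlas (𝓡 d) ∞ M) {X : Π x : M, TangentSpace (𝓡 d) x} {N : ℝ}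
    (hN : ∀ᵐ x ∂(riemannianMeasure d M), ‖X x‖ ≤ N) :
    ∀ᵐ ξ ∂(volume.restrict e.target), ‖chartRep e X ξ‖ ≤ κ * N := by
  filter_upwards [hκ.ae_symm hκ0 he hN, ae_restrict_mem e.open_target.measurableSet] with ξ h hξ
  exact (hκ _ (e.map_target hξ) _).1.trans (mul_le_mul_of_nonneg_left h hκ0.le)

/-- The divergence of the mollified components is bounded below by that of the field, for kernels
supported in small balls. -/
theorem IsBilipschitzChart.exists_neg_le_euclideanDiv_mollify [T2Space M] (hκ0 : 0 < κ)
    (hκ : IsBilipschitzChart e κ) (he : e ∈ IsManifold.maximalAtlas (𝓡 d) ∞ M) {δ : ℝ}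
    (hδ : IsCompact (Metric.cthickening δ K) ∧ Metric.cthickening δ K ⊆ e.target) :
    ∃ R : ℝ, 0 ≤ R ∧ ∀ (k : EuclideanSpace ℝ (Fin d) → ℝ) (r : ℝ), IsMollifier k r → r ≤ δ →
      ∀ (X : Π x : M, TangentSpace (𝓡 d) x) (h : M → ℝ) (a N : ℝ), IsDivergence X h →
        IntegrableOn (chartRep e X) e.target →
        (∀ᵐ x ∂(riemannianMeasure d M), -a ≤ h x) →
        (∀ᵐ x ∂(riemannianMeasure d M), ‖X x‖ ≤ N) →
        ∀ η ∈ K, -(a + R * N) ≤ euclideanDiv (mollify k e.target (chartRep e X)) η := by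
  obtain ⟨R, hR0, hR⟩ := hκ.exists_logDeriv_volDensity_bound hκ0 he hδ.1 hδ.2
  -- `R` bounds the logarithmic derivative of the density and `κ` converts the Riemannian length of
  -- `X` into the Euclidean one.
  refine ⟨R * κ, by positivity, fun k r hk hr X h a N hX hv ha hN η hη ↦ ?_⟩
  have hT := e.open_target.measurableSet
  have hball : Metric.closedBall η r ⊆ Metric.cthickening δ K :=
    (Metric.closedBall_subset_closedBall hr).trans (Metric.closedBall_subset_cthickening hη δ)
  have hballT := hball.trans hδ.2
  have hρ := hκ.contDiffOn_volDensity hκ0 he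
  have hρ0 (ξ) (hξ : ξ ∈ e.target) := (hκ.volDensity_pos hκ0 he hξ).ne'
  have hkη : ContDiff ℝ ∞ (fun ξ ↦ k (η - ξ)) :=
    hk.contDiff.comp (contDiff_const.sub contDiff_id)
  have hk0 (ξ) (hξ : ξ ∉ Metric.closedBall η r) : k (η - ξ) = 0 :=
    hk.eq_zero (not_le.1 hξ).le
  -- Dividing by the density cancels the weight of the measure, so the left side of the divergence
  -- identity becomes the mollification of `h` itself.
  let g (ξ : EuclideanSpace ℝ (Fin d)) : ℝ := k (η - ξ) * (volDensity e ξ)⁻¹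
  have hg : ContDiffOn ℝ ∞ g e.target := hkη.contDiffOn.mul (hρ.inv hρ0)
  have hg0 : ∀ ξ ∈ e.target, ξ ∉ Metric.closedBall η r → g ξ = 0 := fun ξ _ hξ ↦ by
    simp only [g, hk0 ξ hξ, zero_mul]
  have hdiv := hX.setIntegral_chart_eq hκ0 hκ he (isCompact_closedBall η r) hballT hg hg0
  -- The first term produces the divergence of the mollified components; the second is the zeroth
  -- order error.
  have hgd (ξ) (hξ : ξ ∈ e.target) (w) : volDensity e ξ * fderiv ℝ g ξ w
      = -(fderiv ℝ k (η - ξ) w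
        + k (η - ξ) * ((volDensity e ξ)⁻¹ * fderiv ℝ (volDensity e) ξ w)) := by
    have h1 : HasFDerivAt (fun ξ ↦ k (η - ξ)) (-fderiv ℝ k (η - ξ)) ξ := by
      have := ((hk.contDiff.differentiable (by simp)) (η - ξ)).hasFDerivAt.comp ξ
        ((hasFDerivAt_const η ξ).sub (hasFDerivAt_id ξ))
      rw [zero_sub, ContinuousLinearMap.comp_neg, ContinuousLinearMap.comp_id] at this
      exact this
    have h2 := ((hρ.contDiffAt (e.open_target.mem_nhds hξ)).differentiableAt
      (by simp)).hasFDerivAt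
    have h3 : HasFDerivAt (fun ξ ↦ (volDensity e ξ)⁻¹)
        (-((volDensity e ξ) ^ 2)⁻¹ • fderiv ℝ (volDensity e) ξ) ξ :=
      (hasDerivAt_inv (hρ0 ξ hξ)).comp_hasFDerivAt ξ h2
    have h4 := (h1.mul h3).fderiv
    change fderiv ℝ g ξ = _ at h4
    have := hρ0 ξ hξ
    rw [h4]
    simp only [_root_.add_apply, _root_.smul_apply, _root_.neg_apply, smul_eq_mul]
    field_simp
    ring
  have hLHS : ∫ ξ in e.target, volDensity e ξ * (h (e.symm ξ) * g ξ)
      = ∫ ξ in e.target, k (η - ξ) • (h ∘ e.symm) ξ := by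
    refine setIntegral_congr_fun hT fun ξ hξ ↦ ?_
    have := hρ0 ξ hξ
    simp only [g, Function.comp_apply, smul_eq_mul]
    field_simp
  have hkint : IntegrableOn (fun ξ ↦ k (η - ξ)) e.target :=
    (hk.integrable.comp_sub_left η).integrableOn
  -- An average of a function bounded below by `-a`; the kernel has full mass in the target since
  -- its ball lies there.
  have hlow : -a ≤ ∫ ξ in e.target, k (η - ξ) • (h ∘ e.symm) ξ := by
    have h1 : ∫ ξ in e.target, k (η - ξ) * (-a) = -a := by
      rw [integral_mul_const, hk.setIntegral_sub hballT, one_mul]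
    rw [← h1]
    refine integral_mono_ae (hkint.mul_const _)
      (hk.integrableOn_smul (hκ.integrableOn_comp_symm hκ0 he hX.2.2.1) η) ?_
    filter_upwards [hκ.ae_symm hκ0 he ha] with ξ hξ
    exact mul_le_mul_of_nonneg_left hξ (hk.nonneg _)
  have hup : -∫ ξ in e.target, volDensity e ξ * fderiv ℝ g ξ (chartRep e X ξ)
      ≤ (∫ ξ in e.target, fderiv ℝ k (η - ξ) (chartRep e X ξ)) + R * κ * N := by
    have h1 : (∫ ξ in e.target, fderiv ℝ k (η - ξ) (chartRep e X ξ)) + R * κ * N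
        = ∫ ξ in e.target, (fderiv ℝ k (η - ξ) (chartRep e X ξ) + k (η - ξ) * (R * κ * N)) := by
      rw [integral_add (hk.integrableOn_fderiv_apply hT hv η) (hkint.mul_const _),
        integral_mul_const, hk.setIntegral_sub hballT, one_mul]
    rw [h1, ← integral_neg]
    refine integral_mono_ae ?_
      ((hk.integrableOn_fderiv_apply hT hv η).add (hkint.mul_const _)) ?_
    -- The form `ρ dg` is bounded on the compact ball and zero outside it, hence bounded on the
    -- whole target.
    · have hc : ContinuousOn (fun ξ ↦ volDensity e ξ • fderiv ℝ g ξ) e.target :=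
        hρ.continuousOn.smul (hg.continuousOn_fderiv_of_isOpen e.open_target (by simp))
      obtain ⟨C, hC⟩ := (isCompact_closedBall η r).exists_bound_of_continuousOn
        (hc.mono hballT)
      have hgz (ξ) (hξ : ξ ∈ e.target) (hξb : ξ ∉ Metric.closedBall η r) : fderiv ℝ g ξ = 0 := by
        have hz : g =ᶠ[𝓝 ξ] fun _ ↦ 0 := by
          filter_upwards [Metric.isClosed_closedBall.isOpen_compl.mem_nhds hξb,
            e.open_target.mem_nhds hξ] with θ hθ hθT
          exact hg0 θ hθT hθ
        rw [hz.fderiv_eq]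
        simp
      have hi : IntegrableOn (fun ξ ↦ (volDensity e ξ • fderiv ℝ g ξ) (chartRep e X ξ))
          e.target := by
        refine integrableOn_clm_apply hT hc (C := max C 0) (fun ξ hξ ↦ ?_) hv
        by_cases hξb : ξ ∈ Metric.closedBall η r
        · exact (hC ξ hξb).trans (le_max_left _ _)
        · rw [hgz ξ hξ hξb, smul_zero, norm_zero]
          exact le_max_right _ _
      exact hi.neg
    · filter_upwards [ae_restrict_mem hT, hκ.ae_norm_chartRep_le hκ0 he hN] with ξ hξ hξN
      beta_reduce
      rw [hgd ξ hξ, neg_neg]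
      gcongr ?_ + ?_
      · exact le_rfl
      by_cases hξb : ξ ∈ Metric.closedBall η r
      · refine mul_le_mul_of_nonneg_left ((le_abs_self _).trans ((hR ξ (hball hξb) _).trans ?_))
          (hk.nonneg _)
        rw [mul_assoc]
        exact mul_le_mul_of_nonneg_left hξN hR0
      · rw [hk0 ξ hξb, zero_mul, zero_mul]
  rw [hk.euclideanDiv_mollify hT hv]
  linarith [hdiv.symm.trans hLHS]

end ChartTest

theorem ae_norm_le_toReal_eLpNorm_top {α : Type*} [MeasurableSpace α] {μ : Measure α} {f : α → ℝ}
    (hf : eLpNorm f ⊤ μ < ⊤) : ∀ᵐ x ∂μ, ‖f x‖ ≤ (eLpNorm f ⊤ μ).toReal := by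
  rw [eLpNorm_exponent_top] at hf ⊢
  filter_upwards [enorm_ae_le_eLpNormEssSup f μ] with x hx
  rw [← toReal_enorm]
  exact ENNReal.toReal_mono hf.ne hx

/-! ### The uniform lower bound of the divergence -/

section DivergenceBound

variable {d : ℕ} {M : Type*} [TopologicalSpace M] [T2Space M] [CompactSpace M]
  [ChartedSpace (EuclideanSpace ℝ (Fin d)) M]
  [IsManifold (𝓡 d) ∞ M] {ι : Type*} [Fintype ι]
  [RiemannianBundle (fun x : M ↦ TangentSpace (𝓡 d) x)]
  [IsContMDiffRiemannianBundle (𝓡 d) ∞ (EuclideanSpace ℝ (Fin d))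
      (fun x : M ↦ TangentSpace (𝓡 d) x)]
  [MeasurableSpace M] [BorelSpace M]
  {φ : ι → OpenPartialHomeomorph M (EuclideanSpace ℝ (Fin d))}
  {ψ : SmoothPartitionOfUnity ι (𝓡 d) M Set.univ}
  (hφ : ∀ α, φ α ∈ IsManifold.maximalAtlas (𝓡 d) ∞ M)
  (hψ : ψ.IsSubordinate (fun α ↦ (φ α).source))
  {κ : ℝ} (hκ0 : 0 < κ) (hκ : ∀ α, IsBilipschitzChart (φ α) κ)
include hφ hψ hκ0 hκ

/-- For a fixed kernel the divergence of the mollified components is bounded by the supremum of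
the field. -/
theorem exists_abs_euclideanDiv_mollify_le {k : EuclideanSpace ℝ (Fin d) → ℝ} {r : ℝ}
    (hk : IsMollifier k r) (α : ι) : ∃ A : ℝ, 0 ≤ A ∧
    ∀ (X : Π x : M, TangentSpace (𝓡 d) x) (N : ℝ),
      IntegrableOn (chartRep (φ α) X) (φ α).target →
      (∀ᵐ x ∂(riemannianMeasure d M), ‖X x‖ ≤ N) →
      ∀ η, |euclideanDiv (mollify k (φ α).target (chartRep (φ α) X)) η| ≤ A * N := by
  have hv := volume_target_lt_top hφ hψ hκ0 hκ α
  obtain ⟨C, hC0, hC⟩ := hk.exists_bound (G := EuclideanSpace ℝ (Fin d))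
  -- `d` bounds the trace by the operator norm, `C` is the `L^1`-to-`C^1` constant of the kernel,
  -- and the rest bounds the `L^1` norm of the components per unit of `N`.
  refine ⟨d * (C * (volume.real (φ α).target * κ)), by positivity, fun X N hX hN η ↦ ?_⟩
  have h := (hC (φ α).open_target.measurableSet hX η).2
  have hi : ∫ ξ in (φ α).target, ‖chartRep (φ α) X ξ‖ ≤ volume.real (φ α).target * (κ * N) := by
    have := integral_mono_ae hX.norm
      (integrableOn_const (C := κ * N) hv.ne) ((hκ α).ae_norm_chartRep_le hκ0 (hφ α) hN)
    rwa [setIntegral_const, smul_eq_mul] at this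
  calc _ ≤ d * (C * (volume.real (φ α).target * (κ * N))) := by
        refine (abs_euclideanDiv_le _ _).trans ?_
        gcongr
        exact h.trans (mul_le_mul_of_nonneg_left hi hC0)
    _ = _ := by ring

variable {ζ : EuclideanSpace ℝ (Fin d) → ℝ}
  (hζ : ∀ n : ℕ, 1 ≤ n → IsMollifier (rescaledKernel ζ n) ((n : ℝ)⁻¹))
include hζ

/-- For large `n` the kernels fit in the charts and the bound is uniform. Finitely many `n` remain,
and the sum of their crude constants dominates each of them. -/
theorem exists_neg_le_euclideanDiv_mollify_rescaledKernel (α : ι) : ∃ A : ℝ, 0 ≤ A ∧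
    ∀ n : ℕ, 1 ≤ n → ∀ (X : Π x : M, TangentSpace (𝓡 d) x) (h : M → ℝ) (a N : ℝ),
      0 ≤ a → 0 ≤ N → IsDivergence X h → IntegrableOn (chartRep (φ α) X) (φ α).target →
      (∀ᵐ x ∂(riemannianMeasure d M), -a ≤ h x) →
      (∀ᵐ x ∂(riemannianMeasure d M), ‖X x‖ ≤ N) →
      ∀ η ∈ chartSupport φ ψ α, -(a + A * N) ≤
        euclideanDiv (mollify (rescaledKernel ζ n) (φ α).target (chartRep (φ α) X)) η := by
  obtain ⟨δ, hδ0, hδ⟩ := exists_cthickening hφ hψ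
  obtain ⟨R, hR0, hR⟩ := (hκ α).exists_neg_le_euclideanDiv_mollify hκ0 (hφ α) (hδ α)
  have hA : ∀ n : ℕ, ∃ A : ℝ, 0 ≤ A ∧ (1 ≤ n → ∀ (X : Π x : M, TangentSpace (𝓡 d) x) (N : ℝ),
      IntegrableOn (chartRep (φ α) X) (φ α).target →
      (∀ᵐ x ∂(riemannianMeasure d M), ‖X x‖ ≤ N) → ∀ η,
      |euclideanDiv (mollify (rescaledKernel ζ n) (φ α).target (chartRep (φ α) X)) η|
        ≤ A * N) := fun n ↦ by
    by_cases hn : 1 ≤ n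
    · obtain ⟨A, hA0, hA⟩ := exists_abs_euclideanDiv_mollify_le hφ hψ hκ0 hκ (hζ n hn) α
      exact ⟨A, hA0, fun _ ↦ hA⟩
    · exact ⟨0, le_rfl, fun h ↦ absurd h hn⟩
  choose A hA0 hA using hA
  obtain ⟨n₀, hn₀⟩ := exists_nat_gt δ⁻¹
  have hs0 : 0 ≤ ∑ n ∈ Finset.range n₀, A n := Finset.sum_nonneg fun n _ ↦ hA0 n
  refine ⟨R + ∑ n ∈ Finset.range n₀, A n, by positivity,
    fun n hn X h a N ha0 hN0 hX hXi ha hN η hη ↦ ?_⟩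
  rcases lt_or_ge n n₀ with hlt | hge
  · have h1 := (abs_le.1 (hA n hn X N hXi hN η)).1
    have h2 : A n ≤ R + ∑ n ∈ Finset.range n₀, A n :=
      (Finset.single_le_sum (fun n _ ↦ hA0 n) (Finset.mem_range.2 hlt)).trans
        (le_add_of_nonneg_left hR0)
    have h3 := mul_le_mul_of_nonneg_right h2 hN0
    linarith
  · have hnδ : (n : ℝ)⁻¹ ≤ δ := by
      have h1 : δ⁻¹ ≤ n := hn₀.le.trans (by exact_mod_cast hge)
      exact inv_le_of_inv_le₀ hδ0 h1
    have h1 := hR _ _ (hζ n hn) hnδ X h a N hX hXi ha hN η hη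
    have h2 : 0 ≤ (∑ n ∈ Finset.range n₀, A n) * N := by positivity
    linarith

theorem exists_divergence_mollifiedField_bound : ∃ C : ℝ≥0, 0 < C ∧
    ∀ X : Π x : M, TangentSpace (𝓡 d) x, fieldLpNorm ⊤ X < ⊤ →
      ∀ divX : M → ℝ, IsDivergence X divX →
        eLpNorm (fun x ↦ max (-divX x) 0) ⊤ (riemannianMeasure d M) < ⊤ →
        ∀ n : ℕ, 1 ≤ n →
          ∃ divXn : M → ℝ, IsDivergence (mollifiedField ζ φ ψ X n) divXn ∧
            eLpNorm (fun x ↦ max (-divXn x) 0) ⊤ (riemannianMeasure d M) ≤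
              C * (eLpNorm (fun x ↦ max (-divX x) 0) ⊤ (riemannianMeasure d M)
                + fieldLpNorm ⊤ X) := by
  choose A hA0 hA using exists_neg_le_euclideanDiv_mollify_rescaledKernel hφ hψ hκ0 hκ hζ
  obtain ⟨B, hB0, hB⟩ := exists_neg_le_assembledDiv hφ hψ hκ0 hκ
  have hS0 : 0 ≤ ∑ α, A α := Finset.sum_nonneg fun α _ ↦ hA0 α
  set S := ∑ α, A α
  -- From `exists_neg_le_assembledDiv` with `m = a + S N` and components bounded by `κ N`; the final
  -- `1` makes `c` positive.
  obtain ⟨c, hcdef⟩ : ∃ c : ℝ, c = Fintype.card ι * (1 + S) + B * κ + 1 := ⟨_, rfl⟩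
  have hc : 0 < c := by
    rw [hcdef]
    positivity
  refine ⟨c.toNNReal, Real.toNNReal_pos.2 hc, fun X hXtop divX hX hdivtop n hn ↦ ?_⟩
  have hXi (α) := integrableOn_chartRep hφ hψ hκ0 hκ hX.1 le_rfl ENNReal.one_ne_top hX.2.1 α
  have hu (α) : ContDiffOn ℝ ∞
      (mollify (rescaledKernel ζ n) (φ α).target (chartRep (φ α) X)) (φ α).target :=
    ((hζ n hn).contDiff_mollify (φ α).open_target.measurableSet (hXi α)).contDiffOn
  refine ⟨assembledDiv φ ψ
    fun α ↦ mollify (rescaledKernel ζ n) (φ α).target (chartRep (φ α) X), ?_, ?_⟩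
  · rw [mollifiedField_eq_assembleField]
    exact isDivergence_assembleField hφ hψ hκ0 hκ hu
  set a := (eLpNorm (fun x ↦ max (-divX x) 0) ⊤ (riemannianMeasure d M)).toReal with ha
  set N := (fieldLpNorm ⊤ X).toReal with hN
  have ha0 : 0 ≤ a := ENNReal.toReal_nonneg
  have hN0 : 0 ≤ N := ENNReal.toReal_nonneg
  have haX : ∀ᵐ x ∂(riemannianMeasure d M), -a ≤ divX x := by
    filter_upwards [ae_norm_le_toReal_eLpNorm_top hdivtop] with x hx
    have h1 := (le_abs_self _).trans hx
    linarith [le_max_left (-divX x) 0]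
  have hNX : ∀ᵐ x ∂(riemannianMeasure d M), ‖X x‖ ≤ N := by
    filter_upwards [ae_norm_le_toReal_eLpNorm_top hXtop] with x hx
    rwa [norm_norm] at hx
  have hbound (x : M) : -(c * (a + N)) ≤ assembledDiv φ ψ
      (fun α ↦ mollify (rescaledKernel ζ n) (φ α).target (chartRep (φ α) X)) x := by
    refine le_trans ?_ (hB _ hu (a + S * N) (κ * N) (by positivity) (by positivity)
      (fun α η hη ↦ ⟨?_, ?_⟩) x)
    · have h1 : 0 ≤ Fintype.card ι * (S * a + N) + B * κ * a + (a + N) := by positivity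
      rw [hcdef]
      linarith
    · refine le_trans ?_ (hA α n hn X divX a N ha0 hN0 hX (hXi α) haX hNX η hη)
      have h1 : A α ≤ S := Finset.single_le_sum (fun α _ ↦ hA0 α) (Finset.mem_univ α)
      linarith [mul_le_mul_of_nonneg_right h1 hN0]
    · exact (hζ n hn).norm_mollify_le ((hκ α).ae_norm_chartRep_le hκ0 (hφ α) hNX)
        (by positivity)
  have hfin : eLpNorm (fun x ↦ max (-assembledDiv φ ψ
      (fun α ↦ mollify (rescaledKernel ζ n) (φ α).target (chartRep (φ α) X)) x) 0) ⊤
      (riemannianMeasure d M) ≤ ENNReal.ofReal (c * (a + N)) := by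
    rw [eLpNorm_exponent_top]
    refine eLpNormEssSup_le_of_ae_bound (Eventually.of_forall fun x ↦ ?_)
    rw [Real.norm_of_nonneg (le_max_right _ _)]
    exact max_le (by linarith [hbound x]) (by positivity)
  refine hfin.trans_eq ?_
  rw [ENNReal.ofReal_mul hc.le, ENNReal.ofReal_add ha0 hN0, ha, hN,
    ENNReal.ofReal_toReal hdivtop.ne, ENNReal.ofReal_toReal hXtop.ne]
  rfl

end DivergenceBound

end RiemannianMollification

end

theorem mainTheorem4 {d : ℕ} {M : Type*} [TopologicalSpace M] [T2Space M] [CompactSpace M]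
    [ConnectedSpace M] [ChartedSpace (EuclideanSpace ℝ (Fin d)) M] [IsManifold (𝓡 d) ∞ M]
    [RiemannianBundle (fun x : M ↦ TangentSpace (𝓡 d) x)]
    [IsContMDiffRiemannianBundle (𝓡 d) ∞ (EuclideanSpace ℝ (Fin d))
      (fun x : M ↦ TangentSpace (𝓡 d) x)]
    [MeasurableSpace M] [BorelSpace M]
    {ι : Type*} [Fintype ι]
    (φ : ι → OpenPartialHomeomorph M (EuclideanSpace ℝ (Fin d)))
    (hφ : ∀ α, φ α ∈ IsManifold.maximalAtlas (𝓡 d) ∞ M)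
    (lam : ℝ) (hlam : 0 < lam)
    (hmetric : ∀ α, ∀ x ∈ (φ α).source, ∀ w : EuclideanSpace ℝ (Fin d),
      lam * ‖w‖ ^ 2 ≤ ‖ofChartComponents (φ α) x w‖ ^ 2 ∧
        ‖ofChartComponents (φ α) x w‖ ^ 2 ≤ lam⁻¹ * ‖w‖ ^ 2)
    (ψ : SmoothPartitionOfUnity ι (𝓡 d) M Set.univ)
    (hψ : ψ.IsSubordinate (fun α ↦ (φ α).source))
    (ζ : EuclideanSpace ℝ (Fin d) → ℝ) (hζ_smooth : ContDiff ℝ ∞ ζ) (hζ_nonneg : ∀ ξ, 0 ≤ ζ ξ)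
    (hζ_supp : Function.support ζ ⊆ Metric.ball 0 1) (hζ_int : ∫ ξ, ζ ξ = 1) :
    (∀ p : ℝ≥0∞, 1 ≤ p → p ≠ ⊤ → ∀ X : (x : M) → TangentSpace (𝓡 d) x, MemSobolev p X →
      (∀ n : ℕ, 1 ≤ n → IsSmoothField (mollifiedField ζ φ ψ X n)) ∧
      Tendsto (fun n : ℕ ↦ sobolevNorm p (fun x ↦ X x - mollifiedField ζ φ ψ X n x))
        atTop (𝓝 0)) ∧
    ∃ C : ℝ≥0, 0 < C ∧
      ∀ p : ℝ≥0∞, 1 ≤ p → p ≠ ⊤ → ∀ X : (x : M) → TangentSpace (𝓡 d) x, MemSobolev p X →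
        fieldLpNorm ⊤ X < ⊤ →
        ∀ divX : M → ℝ, IsDivergence X divX →
          eLpNorm (fun x ↦ max (-divX x) 0) ⊤ (riemannianMeasure d M) < ⊤ →
          ∀ n : ℕ, 1 ≤ n →
            ∃ divXn : M → ℝ, IsDivergence (mollifiedField ζ φ ψ X n) divXn ∧
              eLpNorm (fun x ↦ max (-divXn x) 0) ⊤ (riemannianMeasure d M) ≤
                C * (eLpNorm (fun x ↦ max (-divX x) 0) ⊤ (riemannianMeasure d M)
                  + fieldLpNorm ⊤ X) := by
  -- Both metric bounds become bilipschitz bounds with the same constant `κ = lam^{-1/2}`.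
  have hκ0 : 0 < Real.sqrt lam⁻¹ := Real.sqrt_pos.2 (inv_pos.2 hlam)
  have hκ (α) : IsBilipschitzChart (φ α) (Real.sqrt lam⁻¹) :=
    isBilipschitzChart_of_metric_bounds (hφ α) hlam (hmetric α)
  have hζ (n : ℕ) (hn : 1 ≤ n) : IsMollifier (rescaledKernel ζ n) ((n : ℝ)⁻¹) :=
    isMollifier_rescaledKernel hζ_smooth hζ_nonneg hζ_supp hζ_int hn
  refine ⟨fun p hp hp' X hX ↦ ⟨fun n hn ↦ ?_, ?_⟩, ?_⟩
  · exact isSmoothField_mollifiedField hφ hψ hκ0 hκ hζ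
      (hX.integrableOn_chartRep hφ hψ hκ0 hκ hp hp') hn
  · exact tendsto_sobolevNorm_sub_mollifiedField hφ hψ hκ0 hκ hζ hp hp' hX
  · obtain ⟨C, hC, h⟩ := exists_divergence_mollifiedField_bound hφ hψ hκ0 hκ hζ
    exact ⟨C, hC, fun p _ _ X _ ↦ h X⟩
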